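/- **Proposition (Kuga–Satake families).** Let $m\ge 7$, let $(V,q)$ be a rational quadratic space of signature $(2,m)$, and let $D$ be the Hermitian symmetric domain of type $\mathrm{IV}_m$ attached to it: one of the two connected components of the space of oriented positive definite planes in $V_{\mathbb R}$. A plane with oriented orthonormal basis $e_0,e_1$ is recorded by $J=e_0e_1\in C^+(V_{\mathbb R})$ (the even Clifford algebra), so that $J^2=-1$. Let $\Lambda\subset C^+(V)$ be a full lattice, let $\Gamma\le \mathrm{Spin}(V)(\mathbb Q)$ be a torsion-free congruence subgroup with $\Gamma\Lambda\subseteq\Lambda$ (left multiplication), and let $\pi:\mathscr A\to\Gamma\backslash D$ be the corresponding Kuga–Satake family, whose fibre over $J$ is the abelian variety $C^+(V_{\mathbb R})/\Lambda$ with complex structure left multiplication by $J$. Let $n=\lfloor m/2\rfloor+1$ be the rank of $\mathfrak g=\mathfrak{so}(m+2,\mathbb C)$. Write weights in the standard coordinates $e_1,\dots,e_n$ for a Cartan subalgebra containing the grading element ${\tt E}=iJ$ at a point $J$ of $D$, where ${\tt E}(e_1)=-2$ and ${\tt E}(e_i)=0$ for $i>1$, so that $\sigma_1=e_1-e_2$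 is the only noncompact simple root; $\tt E$ acts by $p-p'$ on Hodge type $(p,p')$. Put $\omega_1=e_1$ and $\omega_n=\tfrac12(e_1+\dots+e_n)$. For a dominant weight $\lambda$ put $\mu(\lambda)=\tfrac12\big({\tt E}({\tt s}(\lambda+\rho)-\rho)-1\big)$, where $\tt s$ is the reflection in $\sigma_1$ and $\rho$ is the half sum of the positive roots. An irreducible homogeneous real variation of Hodge structure $\mathcal W$ on $\Gamma\backslash D$, given by an irreducible real representation of $\mathrm{Spin}(2,m)$ whose complexification contains the irreducible representation $V^\lambda$ of highest weight $\lambda$, is said to have an infinitesimal normal function if $\mu(\lambda)\ge 0$; it is reduced if the level of $\mathcal W$ is $>1$. Then the relative cohomology of $\mathscr A$ admits reduced infinitesimal normal functions. More precisely, $R^3\pi_*\mathbb R$ contains an irreducible homogeneous real sub-variation of Hodge structure $\mathcal W$, of level $>1$, whose complexification contains $V^{\omega_1+\omega_n}$; one has $\mu(\omega_1+\omega_n)\ge 0$; and, after the Tate twist that places $\mathcal W$ in weight $-1$, for the non-negative integer $j=\mu(\omega_1+\omega_n)$ the middle cohomology $\mathcal H^1(j)$ of $$\mathrm{Gr}_F^{j}\mathcal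 W\to \mathrm{Gr}_F^{j-1}\mathcal W\otimes\Omega^1\to \mathrm{Gr}_F^{j-2}\mathcal W\otimes\Omega^2$$ (with the $\mathcal O$-linear differentials induced by the Gauss–Manin connection) is nonzero at every point of $D$. -/

import Mathlib

open scoped TensorProduct

namespace KugaSatake

noncomputable section

/-! ### The quadratic space, the even Clifford algebra and the spin group -/

/-- The real quadratic form `q_ℝ` on `V_ℝ = ℝ ⊗ V`. -/
abbrev realForm {V : Type*} [AddCommGroup V] [Module ℚ V] (q : QuadraticForm ℚ V) :
    QuadraticForm ℝ (ℝ ⊗[ℚ] V) :=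
  q.baseChange ℝ

/-- The real even Clifford algebra `C⁺(V_ℝ)`. -/
abbrev EvenCl {V : Type*} [AddCommGroup V] [Module ℚ V] (q : QuadraticForm ℚ V) : Type _ :=
  CliffordAlgebra.even (realForm q)

/-- The product `v w ∈ C⁺(V_ℝ)` of two vectors of `V_ℝ`. -/
def vecMul {V : Type*} [AddCommGroup V] [Module ℚ V] (q : QuadraticForm ℚ V)
    (v w : ℝ ⊗[ℚ] V) : EvenCl q :=
  (CliffordAlgebra.even.ι (realForm q)).bilin v w

/-- An element of `Spin(V_ℝ)` as an element of `C⁺(V_ℝ)`. -/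
def spinToEven {V : Type*} [AddCommGroup V] [Module ℚ V] {q : QuadraticForm ℚ V}
    (g : spinGroup (realForm q)) : EvenCl q :=
  ⟨g.1, g.2.2⟩

theorem ofBaseChangeAux_mem_even {V : Type*} [AddCommGroup V] [Module ℚ V]
    (q : QuadraticForm ℚ V) (x : CliffordAlgebra q) (hx : x ∈ CliffordAlgebra.even q) :
    CliffordAlgebra.ofBaseChangeAux ℝ q x ∈ CliffordAlgebra.even (realForm q) := by
  induction x, hx using CliffordAlgebra.even_induction with
  | algebraMap r =>
    rw [AlgHom.commutes, IsScalarTower.algebraMap_apply ℚ ℝ]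
    exact Subalgebra.algebraMap_mem _ _
  | add x y hx hy ihx ihy =>
    rw [map_add]
    exact add_mem ihx ihy
  | ι_mul_ι_mul m₁ m₂ x hx ih =>
    rw [map_mul, map_mul, CliffordAlgebra.ofBaseChangeAux_ι, CliffordAlgebra.ofBaseChangeAux_ι]
    exact mul_mem (CliffordAlgebra.ι_mul_ι_mem_evenOdd_zero _ _ _) ih

/-- The inclusion `C⁺(V) → C⁺(V_ℝ)` of the rational even Clifford algebra into the real one. -/
def evenToReal {V : Type*} [AddCommGroup V] [Module ℚ V] {q : QuadraticForm ℚ V}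
    (x : CliffordAlgebra.even q) : EvenCl q :=
  ⟨CliffordAlgebra.ofBaseChangeAux ℝ q x, ofBaseChangeAux_mem_even q x x.2⟩

/-- An element of `Spin(V)(ℚ)` as an element of the rational even Clifford algebra `C⁺(V)`. -/
def spinToEvenRat {V : Type*} [AddCommGroup V] [Module ℚ V] {q : QuadraticForm ℚ V}
    (γ : spinGroup q) : CliffordAlgebra.even q :=
  ⟨γ.1, γ.2.2⟩

/-- An orthonormal basis `b₀, …, b_{m+1}` of `V_ℝ` adapted to the signature `(2, m)`:
`b₀, b₁` have square `1` and the others have square `-1`. -/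
structure Frame {V : Type*} [AddCommGroup V] [Module ℚ V] (q : QuadraticForm ℚ V) (m : ℕ) where
  basis : Module.Basis (Fin (m + 2)) ℝ (ℝ ⊗[ℚ] V)
  form_apply : ∀ i, realForm q (basis i) = if i.val < 2 then 1 else -1
  orthogonal : ∀ i j, i ≠ j → QuadraticMap.polar (realForm q) (basis i) (basis j) = 0

/-- The point `J = b₀ b₁ ∈ C⁺(V_ℝ)` (so `J² = -1`) determined by the oriented positive definite
plane spanned by `b₀, b₁`. -/
def Frame.J {V : Type*} [AddCommGroup V] [Module ℚ V] {q : QuadraticForm ℚ V} {m : ℕ}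
    (b : Frame q m) : EvenCl q :=
  vecMul q (b.basis ⟨0, by omega⟩) (b.basis ⟨1, by omega⟩)

/-! ### Kuga–Satake families -/

/-- The data of a Kuga–Satake family over a quotient `Γ \ D` of the type `IV_m` domain `D` of a
rational quadratic space of signature `(2, m)`.

* A point of `D` is an oriented positive definite plane in `V_ℝ`; it is recorded by the
  product `J = e₀ e₁ ∈ C⁺(V_ℝ)` of an oriented orthonormal basis of the plane. The domain is one
  orbit of `Spin(2, m) = Spin(V_ℝ)` under conjugation (one of the two connected components).
* `lattice` is a full lattice `Λ` in `C⁺(V)`.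
* `Γ` is a torsion-free congruence subgroup of `Spin(V)(ℚ)` preserving `Λ` under left
  multiplication.

The fibre over `J ∈ D` is the torus `C⁺(V_ℝ) / Λ` with the complex structure given by left
multiplication by `J` (it is an abelian variety by the theorem of Kuga and Satake), and the family
is the quotient `TotalSpace` of `D × C⁺(V_ℝ)`. -/
structure Family {V : Type*} [AddCommGroup V] [Module ℚ V] (q : QuadraticForm ℚ V) (m : ℕ) where
  domain : Set (EvenCl q)
  domain_orbit : ∃ b : Frame q m,
    domain = {J | ∃ g : spinGroup (realForm q), J = spinToEven g * b.J * spinToEven g⁻¹}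
  lattice : Submodule ℤ (CliffordAlgebra.even q)
  lattice_fg : lattice.FG
  lattice_span : Submodule.span ℚ (lattice : Set (CliffordAlgebra.even q)) = ⊤
  Γ : Subgroup (spinGroup q)
  Γ_lattice : ∀ γ ∈ Γ, ∀ x ∈ lattice, spinToEvenRat γ * x ∈ lattice
  Γ_congruence : ∃ N : ℕ, 0 < N ∧ ∀ γ : spinGroup q,
    (∀ x ∈ lattice, ∃ y ∈ lattice, spinToEvenRat γ * x - x = N • y) → γ ∈ Γ
  Γ_torsionFree : ∀ γ ∈ Γ, ∀ N : ℕ, 0 < N → γ ^ N = 1 → γ = 1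

/-- The base `Γ \ D`. -/
def Family.Base {V : Type*} [AddCommGroup V] [Module ℚ V] {q : QuadraticForm ℚ V} {m : ℕ}
    (F : Family q m) : Type _ :=
  Quot fun J J' : F.domain => ∃ γ ∈ F.Γ,
    (J' : EvenCl q) = evenToReal (spinToEvenRat γ) * J * evenToReal (spinToEvenRat γ⁻¹)

/-- The total space `(Γ ⋉ Λ) \ (D × C⁺(V_ℝ))` of the Kuga–Satake family. -/
def Family.TotalSpace {V : Type*} [AddCommGroup V] [Module ℚ V] {q : QuadraticForm ℚ V} {m : ℕ}
    (F : Family q m) : Type _ :=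
  Quot fun P P' : F.domain × EvenCl q => ∃ γ ∈ F.Γ, ∃ l ∈ F.lattice,
    (P'.1 : EvenCl q) = evenToReal (spinToEvenRat γ) * P.1 * evenToReal (spinToEvenRat γ⁻¹) ∧
      P'.2 = evenToReal (spinToEvenRat γ) * P.2 + evenToReal l

/-- The projection of the Kuga–Satake family to its base. -/
def Family.proj {V : Type*} [AddCommGroup V] [Module ℚ V] {q : QuadraticForm ℚ V} {m : ℕ}
    (F : Family q m) : F.TotalSpace → F.Base :=
  Quot.map Prod.fst fun _ _ ⟨γ, hγ, _, _, h, _⟩ => ⟨γ, hγ, h⟩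

/-! ### Relative cohomology -/

/-- The degree `k` cohomology, with coefficients in `R = ℝ` or `ℂ`, of the torus `C⁺(V_ℝ) / Λ`:
invariant forms, i.e. alternating `ℝ`-multilinear `k`-forms on `C⁺(V_ℝ) = H₁(torus, ℝ)`. -/
abbrev Coh {V : Type*} [AddCommGroup V] [Module ℚ V] (q : QuadraticForm ℚ V) (k : ℕ)
    (R : Type*) [AddCommGroup R] [Module ℝ R] : Type _ :=
  (EvenCl q) [⋀^Fin k]→ₗ[ℝ] R

/-- The pullback of a form under left multiplication by `a ∈ C⁺(V_ℝ)`. The left action of a group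
element `g` on cohomology is `pullback g⁻¹`. -/
def pullback {V : Type*} [AddCommGroup V] [Module ℚ V] {q : QuadraticForm ℚ V} {k : ℕ}
    {R : Type*} [AddCommGroup R] [Module ℝ R] (a : EvenCl q) (ω : Coh q k R) : Coh q k R :=
  ω.compLinearMap (LinearMap.mulLeft ℝ a)

/-- The inclusion of real into complex cohomology. -/
def toComplex {V : Type*} [AddCommGroup V] [Module ℚ V] {q : QuadraticForm ℚ V} {k : ℕ}
    (ω : Coh q k ℝ) : Coh q k ℂ :=
  (Algebra.linearMap ℝ ℂ).compAlternatingMap ω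

/-- The complexification `W_ℂ` of a real subspace `W` of the real cohomology. -/
def complexify {V : Type*} [AddCommGroup V] [Module ℚ V] {q : QuadraticForm ℚ V} {k : ℕ}
    (W : Submodule ℝ (Coh q k ℝ)) : Submodule ℂ (Coh q k ℂ) :=
  Submodule.span ℂ (toComplex '' (W : Set (Coh q k ℝ)))

/-- The Hodge piece `H^{p, k-p}` of the fibre at `J`: the forms on which the complex scalar
`z = x + i y`, acting on `C⁺(V_ℝ)` as `x + y J`, acts by `z^p \bar z^{k-p}`. -/
def hodgePiece {V : Type*} [AddCommGroup V] [Module ℚ V] {q : QuadraticForm ℚ V} {k : ℕ}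
    (J : EvenCl q) (p : ℤ) : Submodule ℂ (Coh q k ℂ) where
  carrier := {ω | ∀ z : ℂ, z ≠ 0 →
    pullback (algebraMap ℝ (EvenCl q) z.re + z.im • J) ω
      = (z ^ p * (starRingEnd ℂ z) ^ ((k : ℤ) - p)) • ω}
  add_mem' {ω η} hω hη z hz := by
    rw [smul_add, ← hω z hz, ← hη z hz]
    rfl
  zero_mem' z _ := by
    rw [smul_zero]
    rfl
  smul_mem' c ω hω z hz := by
    rw [smul_comm, ← hω z hz]
    rfl

/-! ### The complexified Lie algebra action -/

theorem infAct_aux {M : Type*} [AddCommGroup M] [Module ℝ M] {k : ℕ} (L : M →ₗ[ℝ] M)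
    (ω : M [⋀^Fin k]→ₗ[ℝ] ℂ) (x : Fin k → M) (i₀ i₁ : Fin k) (h : x i₀ = x i₁) (hne : i₀ ≠ i₁) :
    ∑ j : Fin k, ω (Function.update x j (L (x j))) = 0 := by
  have hsub : ∑ j ∈ ({i₀, i₁} : Finset (Fin k)), ω (Function.update x j (L (x j)))
      = ∑ j : Fin k, ω (Function.update x j (L (x j))) := by
    refine Finset.sum_subset (Finset.subset_univ _) fun j _ hj => ?_
    simp only [Finset.mem_insert, Finset.mem_singleton, not_or] at hj
    refine ω.map_eq_zero_of_eq _ ?_ hne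
    rw [Function.update_of_ne (Ne.symm hj.1), Function.update_of_ne (Ne.symm hj.2), h]
  rw [← hsub, Finset.sum_pair hne]
  have hsw : Function.update x i₁ (L (x i₁))
      = Function.update x i₀ (L (x i₀)) ∘ Equiv.swap i₀ i₁ := by
    funext i
    rcases eq_or_ne i i₁ with rfl | h1
    · simp [h]
    rcases eq_or_ne i i₀ with rfl | h0
    · simp [hne, hne.symm, h]
    · simp [Equiv.swap_apply_of_ne_of_ne h0 h1, h0, h1]
  rw [hsw, ω.map_swap _ hne, add_neg_cancel]

/-- The derivation `(L · ω)(x₁, …, x_k) = - ∑ⱼ ω(x₁, …, L xⱼ, …, x_k)` of forms, i.e. the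
derivative at the identity of the action `g · ω = ω ∘ g⁻¹`. -/
def infAct {M : Type*} [AddCommGroup M] [Module ℝ M] {k : ℕ} (L : M →ₗ[ℝ] M)
    (ω : M [⋀^Fin k]→ₗ[ℝ] ℂ) : M [⋀^Fin k]→ₗ[ℝ] ℂ where
  toMultilinearMap := -∑ j : Fin k, ω.toMultilinearMap.compLinearMap
    (Function.update (fun _ => LinearMap.id) j L)
  map_eq_zero_of_eq' x i₀ i₁ h hne := by
    have key : ∀ j : Fin k, (fun i => Function.update
        (fun _ => (LinearMap.id : M →ₗ[ℝ] M)) j L i (x i)) = Function.update x j (L (x j)) := by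
      intro j
      funext i
      rcases eq_or_ne i j with rfl | hij
      · simp
      · simp [hij]
    simpa [key] using infAct_aux L ω x i₀ i₁ h hne

theorem infAct_apply {M : Type*} [AddCommGroup M] [Module ℝ M] {k : ℕ} (L : M →ₗ[ℝ] M)
    (ω : M [⋀^Fin k]→ₗ[ℝ] ℂ) (x : Fin k → M) :
    infAct L ω x = -∑ j : Fin k, ω (Function.update x j (L (x j))) := by
  have key : ∀ j : Fin k, (fun i => Function.update
      (fun _ => (LinearMap.id : M →ₗ[ℝ] M)) j L i (x i)) = Function.update x j (L (x j)) := by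
    intro j
    funext i
    rcases eq_or_ne i j with rfl | hij
    · simp
    · simp [hij]
  change (-∑ j : Fin k, ω.toMultilinearMap.compLinearMap
    (Function.update (fun _ => LinearMap.id) j L)) x = _
  simp [key]

/-- `infAct` as a linear map. -/
def infActLin (M : Type*) [AddCommGroup M] [Module ℝ M] (k : ℕ) :
    (M →ₗ[ℝ] M) →ₗ[ℝ] ((M [⋀^Fin k]→ₗ[ℝ] ℂ) →ₗ[ℂ] (M [⋀^Fin k]→ₗ[ℝ] ℂ)) where
  toFun L :=
    { toFun := infAct L
      map_add' := fun ω η => by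
        ext x
        simp only [infAct_apply, AlternatingMap.add_apply, Finset.sum_add_distrib, neg_add]
      map_smul' := fun c ω => by
        ext x
        simp only [infAct_apply, AlternatingMap.smul_apply, ← Finset.smul_sum, smul_neg,
          RingHom.id_apply] }
  map_add' L L' := by
    ext ω x
    simp only [LinearMap.coe_mk, AddHom.coe_mk, LinearMap.add_apply, AlternatingMap.add_apply,
      infAct_apply, AlternatingMap.map_update_add, Finset.sum_add_distrib, neg_add]
  map_smul' c L := by
    ext ω x
    simp only [LinearMap.coe_mk, AddHom.coe_mk, LinearMap.smul_apply, AlternatingMap.smul_apply,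
      infAct_apply, AlternatingMap.map_update_smul, ← Finset.smul_sum, smul_neg, RingHom.id_apply]

/-- The complex-linear extension to `ℂ ⊗ C⁺(V_ℝ)` of the infinitesimal left multiplication action
`a · ω = - ∑ⱼ ω(…, a xⱼ, …)` on cohomology. -/
def cAct {V : Type*} [AddCommGroup V] [Module ℚ V] (q : QuadraticForm ℚ V) (k : ℕ) :
    (ℂ ⊗[ℝ] EvenCl q) →ₗ[ℂ] (Coh q k ℂ →ₗ[ℂ] Coh q k ℂ) :=
  LinearMap.liftBaseChange ℂ (infActLin (EvenCl q) k ∘ₗ LinearMap.mul ℝ (EvenCl q))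

/-- The complexified Lie algebra `𝔤 = spin(V_ℝ) ⊗ ℂ` inside `ℂ ⊗ C⁺(V_ℝ)`, spanned by the
commutators `v w - w v` of vectors. -/
def lieAlg {V : Type*} [AddCommGroup V] [Module ℚ V] (q : QuadraticForm ℚ V) :
    Submodule ℂ (ℂ ⊗[ℝ] EvenCl q) :=
  Submodule.span ℂ {X | ∃ v w, X = 1 ⊗ₜ[ℝ] (vecMul q v w - vecMul q w v)}

/-- The grading element `E = i J` at the point `J` of the domain. It acts on the part of type
`(p, p')` of any of the variations below by `p - p'`. -/
def gradingElt {V : Type*} [AddCommGroup V] [Module ℚ V] {q : QuadraticForm ℚ V}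
    (J : EvenCl q) : ℂ ⊗[ℝ] EvenCl q :=
  Complex.I ⊗ₜ[ℝ] J

/-- The subalgebra `𝔫 = 𝔤^{-1,1}` of `𝔤` at the point `J`, which is the holomorphic tangent
space of the domain at `J`. -/
def nilp {V : Type*} [AddCommGroup V] [Module ℚ V] {q : QuadraticForm ℚ V}
    (J : EvenCl q) : Submodule ℂ (ℂ ⊗[ℝ] EvenCl q) where
  carrier := {X | X ∈ lieAlg q ∧ gradingElt J * X - X * gradingElt J = (-2 : ℂ) • X}
  add_mem' {X Y} hX hY := by
    refine ⟨add_mem hX.1 hY.1, ?_⟩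
    rw [smul_add, ← hX.2, ← hY.2, mul_add, add_mul]
    abel
  zero_mem' := ⟨zero_mem _, by simp⟩
  smul_mem' c X hX := by
    refine ⟨Submodule.smul_mem _ _ hX.1, ?_⟩
    rw [smul_comm, ← hX.2, smul_sub, mul_smul_comm, smul_mul_assoc]

/-! ### Weights

The rank of `𝔤` is `n = m / 2 + 1` (natural number division): `m = 2n - 1` for type `B_n` and
`m = 2n - 2` for type `D_n`. A weight `λ = ∑ λⱼ eⱼ` is recorded by its coordinates in the standard
orthonormal basis `e₁, …, e_n`, which has index set `Fin n = {0, …, n - 1}` here. -/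

/-- Weights, in coordinates with respect to `e₁, …, e_n`. -/
abbrev Weight (m : ℕ) : Type := Fin (m / 2 + 1) → ℚ

/-- The basis vector `eⱼ`. -/
def basisWeight {m : ℕ} (j : Fin (m / 2 + 1)) : Weight m := Pi.single j 1

/-- The half sum `ρ` of the positive roots `eᵢ ± eⱼ` (`i < j`) and, if `m` is odd, `eᵢ`. -/
def rho (m : ℕ) : Weight m :=
  (1 / 2 : ℚ) • ((∑ i, ∑ j, if i < j then
      ((basisWeight i - basisWeight j) + (basisWeight i + basisWeight j)) else 0)
    + if Odd m then ∑ i, basisWeight i else 0)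

/-- The distinguished simple root `σ₁ = e₁ - e₂`, the only noncompact simple root. -/
def sigmaI (m : ℕ) : Weight m := basisWeight 0 - basisWeight 1

/-- The reflection `s` in `σ₁`. -/
def reflI {m : ℕ} (lam : Weight m) : Weight m :=
  lam - (2 * (lam ⬝ᵥ sigmaI m) / (sigmaI m ⬝ᵥ sigmaI m)) • sigmaI m

/-- The value `E(λ)` of a weight on the grading element: `E(σ₁) = -2` and `E(σⱼ) = 0` for `j ≠ 1`,
that is, `E(e₁) = -2` and `E(eⱼ) = 0` for `j ≠ 1`. -/
def evalE {m : ℕ} (lam : Weight m) : ℚ := -2 * lam 0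

/-- The invariant `μ(λ) = (E(s · λ) - 1) / 2`, where `s · λ = s(λ + ρ) - ρ`. -/
def mu {m : ℕ} (lam : Weight m) : ℚ := (evalE (reflI (lam + rho m) - rho m) - 1) / 2

/-- The fundamental weight `ω₁ = e₁`. -/
def omegaOne (m : ℕ) : Weight m := basisWeight 0

/-- The fundamental weight `ω_n = (e₁ + ⋯ + e_n) / 2`, highest weight of a (half-)spin
representation. -/
def omegaLast (m : ℕ) : Weight m := (1 / 2 : ℚ) • ∑ i, basisWeight i

namespace Frame

variable {V : Type*} [AddCommGroup V] [Module ℚ V] {q : QuadraticForm ℚ V} {m : ℕ}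

/-- The first vector `b_{2j}` of the `j`-th coordinate plane of the frame. -/
def fst (b : Frame q m) (j : Fin (m / 2 + 1)) : ℝ ⊗[ℚ] V :=
  b.basis ⟨2 * j.val, by omega⟩

/-- The second vector `b_{2j+1}` of the `j`-th coordinate plane of the frame. -/
def snd (b : Frame q m) (j : Fin (m / 2 + 1)) : ℝ ⊗[ℚ] V :=
  b.basis ⟨2 * j.val + 1, by omega⟩

/-- The Cartan element dual to `eⱼ`: with `uⱼ = b_{2j} + i b_{2j+1}`, a complex isotropic vector,
it satisfies `[Hⱼ, uⱼ] = uⱼ` and `[Hⱼ, \bar uⱼ] = -\bar uⱼ`, and it commutes with the other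
vectors of the frame. In particular `E = -2 H₁`. -/
def cartan (b : Frame q m) (j : Fin (m / 2 + 1)) : ℂ ⊗[ℝ] EvenCl q :=
  (-(Complex.I / 2) * (realForm q (b.fst j) : ℂ)) ⊗ₜ[ℝ] vecMul q (b.fst j) (b.snd j)

/-- The product `uᵢ uⱼ` of `uᵢ = b_{2i} + i b_{2i+1}` and `uⱼ = b_{2j} + i b_{2j+1}`: for `i ≠ j` a
root vector of weight `eᵢ + eⱼ`. -/
def rootSum (b : Frame q m) (i j : Fin (m / 2 + 1)) : ℂ ⊗[ℝ] EvenCl q :=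
  1 ⊗ₜ[ℝ] (vecMul q (b.fst i) (b.fst j) - vecMul q (b.snd i) (b.snd j))
    + Complex.I ⊗ₜ[ℝ] (vecMul q (b.snd i) (b.fst j) + vecMul q (b.fst i) (b.snd j))

/-- The product `uᵢ \bar uⱼ` of `uᵢ = b_{2i} + i b_{2i+1}` and `\bar uⱼ = b_{2j} - i b_{2j+1}`: for
`i ≠ j` a root vector of weight `eᵢ - eⱼ`. -/
def rootDiff (b : Frame q m) (i j : Fin (m / 2 + 1)) : ℂ ⊗[ℝ] EvenCl q :=
  1 ⊗ₜ[ℝ] (vecMul q (b.fst i) (b.fst j) + vecMul q (b.snd i) (b.snd j))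
    + Complex.I ⊗ₜ[ℝ] (vecMul q (b.snd i) (b.fst j) - vecMul q (b.fst i) (b.snd j))

/-- The product `uᵢ b_{m+1}` with the last vector of the frame: for `m` odd a root vector of
weight `eᵢ`. -/
def rootShort (b : Frame q m) (i : Fin (m / 2 + 1)) : ℂ ⊗[ℝ] EvenCl q :=
  1 ⊗ₜ[ℝ] vecMul q (b.fst i) (b.basis (Fin.last (m + 1)))
    + Complex.I ⊗ₜ[ℝ] vecMul q (b.snd i) (b.basis (Fin.last (m + 1)))

/-- `ω` is a highest weight vector of weight `λ`: it is nonzero, of weight `λ`, and killed by all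
positive root vectors. -/
structure IsHighestWeightVector (b : Frame q m) {k : ℕ} (lam : Weight m) (ω : Coh q k ℂ) :
    Prop where
  ne_zero : ω ≠ 0
  weight : ∀ j, cAct q k (b.cartan j) ω = ((lam j : ℚ) : ℂ) • ω
  rootSum : ∀ i j, i < j → cAct q k (b.rootSum i j) ω = 0
  rootDiff : ∀ i j, i < j → cAct q k (b.rootDiff i j) ω = 0
  rootShort : Odd m → ∀ i, cAct q k (b.rootShort i) ω = 0

end Frame

/-! ### Real subvariations and infinitesimal normal functions -/

/-- A real sub-variation of Hodge structure of the variation `R^{2r-1}π_* ℝ` of a Kuga–Satake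
family `π`: a `Γ`-stable real subspace of the cohomology whose complexification is, at each point
of the domain, the sum of its intersections with the Hodge pieces. -/
structure SubVHS {V : Type*} [AddCommGroup V] [Module ℚ V] {q : QuadraticForm ℚ V} {m : ℕ}
    (F : Family q m) (r : ℕ) where
  space : Submodule ℝ (Coh q (2 * r - 1) ℝ)
  flat : ∀ γ ∈ F.Γ, ∀ ω ∈ space, pullback (evenToReal (spinToEvenRat γ⁻¹)) ω ∈ space
  hodge : ∀ J ∈ F.domain, complexify space ≤ ⨆ p : ℤ, complexify space ⊓ hodgePiece J p

namespace SubVHS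

variable {V : Type*} [AddCommGroup V] [Module ℚ V] {q : QuadraticForm ℚ V} {m : ℕ}
  {F : Family q m} {r : ℕ}

/-- Stability of a real subspace of the cohomology under `Spin(V_ℝ)`. -/
def IsSpinStable {k : ℕ} (U : Submodule ℝ (Coh q k ℝ)) : Prop :=
  ∀ g : spinGroup (realForm q), ∀ ω ∈ U, pullback (spinToEven g⁻¹) ω ∈ U

/-- `W` is an irreducible homogeneous (Hermitian) real variation: it is given by an irreducible
real representation of `Spin(V_ℝ)`. -/
def IsIrreducibleHomogeneous (W : SubVHS F r) : Prop :=
  IsSpinStable W.space ∧ W.space ≠ ⊥ ∧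
    ∀ U : Submodule ℝ (Coh q (2 * r - 1) ℝ), U ≤ W.space → IsSpinStable U → U = ⊥ ∨ U = W.space

/-- The representation `V^λ` with highest weight `λ` occurs in `W_ℂ`. For `W` irreducible
homogeneous this says that `W` is the real form `Ṽ^λ` of `V^λ` or of `V^λ ⊕ \bar V^λ`. -/
def HasHighestWeight (W : SubVHS F r) (b : Frame q m) (lam : Weight m) : Prop :=
  ∃ ω ∈ complexify W.space, b.IsHighestWeightVector lam ω

/-- The Hodge piece `W^{p, -1-p}` at `J` after the Tate twist by `r`, which places `W` in weight
`-1`. -/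
def piece (W : SubVHS F r) (J : EvenCl q) (p : ℤ) : Submodule ℂ (Coh q (2 * r - 1) ℂ) :=
  complexify W.space ⊓ hodgePiece J (p + r)

/-- The level of `W` at `J`: the largest difference `p - p'` with `W^{p, -1-p}` and
`W^{p', -1-p'}` nonzero. (Pieces outside `-r ≤ p ≤ r - 1` vanish.) -/
def level (W : SubVHS F r) (J : EvenCl q) : ℕ :=
  sSup {d : ℕ | ∃ p p' : ℤ, p ∈ Set.Icc (-r : ℤ) (r - 1) ∧ p' ∈ Set.Icc (-r : ℤ) (r - 1) ∧
    W.piece J p ≠ ⊥ ∧ W.piece J p' ≠ ⊥ ∧ (d : ℤ) = p - p'}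

/-- The fibre at `J` of the cohomology sheaf `ℋ¹(j)`, i.e. the middle cohomology of
`Gr_F^j W → Gr_F^{j-1} W ⊗ Ω¹ → Gr_F^{j-2} W ⊗ Ω²`
with the `𝒪`-linear differential induced by the Gauss–Manin connection, is nonzero. Here the fibre
of `Ω¹` is the dual of `𝔫`, which acts on the fibre of `Gr_F W` through the representation. -/
def InfinitesimalInvariantsNonzero (W : SubVHS F r) (J : EvenCl q) (j : ℤ) : Prop :=
  ∃ θ : nilp J →ₗ[ℂ] Coh q (2 * r - 1) ℂ,
    (∀ X, θ X ∈ W.piece J (j - 1)) ∧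
    (∀ X Y : nilp J, cAct q _ X.1 (θ Y) = cAct q _ Y.1 (θ X)) ∧
    ¬ ∃ w ∈ W.piece J j, ∀ X : nilp J, θ X = cAct q _ X.1 w

end SubVHS

end

end KugaSatake

/-!
Write `C` for the real Clifford algebra, `S = C⁺` for its even part and `u₁, u₂, …` for the
isotropic vectors `b₀ + i b₁`, `b₂ + i b₃`, … of a frame, of weights `e₁, e₂, …`. The third
cohomology of a fibre consists of the alternating `3`-forms on `S`. For linear functionals `φ`,
`ψ` on the complexified Clifford algebra, a vector `U` and an element `P`, the antisymmetrization
of `φ(x̃ U y) ψ(P z)` is such a form (`vectorSpinorForm`). It depends equivariantly on `U`, on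
which the Lie algebra acts by commutators, and on `P`, on which `X` acts by `P ↦ -P X`; so it
realizes "vector tensor spinor" in the cohomology. If `P uⱼ = 0` for all `j`
(`Frame.exists_mul_u_eq_zero`), then `P` is a highest weight vector of weight `ω_n`, and `U = u₁`
gives a highest weight vector of weight `ω₁ + ω_n`. It is nonzero for suitable `φ` and `ψ`: this
is an evaluation at three explicit elements of `S`, which involve the basis vectors up to `b₈`,
and it is here that `m ≥ 7` is used (`Frame.exists_vectorSpinorForm_ne_zero`).

For a positive definite form on `C` that is invariant under left multiplication by all `b_k`, the
adjoint of left multiplication by an element of the spin group is again left multiplication by an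
element of the spin group; so the cohomology is completely reducible. Among the equivariant
endomorphisms `p` of the real cohomology that do not kill the class above, one of minimal rank has
irreducible range (`exists_equivariant_irreducible_range`), and this range is the variation `W`.
It is stable under the Lie algebra because the derivation by `b_i b_j` is a combination of
finitely many group elements (`Frame.cAct_mem_span`), and it is the sum of its Hodge pieces
because these are the eigenspaces of `E = i J` for `±1, ±3`. The image `ω` of the highest weight
vector has type `(0, 3)`, and its conjugate has type `(3, 0)`, so the level is `3`. The number
`μ(ω₁ + ω_n)` is `0`.

For the infinitesimal invariants at `J = b₀ b₁`, let `v` be the image in `W` of the form with `U =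
u₂`. It has type `(1, 2)`. For `X` in `𝔫` the commutator `[X, u₂]` is a vector in the
`H₁`-eigenspace of `u₁`, so `[X, u₂] = f(X) u₁`, while `P X = 0` because `X` is a left multiple of
`u₁`. Hence `X v = f(X) ω`, and `θ = f ⊗ v` is closed, as `X θ(Y) = f(X) f(Y) ω` is symmetric. If
`θ` were exact, `v` would be a multiple of `X₀ w` with `X₀` the root vector of weight `e₁ - e₂`.
But the second Cartan element `H₂` is half of the operator `i K` with `K = b₂ b₃`, `K² = -1`, and
so has only the eigenvalues `±1/2`, `±3/2` on `3`-forms. Since `v` has eigenvalue `3/2` and `X₀`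
lowers the eigenvalue by `1`, this forces `v = 0`, in contradiction to `X₀ v = f(X₀) ω ≠ 0`
(`Frame.eq_zero_of_eq_cAct_rootDiff`, `Frame.exists_infinitesimalInvariant`). The other points of
the domain are reached by rotating the frame by an element of the spin group, which moves `u₁` and
`P` along.
-/

namespace KugaSatake

noncomputable section

/-! ### Alternating three-forms -/

section Trilinear

theorem update_vec_zero {M : Type*} (x y z a : M) :
    Function.update ![x, y, z] 0 a = ![a, y, z] := by
  funext i
  fin_cases i <;> rfl

theorem update_vec_one {M : Type*} (x y z a : M) : Function.update ![x, y, z] 1 a = ![x, a, z] := by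
  funext i
  fin_cases i <;> rfl

theorem update_vec_two {M : Type*} (x y z a : M) : Function.update ![x, y, z] 2 a = ![x, y, a] := by
  funext i
  fin_cases i <;> rfl

variable {M : Type*} [AddCommGroup M] [Module ℝ M] {N : Type*} [AddCommGroup N] [Module ℝ N]

/-- An alternating `3`-form as a curried trilinear map. -/
def tri (ω : M [⋀^Fin 3]→ₗ[ℝ] N) : M →ₗ[ℝ] M →ₗ[ℝ] M →ₗ[ℝ] N where
  toFun x := LinearMap.mk₂ ℝ (fun y z => ω ![x, y, z])
    (fun a b z => by simpa only [update_vec_one] using ω.map_update_add ![x, 0, z] 1 a b)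
    (fun c a z => by simpa only [update_vec_one] using ω.map_update_smul ![x, 0, z] 1 c a)
    (fun y a b => by simpa only [update_vec_two] using ω.map_update_add ![x, y, 0] 2 a b)
    (fun c y a => by simpa only [update_vec_two] using ω.map_update_smul ![x, y, 0] 2 c a)
  map_add' a b := by
    ext y z
    have h := ω.map_update_add ![0, y, z] 0 a b
    simp only [update_vec_zero] at h
    exact h
  map_smul' c a := by
    ext y z
    have h := ω.map_update_smul ![0, y, z] 0 c a
    simp only [update_vec_zero] at h
    exact h

theorem tri_apply (ω : M [⋀^Fin 3]→ₗ[ℝ] N) (x y z : M) : tri ω x y z = ω ![x, y, z] := rfl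

theorem ext_tri {ω η : M [⋀^Fin 3]→ₗ[ℝ] N} (h : ∀ x y z, tri ω x y z = tri η x y z) : ω = η := by
  ext v
  have hv : v = ![v 0, v 1, v 2] := by
    funext i
    fin_cases i <;> rfl
  rw [hv]
  exact h _ _ _

@[simp] theorem tri_add (ω η : M [⋀^Fin 3]→ₗ[ℝ] N) (x y z : M) :
    tri (ω + η) x y z = tri ω x y z + tri η x y z := rfl

@[simp] theorem tri_sub (ω η : M [⋀^Fin 3]→ₗ[ℝ] N) (x y z : M) :
    tri (ω - η) x y z = tri ω x y z - tri η x y z := rfl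

@[simp] theorem tri_zero (x y z : M) : tri (0 : M [⋀^Fin 3]→ₗ[ℝ] N) x y z = 0 := rfl

@[simp] theorem tri_smul (c : ℂ) (ω : M [⋀^Fin 3]→ₗ[ℝ] ℂ) (x y z : M) :
    tri (c • ω) x y z = c * tri ω x y z := rfl

@[simp] theorem tri_compLinearMap (L : M →ₗ[ℝ] M) (ω : M [⋀^Fin 3]→ₗ[ℝ] N) (x y z : M) :
    tri (ω.compLinearMap L) x y z = tri ω (L x) (L y) (L z) := by
  simp only [tri_apply, AlternatingMap.compLinearMap_apply]
  congr 1
  funext i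
  fin_cases i <;> rfl

@[simp] theorem tri_infAct (L : M →ₗ[ℝ] M) (ω : M [⋀^Fin 3]→ₗ[ℝ] ℂ) (x y z : M) :
    tri (infAct L ω) x y z
      = -(tri ω (L x) y z + tri ω x (L y) z + tri ω x y (L z)) := by
  simp [tri_apply, infAct_apply, Fin.sum_univ_three, update_vec_zero, update_vec_one,
    update_vec_two]

/-- The difference of the pullbacks under `c + s L` and `c - s L` isolates the part of the
pullback that is odd in `L`. -/
theorem compLinearMap_sub_compLinearMap (L : M →ₗ[ℝ] M) (c s : ℝ) (ω : M [⋀^Fin 3]→ₗ[ℝ] ℂ) :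
    ω.compLinearMap (c • LinearMap.id + s • L) - ω.compLinearMap (c • LinearMap.id - s • L)
      = ((-2 * c ^ 2 * s : ℝ) : ℂ) • infAct L ω
        + ((2 * s ^ 3 : ℝ) : ℂ) • ω.compLinearMap L := by
  refine ext_tri fun x y z => ?_
  simp only [tri_sub, tri_add, tri_smul, tri_compLinearMap, tri_infAct, LinearMap.add_apply,
    LinearMap.sub_apply, LinearMap.smul_apply, LinearMap.id_apply, map_add, map_sub, map_smul,
    Complex.real_smul]
  push_cast
  ring

/-- If `L² = -1`, then the eigenvalues of `L` on `3`-forms are `± i` and `± 3 i`. -/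
theorem infAct_quartic (L : M →ₗ[ℝ] M) (hL : ∀ x, L (L x) = -x) (ω : M [⋀^Fin 3]→ₗ[ℝ] ℂ) :
    infAct L (infAct L (infAct L (infAct L ω))) + (10 : ℂ) • infAct L (infAct L ω)
      + (9 : ℂ) • ω = 0 := by
  refine ext_tri fun x y z => ?_
  simp only [tri_zero, tri_add, tri_smul, tri_infAct, hL, map_neg, LinearMap.neg_apply]
  ring

/-- If `L² = -1`, then an eigenvector of the derivation `L` is an eigenvector of the pullbacks
under all `x + y L`. -/
theorem compLinearMap_of_infAct_eigen (L : M →ₗ[ℝ] M) (hL : ∀ x, L (L x) = -x)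
    (ω : M [⋀^Fin 3]→ₗ[ℝ] ℂ) (c : ℂ) (h : infAct L ω = -c • ω) (x y : ℝ) :
    ω.compLinearMap (x • LinearMap.id + y • L)
      = (x ^ 3 + c * x ^ 2 * y + (c ^ 2 + 3) / 2 * x * y ^ 2
          + (c * (c ^ 2 + 3) / 2 + 2 * c) / 3 * y ^ 3 : ℂ) • ω := by
  have h1 : ∀ u v w, tri ω (L u) v w + tri ω u (L v) w + tri ω u v (L w) = c * tri ω u v w := by
    intro u v w
    have := congrArg (fun η => tri η u v w) h
    simp only [tri_infAct, tri_smul] at this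
    linear_combination -this
  have h2 : ∀ u v w, tri ω (L u) (L v) w + tri ω (L u) v (L w) + tri ω u (L v) (L w)
      = (c ^ 2 + 3) / 2 * tri ω u v w := by
    intro u v w
    have e1 := h1 (L u) v w
    have e2 := h1 u (L v) w
    have e3 := h1 u v (L w)
    simp only [hL, map_neg, LinearMap.neg_apply] at e1 e2 e3
    linear_combination (e1 + e2 + e3) / 2 + c / 2 * h1 u v w
  have h3 : ∀ u v w, tri ω (L u) (L v) (L w)
      = (c * (c ^ 2 + 3) / 2 + 2 * c) / 3 * tri ω u v w := by
    intro u v w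
    have e1 := h1 (L u) (L v) w
    have e2 := h1 u (L v) (L w)
    have e3 := h1 (L u) v (L w)
    simp only [hL, map_neg, LinearMap.neg_apply] at e1 e2 e3
    linear_combination (e1 + e2 + e3) / 3 + c / 3 * h2 u v w + 2 / 3 * h1 u v w
  refine ext_tri fun u v w => ?_
  simp only [tri_smul, tri_compLinearMap, LinearMap.add_apply, LinearMap.smul_apply,
    LinearMap.id_apply, map_add, map_smul, Complex.real_smul]
  linear_combination (x : ℂ) ^ 2 * y * h1 u v w + x * y ^ 2 * h2 u v w + y ^ 3 * h3 u v w

/-- The alternating `3`-form obtained from a bilinear form `β` and a linear form `α` by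
antisymmetrizing `β(x₀, x₁) α(x₂)`. -/
def wedge (β : M →ₗ[ℝ] M →ₗ[ℝ] ℂ) (α : M →ₗ[ℝ] ℂ) : M [⋀^Fin 3]→ₗ[ℝ] ℂ where
  toFun x := (β (x 0) (x 1) - β (x 1) (x 0)) * α (x 2) + (β (x 1) (x 2) - β (x 2) (x 1)) * α (x 0)
    + (β (x 2) (x 0) - β (x 0) (x 2)) * α (x 1)
  map_update_add' {inst} x i a b := by
    obtain rfl := Subsingleton.elim inst (instDecidableEqFin 3)
    fin_cases i <;> simp [Function.update] <;> ring
  map_update_smul' {inst} x i c a := by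
    obtain rfl := Subsingleton.elim inst (instDecidableEqFin 3)
    fin_cases i <;> simp [Function.update] <;> ring
  map_eq_zero_of_eq' x i j h hij := by
    fin_cases i <;> fin_cases j <;> simp at hij h ⊢ <;> simp [h] <;> ring

@[simp] theorem tri_wedge (β : M →ₗ[ℝ] M →ₗ[ℝ] ℂ) (α : M →ₗ[ℝ] ℂ) (x y z : M) :
    tri (wedge β α) x y z = (β x y - β y x) * α z + (β y z - β z y) * α x
      + (β z x - β x z) * α y := rfl

end Trilinear

/-! ### Complete reducibility -/

section Complements

variable {M : Type*} [AddCommGroup M] [Module ℝ M]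

/-- A positive definite form on `M` induces one on the alternating `3`-forms, and adjoint
endomorphisms of `M` have adjoint pullbacks. -/
theorem exists_posDef_form_alternating [FiniteDimensional ℝ M] (B : M →ₗ[ℝ] M →ₗ[ℝ] ℝ)
    (hsymm : ∀ x y, B x y = B y x) (hpos : ∀ x, x ≠ 0 → 0 < B x x) :
    ∃ S : LinearMap.BilinForm ℝ (M [⋀^Fin 3]→ₗ[ℝ] ℝ), S.IsSymm ∧ (∀ ω, ω ≠ 0 → 0 < S ω ω) ∧
      ∀ L L' : M →ₗ[ℝ] M, (∀ x y, B (L x) y = B x (L' y)) → ∀ ω η,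
        S (ω.compLinearMap L) η = S ω (η.compLinearMap L') := by
  have hnn : ∀ x, 0 ≤ B x x := fun x => by
    rcases eq_or_ne x 0 with rfl | h
    · simp
    · exact (hpos x h).le
  let core : InnerProductSpace.Core ℝ M :=
    { inner := fun x y => B x y
      conj_inner_symm := fun x y => by simp [hsymm x y]
      re_inner_nonneg := fun x => by simpa using hnn x
      add_left := fun x y z => by simp
      smul_left := fun x y r => by simp
      definite := fun x hx => by
        by_contra h
        exact (hpos x h).ne' hx }
  let _ : NormedAddCommGroup M := core.toNormedAddCommGroup
  let _ : InnerProductSpace ℝ M := InnerProductSpace.ofCore core.toCore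
  let e := stdOrthonormalBasis ℝ M
  have hin : ∀ x y : M, inner ℝ x y = B x y := fun x y => rfl
  have hexp : ∀ x : M, x = ∑ l, B (e l) x • e l := fun x => by
    conv_lhs => rw [← e.sum_repr' x]
    simp only [hin]
  let S : LinearMap.BilinForm ℝ (M [⋀^Fin 3]→ₗ[ℝ] ℝ) := LinearMap.mk₂ ℝ
    (fun ω η => ∑ i, ∑ j, ∑ k, tri ω (e i) (e j) (e k) * tri η (e i) (e j) (e k))
    (fun ω ω' η => by simp only [tri_add, add_mul, Finset.sum_add_distrib])
    (fun c ω η => by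
      have : ∀ x y z, tri (c • ω) x y z = c * tri ω x y z := fun _ _ _ => rfl
      simp only [this, mul_assoc, Finset.mul_sum, smul_eq_mul])
    (fun ω η η' => by simp only [tri_add, mul_add, Finset.sum_add_distrib])
    (fun c ω η => by
      have : ∀ x y z, tri (c • η) x y z = c * tri η x y z := fun _ _ _ => rfl
      simp only [this, mul_left_comm, Finset.mul_sum, smul_eq_mul])
  have hS : ∀ ω η, S ω η = ∑ i, ∑ j, ∑ k, tri ω (e i) (e j) (e k) * tri η (e i) (e j) (e k) :=
    fun ω η => rfl
  refine ⟨S, ⟨fun ω η => ?_⟩, fun ω hω => ?_, fun L L' hL ω η => ?_⟩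
  · simp only [hS, mul_comm]
  · have h0 : 0 ≤ S ω ω := by
      rw [hS]
      exact Finset.sum_nonneg fun i _ => Finset.sum_nonneg fun j _ =>
        Finset.sum_nonneg fun k _ => mul_self_nonneg _
    refine lt_of_le_of_ne h0 fun h => hω ?_
    replace h := (Finset.sum_eq_zero_iff_of_nonneg fun i _ => Finset.sum_nonneg fun j _ =>
        Finset.sum_nonneg fun k _ => mul_self_nonneg _).1 (h.trans (hS ω ω)).symm
    have h0 : tri ω = 0 := e.toBasis.ext fun i => e.toBasis.ext fun j => e.toBasis.ext fun k => by
      have h1 := (Finset.sum_eq_zero_iff_of_nonneg fun j _ =>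
        Finset.sum_nonneg fun k _ => mul_self_nonneg _).1 (h i (Finset.mem_univ _))
      have h2 := (Finset.sum_eq_zero_iff_of_nonneg fun k _ => mul_self_nonneg _).1
        (h1 j (Finset.mem_univ _))
      simpa using h2 k (Finset.mem_univ _)
    exact ext_tri fun x y z => by rw [h0]; rfl
  · have slot : ∀ f g : M →ₗ[ℝ] ℝ, ∑ i, f (L (e i)) * g (e i) = ∑ i, f (e i) * g (L' (e i)) := by
      intro f g
      have h1 : ∀ i, f (L (e i)) = ∑ l, B (e l) (L (e i)) * f (e l) := fun i => by
        conv_lhs => rw [hexp (L (e i)), map_sum]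
        simp
      have h2 : ∀ l, g (L' (e l)) = ∑ i, B (e i) (L' (e l)) * g (e i) := fun l => by
        conv_lhs => rw [hexp (L' (e l)), map_sum]
        simp
      simp only [h1, h2, Finset.sum_mul, Finset.mul_sum]
      rw [Finset.sum_comm]
      refine Finset.sum_congr rfl fun l _ => Finset.sum_congr rfl fun i _ => ?_
      rw [hsymm, hL]
      ring
    simp only [hS, tri_compLinearMap]
    calc ∑ i, ∑ j, ∑ k, tri ω (L (e i)) (L (e j)) (L (e k)) * tri η (e i) (e j) (e k)
        = ∑ i, ∑ j, ∑ k, tri ω (L (e i)) (L (e j)) (e k) * tri η (e i) (e j) (L' (e k)) :=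
          Finset.sum_congr rfl fun i _ => Finset.sum_congr rfl fun j _ =>
            slot (tri ω (L (e i)) (L (e j))) (tri η (e i) (e j))
      _ = ∑ i, ∑ k, ∑ j, tri ω (L (e i)) (L (e j)) (e k) * tri η (e i) (e j) (L' (e k)) :=
          Finset.sum_congr rfl fun i _ => Finset.sum_comm
      _ = ∑ i, ∑ k, ∑ j, tri ω (L (e i)) (e j) (e k) * tri η (e i) (L' (e j)) (L' (e k)) :=
          Finset.sum_congr rfl fun i _ => Finset.sum_congr rfl fun k _ =>
            slot ((tri ω (L (e i))).flip (e k)) ((tri η (e i)).flip (L' (e k)))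
      _ = ∑ k, ∑ j, ∑ i, tri ω (L (e i)) (e j) (e k) * tri η (e i) (L' (e j)) (L' (e k)) := by
          rw [Finset.sum_comm]
          exact Finset.sum_congr rfl fun k _ => Finset.sum_comm
      _ = ∑ k, ∑ j, ∑ i, tri ω (e i) (e j) (e k) * tri η (L' (e i)) (L' (e j)) (L' (e k)) :=
          Finset.sum_congr rfl fun k _ => Finset.sum_congr rfl fun j _ =>
            slot (((tri ω).flip (e j)).flip (e k)) (((tri η).flip (L' (e j))).flip (L' (e k)))
      _ = ∑ i, ∑ j, ∑ k, tri ω (e i) (e j) (e k) * tri η (L' (e i)) (L' (e j)) (L' (e k)) := by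
          rw [Finset.sum_congr rfl fun k _ => Finset.sum_comm, Finset.sum_comm]
          exact Finset.sum_congr rfl fun i _ => Finset.sum_comm

/-- Complete reducibility for a set of endomorphisms that is closed under adjoints with respect
to a positive definite form. -/
theorem exists_isCompl_stable [FiniteDimensional ℝ M] (S : LinearMap.BilinForm ℝ M)
    (hS : S.IsSymm) (hpos : ∀ x, x ≠ 0 → 0 < S x x) {G : Type*} (T : G → M →ₗ[ℝ] M)
    (hT : ∀ g, ∃ h, ∀ x y, S (T g x) y = S x (T h y)) (U : Submodule ℝ M)
    (hU : ∀ g, ∀ x ∈ U, T g x ∈ U) :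
    ∃ U' : Submodule ℝ M, IsCompl U U' ∧ ∀ g, ∀ x ∈ U', T g x ∈ U' := by
  refine ⟨S.orthogonal U, ?_, fun g x hx y hy => ?_⟩
  · refine (LinearMap.BilinForm.isCompl_orthogonal_iff_disjoint hS.isRefl).2 ?_
    rw [Submodule.disjoint_def]
    intro x hx hx'
    by_contra h
    exact (hpos x h).ne' (hx' x hx)
  · obtain ⟨h, hh⟩ := hT g
    have := hx (T h y) (hU h y hy)
    change S y (T g x) = 0
    rw [hS.eq, hh, hS.eq]
    exact this

/-- Among the equivariant endomorphisms `p` of a completely reducible representation that satisfy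
a condition `P` which passes to one of the summands of a sum, one of minimal rank has irreducible
range. -/
theorem exists_equivariant_irreducible_range [FiniteDimensional ℝ M] {G : Type*}
    (T : G → M →ₗ[ℝ] M)
    (hcompl : ∀ U : Submodule ℝ M, (∀ g, ∀ x ∈ U, T g x ∈ U) →
      ∃ U' : Submodule ℝ M, IsCompl U U' ∧ ∀ g, ∀ x ∈ U', T g x ∈ U')
    (P : (M →ₗ[ℝ] M) → Prop) (hP0 : ¬ P 0) (hP1 : P LinearMap.id)
    (hPadd : ∀ p p', P (p + p') → P p ∨ P p') :
    ∃ p : M →ₗ[ℝ] M, P p ∧ (∀ g x, p (T g x) = T g (p x)) ∧ LinearMap.range p ≠ ⊥ ∧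
      ∀ U : Submodule ℝ M, U ≤ LinearMap.range p → (∀ g, ∀ x ∈ U, T g x ∈ U) →
        U = ⊥ ∨ U = LinearMap.range p := by
  classical
  have hex : ∃ n, ∃ p : M →ₗ[ℝ] M, P p ∧ (∀ g x, p (T g x) = T g (p x)) ∧
      Module.finrank ℝ (LinearMap.range p) = n := ⟨_, LinearMap.id, hP1, fun _ _ => rfl, rfl⟩
  obtain ⟨p, hp, heq, hrank⟩ := Nat.find_spec hex
  have hmin : ∀ p' : M →ₗ[ℝ] M, (∀ g x, p' (T g x) = T g (p' x)) →
      Module.finrank ℝ (LinearMap.range p') < Module.finrank ℝ (LinearMap.range p) → ¬ P p' :=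
    fun p' he hlt hp' => Nat.find_min hex (hrank ▸ hlt) ⟨p', hp', he, rfl⟩
  refine ⟨p, hp, heq, fun h => hP0 ?_, fun U hU hst => ?_⟩
  · rwa [LinearMap.range_eq_bot.1 h] at hp
  · by_contra! hne
    obtain ⟨U', hc, hst'⟩ := hcompl U hst
    -- `e` and `e'` are the equivariant projections onto the two summands
    let e : M →ₗ[ℝ] M := U.subtype ∘ₗ U.projectionOnto U' hc
    let e' : M →ₗ[ℝ] M := LinearMap.id - e
    have heU : ∀ x, e x ∈ U := fun x => (U.projectionOnto U' hc x).2
    have hefix : ∀ x ∈ U, e x = x := fun x hx => by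
      change ((U.projectionOnto U' hc x : U) : M) = x
      rw [Submodule.projectionOnto_apply_left hc ⟨x, hx⟩]
    have hekill : ∀ x ∈ U', e x = 0 := fun x hx => by
      change ((U.projectionOnto U' hc x : U) : M) = 0
      rw [(Submodule.projectionOnto_apply_eq_zero_iff hc).2 hx]
      rfl
    have heeq : ∀ g x, e (T g x) = T g (e x) := fun g x => by
      obtain ⟨a, ha, c, hcc, rfl⟩ := Submodule.mem_sup.1
        (hc.sup_eq_top ▸ Submodule.mem_top : x ∈ U ⊔ U')
      rw [map_add, map_add, map_add, hefix _ (hst g a ha), hekill _ (hst' g c hcc), hefix a ha,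
        hekill c hcc, add_zero, add_zero]
    have hsum : p = e ∘ₗ p + e' ∘ₗ p := by
      ext x
      simp [e']
    rw [hsum] at hp
    rcases hPadd _ _ hp with h | h
    · refine hmin _ (fun g x => ?_) ?_ h
      · simp only [LinearMap.comp_apply, heq, heeq]
      · refine Submodule.finrank_lt_finrank_of_lt (lt_of_le_of_lt ?_ (lt_of_le_of_ne hU hne.2))
        rintro _ ⟨x, rfl⟩
        exact heU _
    · refine hmin _ (fun g x => ?_) ?_ h
      · simp only [LinearMap.comp_apply, heq, heeq, e', LinearMap.sub_apply, LinearMap.id_apply,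
          map_sub]
      · rw [LinearMap.range_comp]
        obtain ⟨u, huU, hu0⟩ := (Submodule.ne_bot_iff U).1 hne.1
        have hni : LinearMap.ker (e'.domRestrict (LinearMap.range p)) ≠ ⊥ := by
          refine (Submodule.ne_bot_iff _).2 ⟨⟨u, hU huU⟩, ?_, fun h => hu0 (congrArg Subtype.val h)⟩
          simp [e', hefix u huU]
        have h1 := LinearMap.finrank_range_add_finrank_ker (e'.domRestrict (LinearMap.range p))
        have h2 : 0 < Module.finrank ℝ (LinearMap.ker (e'.domRestrict (LinearMap.range p))) :=
          Module.finrank_pos_iff.2 (Submodule.nontrivial_iff_ne_bot.2 hni)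
        have h3 : LinearMap.range (e'.domRestrict (LinearMap.range p))
            = (LinearMap.range p).map e' := by
          rw [LinearMap.domRestrict, LinearMap.range_comp, Submodule.range_subtype]
        rw [h3] at h1
        omega

end Complements

/-! ### A positive definite form on the Clifford algebra -/

section Anticommuting

variable {C : Type*} [Ring C] [Algebra ℝ C] {I : Type*} (e : I → C) (ε : I → ℝ)

/-- Finitely many anticommuting elements with scalar squares leave some finite-dimensional
subspace containing `1` stable. -/
theorem exists_finiteDimensional_stable [DecidableEq I] (he : ∀ i, e i * e i = algebraMap ℝ C (ε i))
    (hanti : ∀ i j, i ≠ j → e i * e j = -(e j * e i)) (s : Finset I) :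
    ∃ N : Submodule ℝ C, FiniteDimensional ℝ N ∧ 1 ∈ N ∧ ∀ i ∈ s, ∀ x ∈ N, e i * x ∈ N := by
  induction s using Finset.induction_on with
  | empty =>
    exact ⟨Submodule.span ℝ {1}, FiniteDimensional.span_singleton ℝ _,
      Submodule.mem_span_singleton_self _, by simp⟩
  | insert k s hk ih =>
    obtain ⟨N, hfin, h1, hN⟩ := ih
    refine ⟨N ⊔ N.map (LinearMap.mulLeft ℝ (e k)), inferInstance,
      Submodule.mem_sup_left h1, fun i hi x hx => ?_⟩
    obtain ⟨a, ha, c, ⟨d, hd, rfl⟩, rfl⟩ := Submodule.mem_sup.1 hx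
    rw [LinearMap.mulLeft_apply, mul_add, ← mul_assoc]
    rcases Finset.mem_insert.1 hi with rfl | hi
    · refine add_mem (Submodule.mem_sup_right ⟨a, ha, rfl⟩) (Submodule.mem_sup_left ?_)
      rw [he, ← Algebra.smul_def]
      exact Submodule.smul_mem _ _ hd
    · refine add_mem (Submodule.mem_sup_left (hN i hi a ha)) (Submodule.mem_sup_right ?_)
      rw [hanti i k (fun h => hk (h ▸ hi)), neg_mul, mul_assoc]
      exact neg_mem ⟨_, hN i hi d hd, rfl⟩

/-- Averaging makes finitely many anticommuting elements with squares `± 1` act orthogonally. -/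
theorem exists_posDef_form_invariant [DecidableEq I] [FiniteDimensional ℝ C]
    (hε : ∀ i, ε i * ε i = 1) (he : ∀ i, e i * e i = algebraMap ℝ C (ε i))
    (hanti : ∀ i j, i ≠ j → e i * e j = -(e j * e i)) (s : Finset I) :
    ∃ B : C →ₗ[ℝ] C →ₗ[ℝ] ℝ, (∀ x y, B x y = B y x) ∧ (∀ x, x ≠ 0 → 0 < B x x) ∧
      ∀ i ∈ s, ∀ x y, B (e i * x) (e i * y) = B x y := by
  induction s using Finset.induction_on with
  | empty =>
    let f := Module.finBasis ℝ C
    refine ⟨LinearMap.mk₂ ℝ (fun x y => f.repr x ⬝ᵥ f.repr y) ?_ ?_ ?_ ?_, ?_, ?_, by simp⟩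
    · intro x y z
      simp [add_dotProduct]
    · intro c x y
      simp
    · intro x y z
      simp [dotProduct_add]
    · intro c x y
      simp
    · intro x y
      simp [dotProduct_comm]
    · intro x hx
      rw [LinearMap.mk₂_apply]
      refine lt_of_le_of_ne (Finset.sum_nonneg fun _ _ => mul_self_nonneg _) fun h => hx ?_
      have := dotProduct_self_eq_zero.1 h.symm
      exact f.repr.map_eq_zero_iff.1 (DFunLike.coe_injective this)
  | insert k s hk ih =>
    obtain ⟨B, hsymm, hpos, hinv⟩ := ih
    have hnn : ∀ x, 0 ≤ B x x := fun x => by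
      rcases eq_or_ne x 0 with rfl | h
      · simp
      · exact (hpos x h).le
    refine ⟨B + B.compl₁₂ (LinearMap.mulLeft ℝ (e k)) (LinearMap.mulLeft ℝ (e k)), ?_, ?_, ?_⟩
    · intro x y
      simp [hsymm x y, hsymm (e k * x)]
    · intro x hx
      simpa using add_pos_of_pos_of_nonneg (hpos x hx) (hnn (e k * x))
    · intro i hi x y
      simp only [LinearMap.add_apply, LinearMap.compl₁₂_apply, LinearMap.mulLeft_apply]
      rcases Finset.mem_insert.1 hi with rfl | hi
      · simp only [← mul_assoc, he, ← Algebra.smul_def, map_smul, LinearMap.smul_apply,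
          smul_eq_mul, hε, one_mul]
        ring
      · simp only [← mul_assoc, hanti k i fun h => hk (h ▸ hi)]
        simp [mul_assoc, hinv i hi]

end Anticommuting

section Ring

variable {R : Type*} [Ring R]

theorem mul_mul_self_of_anticomm {a c : R} (ha : a * a = 1) (hc : c * c = 1)
    (h : c * a = -(a * c)) : a * c * (a * c) = -1 := by
  calc a * c * (a * c) = a * (c * a) * c := by noncomm_ring
    _ = -((a * a) * (c * c)) := by rw [h]; noncomm_ring
    _ = -1 := by rw [ha, hc, one_mul]

theorem mul_mul_conj_left {a c : R} (ha : a * a = 1) (hc : c * c = 1) :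
    a * c * a * (a * c) = a := by
  calc a * c * a * (a * c) = a * c * (a * a) * c := by noncomm_ring
    _ = a * (c * c) := by rw [ha]; noncomm_ring
    _ = a := by rw [hc, mul_one]

theorem mul_mul_conj_right {a c : R} (ha : a * a = 1) (hc : c * c = 1) :
    a * c * c * (a * c) = c := by
  calc a * c * c * (a * c) = a * (c * c) * a * c := by noncomm_ring
    _ = (a * a) * c := by rw [hc]; noncomm_ring
    _ = c := by rw [ha, one_mul]

theorem mul_mul_conj_of_anticomm {a c x : R} (ha : a * a = 1) (hc : c * c = 1)
    (h : c * a = -(a * c)) (hx : x * a = -(a * x)) (hx' : x * c = -(c * x)) :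
    a * c * x * (a * c) = -x := by
  calc a * c * x * (a * c) = a * c * (x * a) * c := by noncomm_ring
    _ = -(a * (c * a) * (x * c)) := by rw [hx]; noncomm_ring
    _ = -((a * a) * (c * c) * x) := by rw [h, hx']; noncomm_ring
    _ = -x := by rw [ha, hc, one_mul, one_mul]

end Ring

section Clifford

variable {V : Type*} [AddCommGroup V] [Module ℚ V] {q : QuadraticForm ℚ V} {m : ℕ}

open CliffordAlgebra

namespace Frame

/-- The `k`-th vector of the frame as an element of the Clifford algebra. -/
def e (b : Frame q m) (k : Fin (m + 2)) : CliffordAlgebra (realForm q) := ι _ (b.basis k)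

/-- The square of the `k`-th vector of a frame. -/
def sgn {m : ℕ} (k : Fin (m + 2)) : ℝ := if k.val < 2 then 1 else -1

theorem sgn_mul_self (k : Fin (m + 2)) : sgn k * sgn k = 1 := by
  unfold sgn
  split_ifs <;> norm_num

theorem e_mul_self (b : Frame q m) (k : Fin (m + 2)) :
    b.e k * b.e k = algebraMap ℝ _ (sgn k) := by
  rw [e, ι_sq_scalar, b.form_apply, sgn]

theorem e_anticomm (b : Frame q m) (k l : Fin (m + 2)) (h : k ≠ l) :
    b.e k * b.e l = -(b.e l * b.e k) := by
  rw [eq_neg_iff_add_eq_zero, e, e, ι_mul_ι_add_swap, b.orthogonal k l h, map_zero]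

theorem finiteDimensional_clifford (b : Frame q m) :
    FiniteDimensional ℝ (CliffordAlgebra (realForm q)) := by
  obtain ⟨N, hfin, h1, hN⟩ := exists_finiteDimensional_stable b.e sgn b.e_mul_self b.e_anticomm
    Finset.univ
  have hv : ∀ v, ∀ x ∈ N, ι (realForm q) v * x ∈ N := by
    intro v x hx
    rw [← b.basis.sum_repr v, map_sum, Finset.sum_mul]
    refine sum_mem fun k _ => ?_
    rw [map_smul, smul_mul_assoc]
    exact Submodule.smul_mem _ _ (hN k (Finset.mem_univ _) x hx)
  have hall : ∀ x, x ∈ N := by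
    intro x
    induction x using CliffordAlgebra.left_induction with
    | algebraMap r =>
      rw [Algebra.algebraMap_eq_smul_one]
      exact Submodule.smul_mem _ _ h1
    | add x y hx hy => exact add_mem hx hy
    | ι_mul x v hx => exact hv v x hx
  have : N = ⊤ := eq_top_iff.2 fun x _ => hall x
  subst this
  exact Module.Finite.equiv Submodule.topEquiv

theorem coe_J (b : Frame q m) : (b.J : CliffordAlgebra (realForm q))
    = b.e ⟨0, by omega⟩ * b.e ⟨1, by omega⟩ := rfl

theorem coe_J_mul_self (b : Frame q m) :
    (b.J : CliffordAlgebra (realForm q)) * b.J = -1 := by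
  have h0 := b.e_mul_self ⟨0, by omega⟩
  have h1 := b.e_mul_self ⟨1, by omega⟩
  have h := b.e_anticomm ⟨1, by omega⟩ ⟨0, by omega⟩ (by simp)
  simp only [sgn, Nat.zero_lt_two, Nat.one_lt_two, if_true, map_one] at h0 h1
  exact mul_mul_self_of_anticomm h0 h1 h

theorem J_mul_self (b : Frame q m) : b.J * b.J = -1 := Subtype.ext b.coe_J_mul_self

theorem coe_J_conj (b : Frame q m) (k : Fin (m + 2)) :
    (b.J : CliffordAlgebra (realForm q)) * b.e k * b.J = algebraMap ℝ _ (sgn k) * b.e k := by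
  have e0 := b.e_mul_self ⟨0, by omega⟩
  have e1 := b.e_mul_self ⟨1, by omega⟩
  have h := b.e_anticomm ⟨1, by omega⟩ ⟨0, by omega⟩ (by simp)
  simp only [sgn, Nat.zero_lt_two, Nat.one_lt_two, if_true, map_one] at e0 e1
  rw [coe_J]
  by_cases h0 : k = ⟨0, by omega⟩
  · rw [h0, mul_mul_conj_left e0 e1]
    simp [sgn]
  by_cases h1 : k = ⟨1, by omega⟩
  · rw [h1, mul_mul_conj_right e0 e1]
    simp [sgn]
  rw [mul_mul_conj_of_anticomm e0 e1 h (b.e_anticomm _ _ h0) (b.e_anticomm _ _ h1)]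
  have hk : ¬ k.val < 2 := fun hk => by
    rcases Nat.lt_succ_iff_lt_or_eq.1 hk with hk | hk
    · exact h0 (Fin.ext (by simpa using hk))
    · exact h1 (Fin.ext hk)
  simp [sgn, hk]

/-- There is a positive definite form on the Clifford algebra for which the adjoint of left
multiplication by `x` is left multiplication by `J x^* J⁻¹`. -/
theorem exists_posDef_form_clifford (b : Frame q m) :
    ∃ B : CliffordAlgebra (realForm q) →ₗ[ℝ] CliffordAlgebra (realForm q) →ₗ[ℝ] ℝ,
      (∀ x y, B x y = B y x) ∧ (∀ x, x ≠ 0 → 0 < B x x) ∧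
      ∀ x y z, B (x * y) z = B y (-(b.J * star x * b.J) * z) := by
  have := b.finiteDimensional_clifford
  obtain ⟨B, hsymm, hpos, hinv⟩ := exists_posDef_form_invariant b.e sgn sgn_mul_self b.e_mul_self
    b.e_anticomm Finset.univ
  refine ⟨B, hsymm, hpos, fun x => ?_⟩
  induction x using CliffordAlgebra.induction with
  | algebraMap r =>
    intro y z
    rw [star_algebraMap, ← Algebra.commutes, mul_assoc, b.coe_J_mul_self, mul_neg, mul_one, neg_neg,
      ← Algebra.smul_def, ← Algebra.smul_def, map_smul, map_smul, LinearMap.smul_apply]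
  | ι v =>
    intro y z
    rw [star_ι, ← b.basis.sum_repr v]
    simp only [map_sum, map_smul, Finset.sum_mul, Finset.mul_sum, LinearMap.sum_apply, mul_neg,
      neg_mul, neg_neg, smul_mul_assoc, mul_smul_comm, LinearMap.smul_apply]
    refine Finset.sum_congr rfl fun k _ => ?_
    rw [← e, b.coe_J_conj, ← hinv k (Finset.mem_univ _) (b.e k * y) z, ← mul_assoc, b.e_mul_self,
      mul_assoc, ← Algebra.smul_def, ← Algebra.smul_def, map_smul, map_smul, LinearMap.smul_apply]
  | mul x x' hx hx' =>
    intro y z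
    rw [mul_assoc, hx, hx', star_mul]
    congr 1
    have := b.coe_J_mul_self
    have h2 : (b.J : CliffordAlgebra (realForm q)) * (star x' * star x) * b.J
        = -((b.J * star x' * b.J) * (b.J * star x * b.J)) := by
      calc (b.J : CliffordAlgebra (realForm q)) * (star x' * star x) * b.J
          = -(b.J * star x' * (-1) * (star x * b.J)) := by noncomm_ring
        _ = _ := by rw [← this]; noncomm_ring
    rw [h2]
    simp [mul_assoc]
  | add x x' hx hx' =>
    intro y z
    rw [add_mul, map_add, LinearMap.add_apply, hx, hx', ← map_add, star_add]
    congr 1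
    noncomm_ring

end Frame

/-! ### Elements of the spin group -/

theorem ι_mul_ι_mem_spinGroup (v w : ℝ ⊗[ℚ] V) (h : realForm q v * realForm q w = 1) :
    ι (realForm q) v * ι (realForm q) w ∈ spinGroup (realForm q) := by
  have hunit : ∀ v, realForm q v ≠ 0 → ∃ u ∈ lipschitzGroup (realForm q),
      (u : CliffordAlgebra (realForm q)) = ι (realForm q) v := by
    intro v hv
    refine ⟨⟨ι _ v, (realForm q v)⁻¹ • ι _ v, ?_, ?_⟩, Subgroup.subset_closure ⟨v, rfl⟩, rfl⟩
    · rw [mul_smul_comm, ι_sq_scalar, Algebra.smul_def, ← map_mul, inv_mul_cancel₀ hv, map_one]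
    · rw [smul_mul_assoc, ι_sq_scalar, Algebra.smul_def, ← map_mul, inv_mul_cancel₀ hv, map_one]
  obtain ⟨a, ha, hav⟩ := hunit v (left_ne_zero_of_mul_eq_one h)
  obtain ⟨c, hc, hcw⟩ := hunit w (right_ne_zero_of_mul_eq_one h)
  have h1 : ∀ v w : ℝ ⊗[ℚ] V, realForm q v * realForm q w = 1 →
      ι (realForm q) v * ι (realForm q) w * (ι (realForm q) w * ι (realForm q) v) = 1 := by
    intro v w h
    rw [mul_assoc, ← mul_assoc (ι _ w) (ι _ w), ι_sq_scalar, Algebra.left_comm, ι_sq_scalar,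
      ← map_mul, mul_comm, h, map_one]
  refine ⟨⟨⟨a * c, mul_mem ha hc, by simp [hav, hcw]⟩, ?_⟩, ι_mul_ι_mem_evenOdd_zero _ _ _⟩
  refine Unitary.mem_iff.2 ?_
  rw [star_mul, star_ι, star_ι, neg_mul_neg]
  exact ⟨h1 w v (by rw [mul_comm, h]), h1 v w h⟩

/-! ### The spin group on the third cohomology -/

/-- The action of an element of the spin group on the real cohomology. -/
def spinActReal (q : QuadraticForm ℚ V) (k : ℕ) (g : spinGroup (realForm q)) :
    Coh q k ℝ →ₗ[ℝ] Coh q k ℝ where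
  toFun := pullback (spinToEven g⁻¹)
  map_add' _ _ := rfl
  map_smul' _ _ := rfl

/-- The action of an element of the spin group on the complex cohomology. -/
def spinAct (q : QuadraticForm ℚ V) (k : ℕ) (g : spinGroup (realForm q)) :
    Coh q k ℂ →ₗ[ℂ] Coh q k ℂ where
  toFun := pullback (spinToEven g⁻¹)
  map_add' _ _ := rfl
  map_smul' _ _ := rfl

theorem spinToEven_mul (g h : spinGroup (realForm q)) :
    spinToEven (g * h) = spinToEven g * spinToEven h := rfl

theorem spinToEven_one : spinToEven (1 : spinGroup (realForm q)) = 1 := rfl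

theorem spinToEven_mul_inv (g : spinGroup (realForm q)) :
    spinToEven g * spinToEven g⁻¹ = 1 := by
  rw [← spinToEven_mul, mul_inv_cancel, spinToEven_one]

theorem spinToEven_inv_mul (g : spinGroup (realForm q)) :
    spinToEven g⁻¹ * spinToEven g = 1 := by
  rw [← spinToEven_mul, inv_mul_cancel, spinToEven_one]

theorem coe_spinToEven_inv (g : spinGroup (realForm q)) :
    (spinToEven g⁻¹ : CliffordAlgebra (realForm q)) = star (g : CliffordAlgebra (realForm q)) :=
  rfl

/-- The point `J` is itself an element of the spin group. -/
def Frame.spinJ (b : Frame q m) : spinGroup (realForm q) :=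
  ⟨b.J, ι_mul_ι_mem_spinGroup _ _ (by rw [b.form_apply, b.form_apply]; simp)⟩

theorem Frame.spinToEven_spinJ (b : Frame q m) : spinToEven b.spinJ = b.J := rfl

theorem Frame.spinToEven_spinJ_inv (b : Frame q m) : spinToEven b.spinJ⁻¹ = -b.J := by
  have h := spinToEven_mul_inv b.spinJ
  rw [b.spinToEven_spinJ] at h
  have h2 := congrArg (fun x => -(b.J * x)) h
  simpa [← mul_assoc, b.J_mul_self] using h2

theorem Frame.finiteDimensional_even (b : Frame q m) : FiniteDimensional ℝ (EvenCl q) :=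
  have := b.finiteDimensional_clifford
  FiniteDimensional.finiteDimensional_submodule (Subalgebra.toSubmodule (even (realForm q)))

theorem Frame.finiteDimensional_coh (b : Frame q m) (k : ℕ) : FiniteDimensional ℝ (Coh q k ℝ) := by
  have := b.finiteDimensional_even
  let f : Coh q k ℝ →ₗ[ℝ] MultilinearMap ℝ (fun _ : Fin k => EvenCl q) ℝ :=
    { toFun := AlternatingMap.toMultilinearMap
      map_add' := fun _ _ => rfl
      map_smul' := fun _ _ => rfl }
  exact Module.Finite.of_injective f AlternatingMap.coe_multilinearMap_injective

/-- The third cohomology is completely reducible under the spin group. -/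
theorem Frame.exists_isCompl_spinStable (b : Frame q m) (U : Submodule ℝ (Coh q 3 ℝ))
    (hU : ∀ g, ∀ x ∈ U, spinActReal q 3 g x ∈ U) :
    ∃ U' : Submodule ℝ (Coh q 3 ℝ), IsCompl U U' ∧ ∀ g, ∀ x ∈ U', spinActReal q 3 g x ∈ U' := by
  have := b.finiteDimensional_even
  have := b.finiteDimensional_coh 3
  obtain ⟨B, hsymm, hpos, hB⟩ := b.exists_posDef_form_clifford
  obtain ⟨S, hS, hSpos, hadj⟩ := exists_posDef_form_alternating
    (B.compl₁₂ (even (realForm q)).val.toLinearMap (even (realForm q)).val.toLinearMap)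
    (fun x y => hsymm _ _) (fun x hx => hpos _ fun h => hx (Subtype.ext h))
  refine exists_isCompl_stable S hS hSpos (spinActReal q 3) (fun g => ?_) U hU
  refine ⟨b.spinJ * g⁻¹ * b.spinJ⁻¹, hadj (LinearMap.mulLeft ℝ (spinToEven g⁻¹))
    (LinearMap.mulLeft ℝ (spinToEven (b.spinJ * g⁻¹ * b.spinJ⁻¹)⁻¹)) fun x y => ?_⟩
  refine (hB _ _ _).trans ?_
  rw [coe_spinToEven_inv, star_star, mul_inv_rev, mul_inv_rev, inv_inv, inv_inv, spinToEven_mul,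
    spinToEven_mul, b.spinToEven_spinJ_inv, b.spinToEven_spinJ]
  change _ = B (x : CliffordAlgebra (realForm q)) (((b.J : CliffordAlgebra (realForm q)) *
    (g.1 * (-(b.J : CliffordAlgebra (realForm q))))) * y)
  congr 2
  noncomm_ring

/-- For orthonormal `v = b_i`, `w = b_j` the element `c + s v w` lies on a one-parameter subgroup
of the spin group when `c² ± s² = 1`. -/
theorem Frame.exists_spin_eq (b : Frame q m) (i j : Fin (m + 2)) (hij : i ≠ j) (c s : ℝ)
    (h : c ^ 2 + sgn i * sgn j * s ^ 2 = 1) :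
    ∃ g : spinGroup (realForm q),
      spinToEven g = algebraMap ℝ _ c + s • vecMul q (b.basis i) (b.basis j) := by
  have hi := sgn_mul_self i
  have e1 : realForm q (b.basis i) = sgn i := b.form_apply i
  have e2 : realForm q ((c * sgn i) • b.basis i + s • b.basis j)
      = c ^ 2 * sgn i + s ^ 2 * sgn j := by
    rw [QuadraticMap.map_add (realForm q), QuadraticMap.map_smul, QuadraticMap.map_smul,
      QuadraticMap.polar_smul_left, QuadraticMap.polar_smul_right, b.orthogonal i j hij, e1,
      b.form_apply j, ← sgn]
    simp only [smul_eq_mul, mul_zero, add_zero]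
    linear_combination c ^ 2 * sgn i * hi
  refine ⟨⟨_, ι_mul_ι_mem_spinGroup (b.basis i) ((c * sgn i) • b.basis i + s • b.basis j) ?_⟩, ?_⟩
  · rw [e1, e2]
    linear_combination h + c ^ 2 * hi
  · refine Subtype.ext ?_
    change ι (realForm q) _ * ι (realForm q) _ = algebraMap ℝ (CliffordAlgebra (realForm q)) c
      + s • (ι (realForm q) _ * ι (realForm q) _)
    rw [map_add, map_smul, map_smul, mul_add, mul_smul_comm, mul_smul_comm, ι_sq_scalar, e1,
      Algebra.smul_def (c * sgn i), ← map_mul, mul_assoc, hi, mul_one]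

theorem cAct_tmul (k : ℕ) (z : ℂ) (a : EvenCl q) (ω : Coh q k ℂ) :
    cAct q k (z ⊗ₜ a) ω = z • infAct (LinearMap.mulLeft ℝ a) ω := by
  simp only [cAct, infActLin, LinearMap.liftBaseChange_tmul]
  rfl

/-- The derivation given by `b_i b_j` is a linear combination of the actions of group elements:
a one-parameter group `c + s b_i b_j` acts on `3`-forms by a cubic polynomial in `(c, s)`, whose
coefficients can be recovered from finitely many rational points. -/
theorem Frame.cAct_mem_span (b : Frame q m) (i j : Fin (m + 2)) (hij : i ≠ j) :
    cAct q 3 (1 ⊗ₜ vecMul q (b.basis i) (b.basis j))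
      ∈ Submodule.span ℂ (Set.range (spinAct q 3)) := by
  set K := vecMul q (b.basis i) (b.basis j) with hK
  have hpb : ∀ c s : ℝ, c ^ 2 + sgn i * sgn j * s ^ 2 = 1 →
      ∃ T ∈ Submodule.span ℂ (Set.range (spinAct q 3)), ∀ ω,
        T ω = ω.compLinearMap (c • LinearMap.id + s • LinearMap.mulLeft ℝ K) := by
    intro c s h
    obtain ⟨g, hg⟩ := b.exists_spin_eq i j hij c s h
    refine ⟨spinAct q 3 g⁻¹, Submodule.subset_span ⟨_, rfl⟩, fun ω => ?_⟩
    change ω.compLinearMap (LinearMap.mulLeft ℝ (spinToEven g⁻¹⁻¹)) = _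
    congr 1
    rw [inv_inv, hg]
    ext x
    simp [add_mul, Algebra.algebraMap_eq_smul_one, hK]
  have hodd : ∀ c s : ℝ, c ^ 2 + sgn i * sgn j * s ^ 2 = 1 →
      ∃ T ∈ Submodule.span ℂ (Set.range (spinAct q 3)), ∀ ω,
        T ω = ((-2 * c ^ 2 * s : ℝ) : ℂ) • infAct (LinearMap.mulLeft ℝ K) ω
        + ((2 * s ^ 3 : ℝ) : ℂ) • ω.compLinearMap (LinearMap.mulLeft ℝ K) := by
    intro c s h
    obtain ⟨T, hT, hTω⟩ := hpb c s h
    obtain ⟨T', hT', hTω'⟩ := hpb c (-s) (by rw [neg_sq, h])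
    refine ⟨T - T', sub_mem hT hT', fun ω => ?_⟩
    have hneg : c • LinearMap.id + -s • LinearMap.mulLeft ℝ K
        = c • LinearMap.id - s • LinearMap.mulLeft ℝ K := by
      ext x
      simp [sub_eq_add_neg]
    rw [← compLinearMap_sub_compLinearMap, LinearMap.sub_apply, hTω, hTω', hneg]
  have hcomb : ∀ c s c' s' : ℝ, c ^ 2 + sgn i * sgn j * s ^ 2 = 1 →
      c' ^ 2 + sgn i * sgn j * s' ^ 2 = 1 → c' ^ 2 * s' * s ^ 3 - c ^ 2 * s * s' ^ 3 ≠ 0 →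
      cAct q 3 (1 ⊗ₜ K) ∈ Submodule.span ℂ (Set.range (spinAct q 3)) := by
    intro c s c' s' h h' hdet
    obtain ⟨T, hT, hTω⟩ := hodd c s h
    obtain ⟨T', hT', hTω'⟩ := hodd c' s' h'
    have : cAct q 3 (1 ⊗ₜ K) = ((2 * (c' ^ 2 * s' * s ^ 3 - c ^ 2 * s * s' ^ 3) : ℝ) : ℂ)⁻¹ •
        (((s' ^ 3 : ℝ) : ℂ) • T - ((s ^ 3 : ℝ) : ℂ) • T') := by
      rw [eq_inv_smul_iff₀ (by exact_mod_cast mul_ne_zero two_ne_zero hdet)]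
      refine LinearMap.ext fun ω => ?_
      rw [LinearMap.smul_apply, LinearMap.sub_apply, LinearMap.smul_apply, LinearMap.smul_apply,
        hTω, hTω', cAct_tmul, one_smul]
      push_cast
      module
    rw [this]
    exact Submodule.smul_mem _ _ (sub_mem (Submodule.smul_mem _ _ hT) (Submodule.smul_mem _ _ hT'))
  have hs : sgn i * sgn j = 1 ∨ sgn i * sgn j = -1 := by
    unfold sgn
    split_ifs <;> simp
  rcases hs with hs | hs
  · exact hcomb (3 / 5) (4 / 5) (4 / 5) (3 / 5) (by rw [hs]; norm_num) (by rw [hs]; norm_num)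
      (by norm_num)
  · exact hcomb (5 / 4) (3 / 4) (5 / 3) (4 / 3) (by rw [hs]; norm_num) (by rw [hs]; norm_num)
      (by norm_num)

theorem Frame.vecMul_anticomm (b : Frame q m) (i j : Fin (m + 2)) (hij : i ≠ j) :
    vecMul q (b.basis i) (b.basis j) = -vecMul q (b.basis j) (b.basis i) :=
  Subtype.ext (b.e_anticomm i j hij)

/-- The Lie algebra is spanned by the products of two different vectors of a frame. -/
theorem Frame.lieAlg_eq_span (b : Frame q m) : lieAlg q = Submodule.span ℂ
    {X | ∃ i j, i ≠ j ∧ X = 1 ⊗ₜ[ℝ] vecMul q (b.basis i) (b.basis j)} := by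
  refine le_antisymm (Submodule.span_le.2 ?_) (Submodule.span_le.2 ?_)
  · rintro _ ⟨v, w, rfl⟩
    have hexp : vecMul q v w - vecMul q w v = ∑ i, ∑ j, (b.basis.repr v i * b.basis.repr w j) •
        (vecMul q (b.basis i) (b.basis j) - vecMul q (b.basis j) (b.basis i)) := by
      conv_lhs => rw [← b.basis.sum_repr v, ← b.basis.sum_repr w]
      simp only [vecMul, map_sum, LinearMap.sum_apply, map_smul, LinearMap.smul_apply,
        Finset.smul_sum, smul_smul, smul_sub, Finset.sum_sub_distrib]
      rw [Finset.sum_comm]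
      simp only [mul_comm]
    rw [hexp, TensorProduct.tmul_sum]
    refine sum_mem fun i _ => ?_
    rw [TensorProduct.tmul_sum]
    refine sum_mem fun j _ => ?_
    rcases eq_or_ne i j with rfl | hij
    · simp
    · rw [b.vecMul_anticomm j i hij.symm, sub_neg_eq_add, ← two_smul ℝ, smul_smul,
        TensorProduct.tmul_smul, ← algebraMap_smul ℂ (_ : ℝ)]
      exact Submodule.smul_mem _ _ (Submodule.subset_span ⟨i, j, hij, rfl⟩)
  · rintro _ ⟨i, j, hij, rfl⟩
    have : (1 : ℂ) ⊗ₜ[ℝ] vecMul q (b.basis i) (b.basis j) = (1 / 2 : ℂ) •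
        (1 ⊗ₜ[ℝ] (vecMul q (b.basis i) (b.basis j) - vecMul q (b.basis j) (b.basis i))) := by
      rw [b.vecMul_anticomm j i hij.symm, sub_neg_eq_add, ← two_smul ℝ, TensorProduct.tmul_smul,
        ← algebraMap_smul ℂ (2 : ℝ), smul_smul]
      simp
    rw [this]
    exact Submodule.smul_mem _ _ (Submodule.subset_span ⟨_, _, rfl⟩)

theorem Frame.tmul_vecMul_mem_lieAlg (b : Frame q m) (z : ℂ) (i j : Fin (m + 2)) (hij : i ≠ j) :
    z ⊗ₜ[ℝ] vecMul q (b.basis i) (b.basis j) ∈ lieAlg q := by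
  have : z ⊗ₜ[ℝ] vecMul q (b.basis i) (b.basis j)
      = z • (1 ⊗ₜ[ℝ] vecMul q (b.basis i) (b.basis j)) := by
    rw [TensorProduct.smul_tmul', smul_eq_mul, mul_one]
  rw [this, b.lieAlg_eq_span]
  exact Submodule.smul_mem _ _ (Submodule.subset_span ⟨i, j, hij, rfl⟩)

theorem Frame.cAct_mem_span_of_mem_lieAlg (b : Frame q m) (X : ℂ ⊗[ℝ] EvenCl q)
    (hX : X ∈ lieAlg q) : cAct q 3 X ∈ Submodule.span ℂ (Set.range (spinAct q 3)) := by
  rw [b.lieAlg_eq_span] at hX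
  induction hX using Submodule.span_induction with
  | mem X hX =>
    obtain ⟨i, j, hij, rfl⟩ := hX
    exact b.cAct_mem_span i j hij
  | zero => simp
  | add X Y _ _ hX hY =>
    rw [map_add]
    exact add_mem hX hY
  | smul c X _ hX =>
    rw [map_smul]
    exact Submodule.smul_mem _ _ hX

/-! ### Complexification -/

/-- The real part of a complex cohomology class. -/
def rePart {k : ℕ} (ω : Coh q k ℂ) : Coh q k ℝ := Complex.reLm.compAlternatingMap ω

/-- The imaginary part of a complex cohomology class. -/
def imPart {k : ℕ} (ω : Coh q k ℂ) : Coh q k ℝ := Complex.imLm.compAlternatingMap ω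

theorem rePart_add_imPart {k : ℕ} (ω : Coh q k ℂ) :
    toComplex (rePart ω) + Complex.I • toComplex (imPart ω) = ω := by
  ext x
  change ((ω x).re : ℂ) + Complex.I * ((ω x).im : ℂ) = ω x
  rw [mul_comm, Complex.re_add_im]

/-- The complex-linear extension of a real endomorphism of the cohomology. -/
def complexMap {k : ℕ} (p : Coh q k ℝ →ₗ[ℝ] Coh q k ℝ) : Coh q k ℂ →ₗ[ℂ] Coh q k ℂ where
  toFun ω := toComplex (p (rePart ω)) + Complex.I • toComplex (p (imPart ω))
  map_add' ω η := by
    have h1 : rePart (ω + η) = rePart ω + rePart η := rfl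
    have h2 : imPart (ω + η) = imPart ω + imPart η := rfl
    ext x
    simp [h1, h2, toComplex]
    ring
  map_smul' c ω := by
    have h1 : rePart (c • ω) = c.re • rePart ω - c.im • imPart ω := by
      ext x
      exact Complex.mul_re _ _
    have h2 : imPart (c • ω) = c.re • imPart ω + c.im • rePart ω := by
      ext x
      exact Complex.mul_im _ _
    ext x
    simp only [h1, h2, map_add, map_sub, map_smul]
    change (((c.re * p (rePart ω) x - c.im * p (imPart ω) x : ℝ) : ℂ)
        + Complex.I * ((c.re * p (imPart ω) x + c.im * p (rePart ω) x : ℝ) : ℂ) : ℂ)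
      = c * ((p (rePart ω) x : ℂ) + Complex.I * (p (imPart ω) x : ℂ))
    push_cast
    linear_combination ((p (rePart ω) x : ℂ) + Complex.I * (p (imPart ω) x : ℂ))
      * Complex.re_add_im c - c.im * p (imPart ω) x * Complex.I_sq

theorem complexMap_add {k : ℕ} (p p' : Coh q k ℝ →ₗ[ℝ] Coh q k ℝ) (ω : Coh q k ℂ) :
    complexMap (p + p') ω = complexMap p ω + complexMap p' ω := by
  refine AlternatingMap.ext fun x => ?_
  simp [complexMap, toComplex]
  ring

theorem complexMap_zero {k : ℕ} (ω : Coh q k ℂ) :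
    complexMap (0 : Coh q k ℝ →ₗ[ℝ] Coh q k ℝ) ω = 0 := by
  refine AlternatingMap.ext fun x => ?_
  simp [complexMap, toComplex]

theorem complexMap_id {k : ℕ} (ω : Coh q k ℂ) : complexMap LinearMap.id ω = ω :=
  rePart_add_imPart ω

theorem complexMap_mem {k : ℕ} (p : Coh q k ℝ →ₗ[ℝ] Coh q k ℝ) (ω : Coh q k ℂ) :
    complexMap p ω ∈ complexify (LinearMap.range p) :=
  add_mem (Submodule.subset_span ⟨_, ⟨_, rfl⟩, rfl⟩)
    (Submodule.smul_mem _ _ (Submodule.subset_span ⟨_, ⟨_, rfl⟩, rfl⟩))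

theorem complexMap_spinAct {k : ℕ} (p : Coh q k ℝ →ₗ[ℝ] Coh q k ℝ)
    (hp : ∀ g x, p (spinActReal q k g x) = spinActReal q k g (p x)) (g : spinGroup (realForm q))
    (ω : Coh q k ℂ) : complexMap p (spinAct q k g ω) = spinAct q k g (complexMap p ω) := by
  have h1 : rePart (spinAct q k g ω) = spinActReal q k g (rePart ω) := rfl
  have h2 : imPart (spinAct q k g ω) = spinActReal q k g (imPart ω) := rfl
  change toComplex (p _) + Complex.I • toComplex (p _) = _
  rw [h1, h2, hp, hp]
  rfl

/-- An endomorphism that commutes with the spin group commutes with the Lie algebra. -/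
theorem Frame.complexMap_cAct (b : Frame q m) (p : Coh q 3 ℝ →ₗ[ℝ] Coh q 3 ℝ)
    (hp : ∀ g x, p (spinActReal q 3 g x) = spinActReal q 3 g (p x)) (X : ℂ ⊗[ℝ] EvenCl q)
    (hX : X ∈ lieAlg q) (ω : Coh q 3 ℂ) :
    complexMap p (cAct q 3 X ω) = cAct q 3 X (complexMap p ω) := by
  have h := b.cAct_mem_span_of_mem_lieAlg X hX
  generalize cAct q 3 X = T at h ⊢
  induction h using Submodule.span_induction with
  | mem T hT =>
    obtain ⟨g, rfl⟩ := hT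
    exact complexMap_spinAct p hp g ω
  | zero => simp
  | add T T' _ _ h h' => simp only [LinearMap.add_apply, map_add, h, h']
  | smul c T _ h => simp only [LinearMap.smul_apply, map_smul, h]

theorem spinAct_mem_complexify {k : ℕ} (W : Submodule ℝ (Coh q k ℝ))
    (hW : ∀ g, ∀ x ∈ W, spinActReal q k g x ∈ W) (g : spinGroup (realForm q)) (ω : Coh q k ℂ)
    (hω : ω ∈ complexify W) : spinAct q k g ω ∈ complexify W := by
  induction hω using Submodule.span_induction with
  | mem ω hω =>
    obtain ⟨x, hx, rfl⟩ := hω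
    exact Submodule.subset_span ⟨_, hW g x hx, rfl⟩
  | zero => simp
  | add ω η _ _ h h' =>
    rw [map_add]
    exact add_mem h h'
  | smul c ω _ h =>
    rw [map_smul]
    exact Submodule.smul_mem _ _ h

theorem Frame.cAct_mem_complexify (b : Frame q m) (W : Submodule ℝ (Coh q 3 ℝ))
    (hW : ∀ g, ∀ x ∈ W, spinActReal q 3 g x ∈ W) (X : ℂ ⊗[ℝ] EvenCl q) (hX : X ∈ lieAlg q)
    (ω : Coh q 3 ℂ) (hω : ω ∈ complexify W) : cAct q 3 X ω ∈ complexify W := by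
  have h := b.cAct_mem_span_of_mem_lieAlg X hX
  generalize cAct q 3 X = T at h ⊢
  induction h using Submodule.span_induction with
  | mem T hT =>
    obtain ⟨g, rfl⟩ := hT
    exact spinAct_mem_complexify W hW g ω hω
  | zero => exact zero_mem _
  | add T T' _ _ h h' => exact add_mem h h'
  | smul c T _ h => exact Submodule.smul_mem _ _ h

/-- Complex conjugation of cohomology classes. -/
def conjCoh {k : ℕ} (ω : Coh q k ℂ) : Coh q k ℂ :=
  (Complex.conjAe.toLinearMap).compAlternatingMap ω

theorem conjCoh_mem_complexify {k : ℕ} (W : Submodule ℝ (Coh q k ℝ)) (ω : Coh q k ℂ)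
    (hω : ω ∈ complexify W) : conjCoh ω ∈ complexify W := by
  induction hω using Submodule.span_induction with
  | mem ω hω =>
    obtain ⟨x, hx, rfl⟩ := hω
    have : conjCoh (toComplex x) = toComplex x := by
      ext y
      exact Complex.conj_ofReal _
    rw [this]
    exact Submodule.subset_span ⟨x, hx, rfl⟩
  | zero =>
    have : conjCoh (0 : Coh q k ℂ) = 0 := by
      ext y
      exact map_zero (starRingEnd ℂ)
    rw [this]
    exact zero_mem _
  | add ω η _ _ h h' =>
    have : conjCoh (ω + η) = conjCoh ω + conjCoh η := by
      ext y
      exact map_add (starRingEnd ℂ) _ _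
    rw [this]
    exact add_mem h h'
  | smul c ω _ h =>
    have : conjCoh (c • ω) = (starRingEnd ℂ c) • conjCoh ω := by
      ext y
      exact map_mul (starRingEnd ℂ) _ _
    rw [this]
    exact Submodule.smul_mem _ _ h

theorem conjCoh_ne_zero {k : ℕ} {ω : Coh q k ℂ} (h : ω ≠ 0) : conjCoh ω ≠ 0 := by
  contrapose! h
  ext y
  exact (map_eq_zero (starRingEnd ℂ)).1 (DFunLike.congr_fun h y)

theorem conjCoh_mem_hodgePiece {k : ℕ} {J : EvenCl q} {p : ℤ} {ω : Coh q k ℂ}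
    (h : ω ∈ hodgePiece J p) : conjCoh ω ∈ hodgePiece J (k - p) := by
  intro z hz
  ext y
  have := congrArg (starRingEnd ℂ) (DFunLike.congr_fun (h z hz) y)
  refine this.trans ?_
  change starRingEnd ℂ (_ * _) = _ * starRingEnd ℂ (ω y)
  rw [map_mul, map_mul, map_zpow₀, map_zpow₀, Complex.conj_conj, sub_sub_cancel, mul_comm (_ ^ p)]
  rfl

/-! ### Hodge pieces as eigenspaces -/

/-- The Hodge pieces are eigenspaces: a class on which `E = i J` acts by `p - (3 - p)` has type
`(p, 3 - p)`. -/
theorem mem_hodgePiece_of_cAct {J : EvenCl q} (hJ : J * J = -1) (ω : Coh q 3 ℂ) (p : ℕ)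
    (hp : p ≤ 3) (h : cAct q 3 (gradingElt J) ω = (2 * p - 3 : ℂ) • ω) :
    ω ∈ hodgePiece J (p : ℤ) := by
  have hL : ∀ x, LinearMap.mulLeft ℝ J (LinearMap.mulLeft ℝ J x) = -x := fun x => by
    simp [← mul_assoc, hJ]
  rw [gradingElt, cAct_tmul] at h
  have h' : infAct (LinearMap.mulLeft ℝ J) ω = -(Complex.I * (2 * p - 3)) • ω := by
    have := congrArg (fun η => -Complex.I • η) h
    simp only [smul_smul] at this
    rw [neg_mul, Complex.I_mul_I, neg_neg, one_smul] at this
    rw [this]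
    congr 1
    ring
  intro z hz
  have key := compLinearMap_of_infAct_eigen _ hL ω _ h' z.re z.im
  have hmul : LinearMap.mulLeft ℝ (algebraMap ℝ (EvenCl q) z.re + z.im • J)
      = z.re • LinearMap.id + z.im • LinearMap.mulLeft ℝ J := by
    ext x
    simp [add_mul, Algebra.algebraMap_eq_smul_one]
  rw [pullback, hmul, key]
  congr 1
  have e1 : z = z.re + z.im * Complex.I := (Complex.re_add_im z).symm
  have e2 : starRingEnd ℂ z = z.re - z.im * Complex.I := by
    apply Complex.ext <;> simp
  have I2 : Complex.I ^ 2 = -1 := Complex.I_sq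
  have hq : ((3 : ℕ) : ℤ) - p = ((3 - p : ℕ) : ℤ) := by omega
  rw [hq, zpow_natCast, zpow_natCast]
  generalize starRingEnd ℂ z = w at e2 ⊢
  generalize (z.re : ℂ) = x at e1 e2 ⊢
  generalize (z.im : ℂ) = y at e1 e2 ⊢
  rw [e1, e2]
  have I3 : Complex.I ^ 3 = -Complex.I := by rw [pow_succ, I2]; ring
  interval_cases p <;> ring_nf <;> simp only [I2, I3] <;> ring

/-- The grading element satisfies `(E² - 1)(E² - 9) = 0` on the third cohomology. -/
theorem cAct_quartic {K : EvenCl q} (hK : K * K = -1) (ω : Coh q 3 ℂ) :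
    cAct q 3 (gradingElt K) (cAct q 3 (gradingElt K)
      (cAct q 3 (gradingElt K) (cAct q 3 (gradingElt K) ω)))
      = (10 : ℂ) • cAct q 3 (gradingElt K) (cAct q 3 (gradingElt K) ω) - (9 : ℂ) • ω := by
  have hL : ∀ x, LinearMap.mulLeft ℝ K (LinearMap.mulLeft ℝ K x) = -x := fun x => by
    simp [← mul_assoc, hK]
  have key := infAct_quartic _ hL ω
  have hsm : ∀ (c : ℂ) η, infAct (LinearMap.mulLeft ℝ K) (c • η)
      = c • infAct (LinearMap.mulLeft ℝ K) η :=
    fun c η => map_smul (infActLin (EvenCl q) 3 (LinearMap.mulLeft ℝ K)) c η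
  simp only [gradingElt, cAct_tmul, hsm, smul_smul]
  have I4 : Complex.I * Complex.I * Complex.I * Complex.I = 1 := by
    rw [Complex.I_mul_I, neg_one_mul, neg_mul, Complex.I_mul_I, neg_neg]
  rw [← mul_assoc, ← mul_assoc, I4, Complex.I_mul_I, one_smul]
  rw [add_assoc] at key
  rw [eq_neg_of_add_eq_zero_left key]
  module

/-- A stable subspace is the sum of its intersections with the Hodge pieces. -/
theorem Frame.complexify_le_iSup_hodgePiece (b : Frame q m) (W : Submodule ℝ (Coh q 3 ℝ))
    (hW : ∀ g, ∀ x ∈ W, spinActReal q 3 g x ∈ W) :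
    complexify W ≤ ⨆ p : ℤ, complexify W ⊓ hodgePiece b.J p := by
  intro ω hω
  set E := cAct q 3 (gradingElt b.J) with hE
  have hst : ∀ η ∈ complexify W, E η ∈ complexify W := fun η hη =>
    b.cAct_mem_complexify W hW _ (b.tmul_vecMul_mem_lieAlg _ _ _ (by simp)) η hη
  have h4 : E (E (E (E ω))) = (10 : ℂ) • E (E ω) - (9 : ℂ) • ω := cAct_quartic b.J_mul_self ω
  have m0 := hω
  have m1 := hst _ m0
  have m2 := hst _ m1
  have m3 := hst _ m2
  -- the Lagrange interpolation projections onto the four eigenspaces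
  have hpiece : ∀ (p : ℕ) (c0 c1 c2 c3 : ℂ), p ≤ 3 →
      E (c0 • ω + c1 • E ω + c2 • E (E ω) + c3 • E (E (E ω)))
        = (2 * p - 3 : ℂ) • (c0 • ω + c1 • E ω + c2 • E (E ω) + c3 • E (E (E ω))) →
      c0 • ω + c1 • E ω + c2 • E (E ω) + c3 • E (E (E ω))
        ∈ ⨆ p : ℤ, complexify W ⊓ hodgePiece b.J p := fun p c0 c1 c2 c3 hp h =>
    Submodule.mem_iSup_of_mem (p : ℤ) ⟨add_mem (add_mem (add_mem
      (Submodule.smul_mem _ _ m0) (Submodule.smul_mem _ _ m1)) (Submodule.smul_mem _ _ m2))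
      (Submodule.smul_mem _ _ m3), mem_hodgePiece_of_cAct b.J_mul_self _ p hp h⟩
  have p0 := hpiece 0 (-1 / 16) (1 / 48) (1 / 16) (-1 / 48) (by norm_num) (by
    simp only [map_add, map_smul, h4]; push_cast; module)
  have p1 := hpiece 1 (9 / 16) (-9 / 16) (-1 / 16) (1 / 16) (by norm_num) (by
    simp only [map_add, map_smul, h4]; push_cast; module)
  have p2 := hpiece 2 (9 / 16) (9 / 16) (-1 / 16) (-1 / 16) (by norm_num) (by
    simp only [map_add, map_smul, h4]; push_cast; module)
  have p3 := hpiece 3 (-1 / 16) (-1 / 48) (1 / 16) (1 / 48) (by norm_num) (by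
    simp only [map_add, map_smul, h4]; push_cast; module)
  convert! add_mem (add_mem p0 p1) (add_mem p2 p3) using 1
  module

/-! ### Three-forms built from a vector and a spinor -/

/-- The complexified Clifford algebra. It is a definition and not an abbreviation, with its ring and
algebra structures declared below, so that instances are not searched through the tensor product. -/
def ComplexCl (q : QuadraticForm ℚ V) : Type _ := ℂ ⊗[ℝ] CliffordAlgebra (realForm q)

instance (q : QuadraticForm ℚ V) : Ring (ComplexCl q) :=
  inferInstanceAs (Ring (ℂ ⊗[ℝ] CliffordAlgebra (realForm q)))

instance (q : QuadraticForm ℚ V) : Algebra ℂ (ComplexCl q) :=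
  inferInstanceAs (Algebra ℂ (ℂ ⊗[ℝ] CliffordAlgebra (realForm q)))

instance (q : QuadraticForm ℚ V) : Algebra ℝ (ComplexCl q) :=
  inferInstanceAs (Algebra ℝ (ℂ ⊗[ℝ] CliffordAlgebra (realForm q)))

instance (q : QuadraticForm ℚ V) : IsScalarTower ℝ ℂ (ComplexCl q) :=
  inferInstanceAs (IsScalarTower ℝ ℂ (ℂ ⊗[ℝ] CliffordAlgebra (realForm q)))

/-- The inclusion of the complexified even Clifford algebra into the complexified Clifford
algebra. -/
def evenIncl (q : QuadraticForm ℚ V) : (ℂ ⊗[ℝ] EvenCl q) →ₐ[ℂ] ComplexCl q :=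
  Algebra.TensorProduct.map (AlgHom.id ℂ ℂ) (even (realForm q)).val

/-- The inclusion of the real Clifford algebra into the complexified one. -/
def clIncl (q : QuadraticForm ℚ V) : CliffordAlgebra (realForm q) →ₐ[ℝ] ComplexCl q :=
  Algebra.TensorProduct.includeRight

theorem evenIncl_tmul (z : ℂ) (a : EvenCl q) : evenIncl q (z ⊗ₜ a) = z • clIncl q a := by
  have h : z ⊗ₜ[ℝ] (a : CliffordAlgebra (realForm q)) = (z * 1) ⊗ₜ[ℝ] a.1 := by rw [mul_one]
  exact h

theorem clIncl_injective (q : QuadraticForm ℚ V) : Function.Injective (clIncl q) :=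
  Algebra.TensorProduct.includeRight_injective (algebraMap ℝ ℂ).injective

/-- The bilinear form `φ(x̃ U y)` on the even Clifford algebra, where `x̃` is the reversal. It
depends equivariantly on `U`, since `g̃ = g⁻¹` on the spin group. -/
def vectorForm (φ : ComplexCl q →ₗ[ℂ] ℂ) (U : ComplexCl q) :
    EvenCl q →ₗ[ℝ] EvenCl q →ₗ[ℝ] ℂ :=
  LinearMap.mk₂ ℝ (fun x y => φ (clIncl q (reverse (x : CliffordAlgebra (realForm q))) * U
      * clIncl q y))
    (fun x x' y => by simp [add_mul])
    (fun c x y => by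
      simp only [SetLike.val_smul, map_smul, smul_mul_assoc]
      exact φ.map_smul_of_tower c _)
    (fun x y y' => by simp [mul_add])
    (fun c x y => by
      simp only [SetLike.val_smul, map_smul, mul_smul_comm]
      exact φ.map_smul_of_tower c _)

theorem vectorForm_apply (φ : ComplexCl q →ₗ[ℂ] ℂ) (U : ComplexCl q) (x y : EvenCl q) :
    vectorForm φ U x y
      = φ (clIncl q (reverse (x : CliffordAlgebra (realForm q))) * U * clIncl q y) := rfl

/-- The linear form `ψ(P x)` on the even Clifford algebra. -/
def spinorForm (ψ : ComplexCl q →ₗ[ℂ] ℂ) (P : ComplexCl q) : EvenCl q →ₗ[ℝ] ℂ where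
  toFun x := ψ (P * clIncl q x)
  map_add' x y := by simp [mul_add]
  map_smul' c x := by
    simp only [SetLike.val_smul, map_smul, mul_smul_comm]
    exact ψ.map_smul_of_tower c _

theorem spinorForm_apply (ψ : ComplexCl q →ₗ[ℂ] ℂ) (P : ComplexCl q) (x : EvenCl q) :
    spinorForm ψ P x = ψ (P * clIncl q x) := rfl

/-- The cohomology class `φ(x̃ U y) ∧ ψ(P z)`, which depends linearly on the "vector" `U` and the
"spinor" `P`. -/
def vectorSpinorForm (φ ψ : ComplexCl q →ₗ[ℂ] ℂ) :
    ComplexCl q →ₗ[ℂ] ComplexCl q →ₗ[ℂ] Coh q 3 ℂ :=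
  LinearMap.mk₂ ℂ (fun U P => wedge (vectorForm φ U) (spinorForm ψ P))
    (fun U U' P => ext_tri fun x y z => by
      simp only [tri_wedge, tri_add, vectorForm_apply, mul_add, add_mul, map_add]; ring)
    (fun c U P => ext_tri fun x y z => by
      simp only [tri_wedge, tri_smul, vectorForm_apply, mul_smul_comm, smul_mul_assoc, map_smul,
        smul_eq_mul]
      ring)
    (fun U P P' => ext_tri fun x y z => by
      simp only [tri_wedge, tri_add, spinorForm_apply, add_mul, map_add]; ring)
    (fun c U P => ext_tri fun x y z => by
      simp only [tri_wedge, tri_smul, spinorForm_apply, smul_mul_assoc, map_smul, smul_eq_mul]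
      ring)

theorem tri_vectorSpinorForm (φ ψ : ComplexCl q →ₗ[ℂ] ℂ) (U P : ComplexCl q) (x y z : EvenCl q) :
    tri (vectorSpinorForm φ ψ U P) x y z
      = (vectorForm φ U x y - vectorForm φ U y x) * spinorForm ψ P z
      + (vectorForm φ U y z - vectorForm φ U z y) * spinorForm ψ P x
      + (vectorForm φ U z x - vectorForm φ U x z) * spinorForm ψ P y := rfl

/-- The Lie algebra acts on the forms through commutators with the vector and through right
multiplication on the spinor. -/
theorem cAct_vectorSpinorForm (φ ψ : ComplexCl q →ₗ[ℂ] ℂ) (X : ℂ ⊗[ℝ] EvenCl q)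
    (hX : X ∈ lieAlg q) (U P : ComplexCl q) :
    cAct q 3 X (vectorSpinorForm φ ψ U P)
      = vectorSpinorForm φ ψ (evenIncl q X * U - U * evenIncl q X) P
        - vectorSpinorForm φ ψ U (P * evenIncl q X) := by
  induction hX using Submodule.span_induction with
  | mem X hX =>
    obtain ⟨v, w, rfl⟩ := hX
    set a := vecMul q v w - vecMul q w v with ha
    have hrev : reverse (a : CliffordAlgebra (realForm q))
        = -(a : CliffordAlgebra (realForm q)) := by
      change reverse (ι (realForm q) v * ι (realForm q) w - ι (realForm q) w * ι (realForm q) v)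
        = -(ι (realForm q) v * ι (realForm q) w - ι (realForm q) w * ι (realForm q) v)
      rw [map_sub, reverse.map_mul, reverse.map_mul, reverse_ι, reverse_ι, neg_sub]
    rw [cAct_tmul, one_smul, evenIncl_tmul, one_smul]
    have h1 : ∀ x y, vectorForm φ U (a * x) y = -vectorForm φ (clIncl q a * U) x y := by
      intro x y
      simp only [vectorForm_apply, MulMemClass.coe_mul, reverse.map_mul, hrev, map_mul, map_neg,
        mul_neg, neg_mul, mul_assoc]
    have h2 : ∀ x y, vectorForm φ U x (a * y) = vectorForm φ (U * clIncl q a) x y := by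
      intro x y
      simp only [vectorForm_apply, MulMemClass.coe_mul, map_mul, mul_assoc]
    have h3 : ∀ x, spinorForm ψ P (a * x) = spinorForm ψ (P * clIncl q a) x := by
      intro x
      simp only [spinorForm_apply, MulMemClass.coe_mul, map_mul, mul_assoc]
    have h4 : ∀ x y, vectorForm φ (clIncl q a * U - U * clIncl q a) x y
        = vectorForm φ (clIncl q a * U) x y - vectorForm φ (U * clIncl q a) x y := by
      intro x y
      simp only [vectorForm_apply, mul_sub, sub_mul, map_sub]
    refine ext_tri fun x y z => ?_
    simp only [tri_infAct, tri_sub, tri_vectorSpinorForm, LinearMap.mulLeft_apply, h1, h2, h3, h4]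
    ring
  | zero => simp
  | add X Y _ _ hX hY =>
    simp only [map_add, LinearMap.add_apply, hX, hY, add_mul, mul_add, map_sub, LinearMap.sub_apply]
    abel
  | smul c X _ hX =>
    simp only [map_smul, LinearMap.smul_apply, hX, smul_mul_assoc, mul_smul_comm, ← smul_sub]

/-- The spin group acts on the forms by conjugation of the vector and by right multiplication on
the spinor. -/
theorem spinAct_vectorSpinorForm (φ ψ : ComplexCl q →ₗ[ℂ] ℂ) (g : spinGroup (realForm q))
    (U P : ComplexCl q) :
    spinAct q 3 g (vectorSpinorForm φ ψ U P)
      = vectorSpinorForm φ ψ (clIncl q g * U * clIncl q (star (g : CliffordAlgebra (realForm q))))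
        (P * clIncl q (star (g : CliffordAlgebra (realForm q)))) := by
  have hrev : reverse (star (g : CliffordAlgebra (realForm q))) = g := by
    rw [star_def, reverse_reverse, spinGroup.involute_eq g.2]
  refine ext_tri fun x y z => ?_
  refine (tri_compLinearMap (LinearMap.mulLeft ℝ (spinToEven g⁻¹)) _ x y z).trans ?_
  simp only [tri_vectorSpinorForm, LinearMap.mulLeft_apply, vectorForm_apply, spinorForm_apply,
    MulMemClass.coe_mul, coe_spinToEven_inv, reverse.map_mul, hrev, map_mul, mul_assoc]

/-! ### Isotropic vectors and the spinor annihilated by them -/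

namespace Frame

/-- The vectors of the frame in the complexified Clifford algebra. -/
def ce (b : Frame q m) (k : Fin (m + 2)) : ComplexCl q := clIncl q (b.e k)

/-- The isotropic vector `uⱼ = b_{2j} + i b_{2j+1}`, of weight `eⱼ`. -/
def u (b : Frame q m) (j : Fin (m / 2 + 1)) : ComplexCl q :=
  b.ce ⟨2 * j.val, by omega⟩ + Complex.I • b.ce ⟨2 * j.val + 1, by omega⟩

/-- The isotropic vector `\bar uⱼ = b_{2j} - i b_{2j+1}`, of weight `-eⱼ`. -/
def ubar (b : Frame q m) (j : Fin (m / 2 + 1)) : ComplexCl q :=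
  b.ce ⟨2 * j.val, by omega⟩ - Complex.I • b.ce ⟨2 * j.val + 1, by omega⟩

/-- The square of the vectors of the `j`-th coordinate plane. -/
def planeSgn {m : ℕ} (j : Fin (m / 2 + 1)) : ℂ := if j.val = 0 then 1 else -1

theorem planeSgn_mul_self (j : Fin (m / 2 + 1)) : planeSgn j * planeSgn j = 1 := by
  unfold planeSgn
  split_ifs <;> norm_num

theorem ce_anticomm (b : Frame q m) (k l : Fin (m + 2)) (h : k ≠ l) :
    b.ce k * b.ce l = -(b.ce l * b.ce k) := by
  rw [ce, ce, ← map_mul, b.e_anticomm k l h, map_neg, map_mul]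

theorem ce_mul_self (b : Frame q m) (k : Fin (m + 2)) :
    b.ce k * b.ce k = ((sgn k : ℝ) : ℂ) • (1 : ComplexCl q) := by
  rw [ce, ← map_mul, b.e_mul_self, AlgHom.commutes, ← Complex.coe_algebraMap, algebraMap_smul,
    Algebra.algebraMap_eq_smul_one]

theorem ce_fst_mul_self (b : Frame q m) (j : Fin (m / 2 + 1)) :
    b.ce ⟨2 * j.val, by omega⟩ * b.ce ⟨2 * j.val, by omega⟩ = planeSgn j • 1 := by
  rw [ce_mul_self, sgn, planeSgn]
  by_cases h : j.val = 0
  · simp [h]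
  · rw [if_neg h, if_neg (by simp only; omega)]
    simp

theorem ce_snd_mul_self (b : Frame q m) (j : Fin (m / 2 + 1)) :
    b.ce ⟨2 * j.val + 1, by omega⟩ * b.ce ⟨2 * j.val + 1, by omega⟩ = planeSgn j • 1 := by
  rw [ce_mul_self, sgn, planeSgn]
  by_cases h : j.val = 0
  · simp [h]
  · rw [if_neg h, if_neg (by simp only; omega)]
    simp

theorem ce_mul_u (b : Frame q m) (k : Fin (m + 2)) (j : Fin (m / 2 + 1)) (h : k.val ≠ 2 * j.val)
    (h' : k.val ≠ 2 * j.val + 1) : b.ce k * b.u j = -(b.u j * b.ce k) := by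
  rw [u, mul_add, add_mul, mul_smul_comm, smul_mul_assoc, b.ce_anticomm k _ fun e => h (by rw [e]),
    b.ce_anticomm k _ fun e => h' (by rw [e]), smul_neg, neg_add]

theorem ce_mul_ubar (b : Frame q m) (k : Fin (m + 2)) (j : Fin (m / 2 + 1))
    (h : k.val ≠ 2 * j.val) (h' : k.val ≠ 2 * j.val + 1) :
    b.ce k * b.ubar j = -(b.ubar j * b.ce k) := by
  rw [ubar, mul_sub, sub_mul, mul_smul_comm, smul_mul_assoc,
    b.ce_anticomm k _ fun e => h (by rw [e]), b.ce_anticomm k _ fun e => h' (by rw [e]), smul_neg,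
    neg_sub', sub_neg_eq_add]

theorem ce_snd_mul_fst (b : Frame q m) (j : Fin (m / 2 + 1)) :
    b.ce ⟨2 * j.val + 1, by omega⟩ * b.ce ⟨2 * j.val, by omega⟩
      = -(b.ce ⟨2 * j.val, by omega⟩ * b.ce ⟨2 * j.val + 1, by omega⟩) :=
  b.ce_anticomm _ _ (by simp)

theorem u_mul_self (b : Frame q m) (j : Fin (m / 2 + 1)) : b.u j * b.u j = 0 := by
  have h := b.ce_snd_mul_fst j
  rw [u, add_mul, mul_add, mul_add]
  simp only [mul_smul_comm, smul_mul_assoc, h, ce_fst_mul_self, ce_snd_mul_self, smul_smul,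
    ← mul_assoc, Complex.I_mul_I]
  module

theorem u_mul_ubar (b : Frame q m) (j : Fin (m / 2 + 1)) :
    b.u j * b.ubar j = (2 * planeSgn j) • 1
      - (2 * Complex.I) • (b.ce ⟨2 * j.val, by omega⟩ * b.ce ⟨2 * j.val + 1, by omega⟩) := by
  have h := b.ce_snd_mul_fst j
  rw [u, ubar, add_mul, mul_sub, mul_sub]
  simp only [mul_smul_comm, smul_mul_assoc, h, ce_fst_mul_self, ce_snd_mul_self, smul_smul,
    ← mul_assoc, Complex.I_mul_I]
  module

theorem ubar_mul_u (b : Frame q m) (j : Fin (m / 2 + 1)) :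
    b.ubar j * b.u j = (2 * planeSgn j) • 1
      + (2 * Complex.I) • (b.ce ⟨2 * j.val, by omega⟩ * b.ce ⟨2 * j.val + 1, by omega⟩) := by
  have h := b.ce_snd_mul_fst j
  rw [u, ubar, sub_mul, mul_add, mul_add]
  simp only [mul_smul_comm, smul_mul_assoc, h, ce_fst_mul_self, ce_snd_mul_self, smul_smul,
    ← mul_assoc, Complex.I_mul_I]
  module

theorem u_mul_ubar_add (b : Frame q m) (j : Fin (m / 2 + 1)) :
    b.u j * b.ubar j + b.ubar j * b.u j = (4 * planeSgn j) • 1 := by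
  rw [u_mul_ubar, ubar_mul_u]
  module

theorem u_anticomm (b : Frame q m) (i j : Fin (m / 2 + 1)) : b.u i * b.u j = -(b.u j * b.u i) := by
  rcases eq_or_ne i j with rfl | h
  · rw [u_mul_self, neg_zero]
  · have hv : i.val ≠ j.val := fun e => h (Fin.ext e)
    conv_lhs => rw [u, add_mul, smul_mul_assoc, b.ce_mul_u _ j (by simp; omega) (by simp; omega),
      b.ce_mul_u _ j (by simp; omega) (by simp; omega), smul_neg, ← neg_add, ← mul_smul_comm,
      ← mul_add]
    rfl

theorem u_mul_ubar_anticomm (b : Frame q m) (i j : Fin (m / 2 + 1)) (h : i ≠ j) :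
    b.u i * b.ubar j = -(b.ubar j * b.u i) := by
  have hv : i.val ≠ j.val := fun e => h (Fin.ext e)
  conv_lhs => rw [u, add_mul, smul_mul_assoc, b.ce_mul_ubar _ j (by simp; omega) (by simp; omega),
    b.ce_mul_ubar _ j (by simp; omega) (by simp; omega), smul_neg, ← neg_add, ← mul_smul_comm,
    ← mul_add]
  rfl

theorem evenIncl_vecMul (b : Frame q m) (z : ℂ) (k l : Fin (m + 2)) :
    evenIncl q (z ⊗ₜ vecMul q (b.basis k) (b.basis l)) = z • (b.ce k * b.ce l) := by
  rw [evenIncl_tmul, ce, ce, ← map_mul]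
  rfl

theorem realForm_fst (b : Frame q m) (j : Fin (m / 2 + 1)) :
    ((realForm q (b.fst j) : ℝ) : ℂ) = planeSgn j := by
  rw [fst, b.form_apply, planeSgn]
  by_cases h : j.val = 0
  · simp [h]
  · rw [if_neg h, if_neg (by simp only; omega)]
    simp

theorem evenIncl_cartan (b : Frame q m) (j : Fin (m / 2 + 1)) :
    evenIncl q (b.cartan j) = (-(Complex.I / 2) * planeSgn j) •
      (b.ce ⟨2 * j.val, by omega⟩ * b.ce ⟨2 * j.val + 1, by omega⟩) := by
  rw [cartan, realForm_fst]
  exact b.evenIncl_vecMul _ _ _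

/-- The Cartan element in terms of the isotropic vectors: `4 Hⱼ + 2 = ± uⱼ \bar uⱼ`. -/
theorem u_mul_ubar_eq_cartan (b : Frame q m) (j : Fin (m / 2 + 1)) :
    planeSgn j • (b.u j * b.ubar j) = (2 : ℂ) • 1 + (4 : ℂ) • evenIncl q (b.cartan j) := by
  rw [u_mul_ubar, evenIncl_cartan, smul_sub, smul_smul, smul_smul, smul_smul]
  have h := planeSgn_mul_self j
  rw [show planeSgn j * (2 * planeSgn j) = 2 by linear_combination 2 * h]
  module

theorem cartan_mul_u (b : Frame q m) (j : Fin (m / 2 + 1)) :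
    evenIncl q (b.cartan j) * b.u j = (1 / 2 : ℂ) • b.u j := by
  have h := congrArg (· * b.u j) (b.u_mul_ubar_eq_cartan j)
  have h2 : b.u j * b.ubar j * b.u j = (4 * planeSgn j) • b.u j := by
    have := congrArg (b.u j * ·) (b.u_mul_ubar_add j)
    simp only [mul_add, ← mul_assoc, b.u_mul_self, zero_mul, zero_add, mul_smul_comm,
      mul_one] at this
    exact this
  simp only [smul_mul_assoc, h2, add_mul, one_mul, smul_smul] at h
  rw [show planeSgn j * (4 * planeSgn j) = 4 by linear_combination 4 * planeSgn_mul_self j] at h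
  linear_combination (norm := module) (-1 / 4 : ℂ) • h

theorem mul_cartan_of_mul_u (b : Frame q m) (j : Fin (m / 2 + 1)) (P : ComplexCl q)
    (hP : P * b.u j = 0) : P * evenIncl q (b.cartan j) = (-1 / 2 : ℂ) • P := by
  have h := congrArg (P * ·) (b.u_mul_ubar_eq_cartan j)
  simp only [mul_smul_comm, ← mul_assoc, hP, zero_mul, smul_zero, mul_add, mul_one] at h
  linear_combination (norm := module) (-1 / 4 : ℂ) • h

theorem cartan_comm_of_ne (b : Frame q m) (i j : Fin (m / 2 + 1)) (h : i ≠ j) :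
    evenIncl q (b.cartan i) * b.u j = b.u j * evenIncl q (b.cartan i) := by
  have hv : i.val ≠ j.val := fun e => h (Fin.ext e)
  rw [evenIncl_cartan, smul_mul_assoc, mul_smul_comm, mul_assoc,
    b.ce_mul_u _ j (by simp; omega) (by simp; omega), mul_neg, ← mul_assoc,
    b.ce_mul_u _ j (by simp; omega) (by simp; omega)]
  simp only [neg_mul, neg_neg, mul_assoc]

theorem evenIncl_rootSum (b : Frame q m) (i j : Fin (m / 2 + 1)) :
    evenIncl q (b.rootSum i j) = b.u i * b.u j := by
  simp only [rootSum, fst, snd, TensorProduct.tmul_sub, TensorProduct.tmul_add, map_add, map_sub,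
    evenIncl_vecMul, u, add_mul, mul_add, smul_mul_assoc, mul_smul_comm, smul_add, smul_smul,
    Complex.I_mul_I]
  module

theorem evenIncl_rootDiff (b : Frame q m) (i j : Fin (m / 2 + 1)) :
    evenIncl q (b.rootDiff i j) = b.u i * b.ubar j := by
  simp only [rootDiff, fst, snd, TensorProduct.tmul_sub, TensorProduct.tmul_add, map_add, map_sub,
    evenIncl_vecMul, u, ubar, add_mul, mul_sub, smul_mul_assoc, mul_smul_comm, smul_add,
    smul_smul, Complex.I_mul_I]
  module

theorem evenIncl_rootShort (b : Frame q m) (i : Fin (m / 2 + 1)) :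
    evenIncl q (b.rootShort i) = b.u i * b.ce (Fin.last (m + 1)) := by
  simp only [rootShort, fst, snd, map_add, evenIncl_vecMul, u, add_mul, smul_mul_assoc, one_smul]

theorem cartan_mem_lieAlg (b : Frame q m) (j : Fin (m / 2 + 1)) : b.cartan j ∈ lieAlg q :=
  b.tmul_vecMul_mem_lieAlg _ _ _ (by simp)

theorem rootSum_mem_lieAlg (b : Frame q m) (i j : Fin (m / 2 + 1)) (h : i ≠ j) :
    b.rootSum i j ∈ lieAlg q := by
  have hv : i.val ≠ j.val := fun e => h (Fin.ext e)
  rw [rootSum, TensorProduct.tmul_sub, TensorProduct.tmul_add]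
  refine add_mem (sub_mem ?_ ?_) (add_mem ?_ ?_) <;>
    exact b.tmul_vecMul_mem_lieAlg _ _ _ (by simp; omega)

theorem rootDiff_mem_lieAlg (b : Frame q m) (i j : Fin (m / 2 + 1)) (h : i ≠ j) :
    b.rootDiff i j ∈ lieAlg q := by
  have hv : i.val ≠ j.val := fun e => h (Fin.ext e)
  rw [rootDiff, TensorProduct.tmul_add, TensorProduct.tmul_sub]
  refine add_mem (add_mem ?_ ?_) (sub_mem ?_ ?_) <;>
    exact b.tmul_vecMul_mem_lieAlg _ _ _ (by simp; omega)

theorem rootShort_mem_lieAlg (b : Frame q m) (hodd : Odd m) (i : Fin (m / 2 + 1)) :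
    b.rootShort i ∈ lieAlg q := by
  have := i.isLt
  obtain ⟨k, rfl⟩ := hodd
  exact add_mem (b.tmul_vecMul_mem_lieAlg _ _ _ (by simp [Fin.ext_iff]; omega))
    (b.tmul_vecMul_mem_lieAlg _ _ _ (by simp [Fin.ext_iff]; omega))

/-- There is a nonzero element annihilated by right multiplication with all `uⱼ`: a highest weight
vector, of weight `ω_n`, for the action `P ↦ -P X` of the Lie algebra. It is a product of some of
the `uⱼ`. -/
theorem exists_mul_u_eq_zero (b : Frame q m) : ∃ P : ComplexCl q, P ≠ 0 ∧ ∀ j, P * b.u j = 0 := by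
  classical
  have key : ∀ s : Finset (Fin (m / 2 + 1)), ∃ P : ComplexCl q, P ≠ 0 ∧ ∀ j ∈ s, P * b.u j = 0 := by
    intro s
    induction s using Finset.induction_on with
    | empty =>
      refine ⟨1, fun h => one_ne_zero (α := CliffordAlgebra (realForm q)) ?_, by simp⟩
      exact clIncl_injective q (by rw [map_one, map_zero, h])
    | insert k s _ ih =>
      obtain ⟨P, hP, h⟩ := ih
      by_cases hk : P * b.u k = 0
      · exact ⟨P, hP, fun j hj => (Finset.mem_insert.1 hj).elim (fun e => e ▸ hk) (h j)⟩
      · refine ⟨P * b.u k, hk, fun j hj => ?_⟩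
        rcases Finset.mem_insert.1 hj with rfl | hj
        · rw [mul_assoc, u_mul_self, mul_zero]
        · rw [mul_assoc, u_anticomm, mul_neg, ← mul_assoc, h j hj, zero_mul, neg_zero]
  obtain ⟨P, hP, h⟩ := key Finset.univ
  exact ⟨P, hP, fun j => h j (Finset.mem_univ _)⟩

end Frame

/-! ### Nonvanishing of the highest weight vector -/

theorem comm_mul_of_anticomm {R : Type*} [Ring R] {x a c : R} (ha : x * a = -(a * x))
    (hc : x * c = -(c * x)) : x * (a * c) = a * c * x := by
  calc x * (a * c) = (x * a) * c := by rw [mul_assoc]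
    _ = -(a * (x * c)) := by rw [ha]; noncomm_ring
    _ = a * c * x := by rw [hc]; noncomm_ring

theorem anticomm_mul_left {R : Type*} [Ring R] {x a c : R} (ha : x * a = -(a * x))
    (hc : x * c = c * x) : x * (a * c) = -(a * c * x) := by
  calc x * (a * c) = (x * a) * c := by rw [mul_assoc]
    _ = -(a * (x * c)) := by rw [ha]; noncomm_ring
    _ = -(a * c * x) := by rw [hc]; noncomm_ring

namespace Frame

theorem ce_comm_mul (b : Frame q m) (k i j : Fin (m + 2)) (hi : k ≠ i) (hj : k ≠ j) :
    b.ce k * (b.ce i * b.ce j) = b.ce i * b.ce j * b.ce k :=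
  comm_mul_of_anticomm (b.ce_anticomm _ _ hi) (b.ce_anticomm _ _ hj)

theorem val_one (hm : 2 ≤ m) : (1 : Fin (m / 2 + 1)).val = 1 := by
  rw [Fin.val_one', Nat.mod_eq_of_lt]
  omega

theorem zero_ne_one (hm : 2 ≤ m) : (0 : Fin (m / 2 + 1)) ≠ 1 := fun h => by
  have := congrArg Fin.val h
  rw [val_one hm] at this
  exact absurd this (by simp)

theorem evenIncl_cartan_one (b : Frame q m) (hm : 2 ≤ m) : evenIncl q (b.cartan 1)
    = (Complex.I / 2) • (b.ce ⟨2, by omega⟩ * b.ce ⟨3, by omega⟩) := by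
  have hv := val_one hm
  have e1 : (⟨2 * (1 : Fin (m / 2 + 1)).val, by omega⟩ : Fin (m + 2)) = ⟨2, by omega⟩ :=
    Fin.ext (congrArg (2 * ·) hv)
  have e2 : (⟨2 * (1 : Fin (m / 2 + 1)).val + 1, by omega⟩ : Fin (m + 2)) = ⟨3, by omega⟩ :=
    Fin.ext (congrArg (2 * · + 1) hv)
  rw [evenIncl_cartan, e1, e2, planeSgn, if_neg (by rw [hv]; norm_num)]
  congr 1
  ring

/-- The class built from the highest weight vector `u₁` of the vector representation and the
highest weight vector `P` of the spin representation does not vanish for suitable `φ` and `ψ`: it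
is evaluated at `x = b₂ b₄`, `y = b₀ b₂ b₄ b₆ b₇ b₈` and `1`. The functional `ψ` kills `P x` and
`P y`, which have another weight than `P` for `b₂ b₃`, and
`x̃ u₁ y - ỹ u₁ x = 2 b₆ b₇ b₈`. -/
theorem exists_vectorSpinorForm_ne_zero (b : Frame q m) (hm : 7 ≤ m) (P : ComplexCl q)
    (hP0 : P ≠ 0) (hP : ∀ j, P * b.u j = 0) :
    ∃ φ ψ : ComplexCl q →ₗ[ℂ] ℂ, vectorSpinorForm φ ψ (b.u 0) P ≠ 0 := by
  let i0 : Fin (m + 2) := ⟨0, by omega⟩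
  let i1 : Fin (m + 2) := ⟨1, by omega⟩
  let i2 : Fin (m + 2) := ⟨2, by omega⟩
  let i3 : Fin (m + 2) := ⟨3, by omega⟩
  let i4 : Fin (m + 2) := ⟨4, by omega⟩
  let i6 : Fin (m + 2) := ⟨6, by omega⟩
  let i7 : Fin (m + 2) := ⟨7, by omega⟩
  let i8 : Fin (m + 2) := ⟨8, by omega⟩
  have hne : ∀ {a c : ℕ} (ha : a < m + 2) (hc : c < m + 2), a ≠ c →
      (⟨a, ha⟩ : Fin (m + 2)) ≠ ⟨c, hc⟩ := fun _ _ h e => h (congrArg Fin.val e)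
  have hneg : ∀ k : Fin (m + 2), 2 ≤ k.val → b.ce k * b.ce k = -1 := fun k hk => by
    rw [b.ce_mul_self, sgn, if_neg (by omega)]
    simp
  let x : EvenCl q := vecMul q (b.basis i2) (b.basis i4)
  let y : EvenCl q := vecMul q (b.basis i0) (b.basis i2) * vecMul q (b.basis i4) (b.basis i6)
    * vecMul q (b.basis i7) (b.basis i8)
  have hvec : ∀ i j, ((vecMul q (b.basis i) (b.basis j) : EvenCl q) :
      CliffordAlgebra (realForm q)) = b.e i * b.e j := fun _ _ => rfl
  have hrev : ∀ i, reverse (b.e i) = b.e i := fun i => reverse_ι _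
  set X := b.ce i2 * b.ce i4 with hX
  set T := b.ce i6 * (b.ce i7 * b.ce i8) with hT
  set Xr := b.ce i4 * b.ce i2 with hXr
  set U := b.u 0 with hU
  have hU' : U = b.ce i0 + Complex.I • b.ce i1 := rfl
  have x1 : clIncl q x = X := by simp only [x, hvec, map_mul]; rfl
  have x2 : clIncl q (reverse (x : CliffordAlgebra (realForm q))) = Xr := by
    simp only [x, hvec, reverse.map_mul, hrev, map_mul]; rfl
  have y1 : clIncl q y = b.ce i0 * X * T := by
    simp only [y, MulMemClass.coe_mul, hvec, map_mul, hX, hT, ce, mul_assoc]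
  -- `T` is antisymmetric under reversal
  have hTr : b.ce i8 * b.ce i7 * b.ce i6 = -T := by
    rw [b.ce_anticomm i8 i7 (hne _ _ (by norm_num)), neg_mul, hT,
      b.ce_comm_mul i6 i7 i8 (hne _ _ (by norm_num)) (hne _ _ (by norm_num))]
  have y2 : clIncl q (reverse (y : CliffordAlgebra (realForm q))) = -T * Xr * b.ce i0 := by
    rw [← hTr]
    simp only [y, MulMemClass.coe_mul, hvec, reverse.map_mul, hrev, map_mul, hXr, ce, mul_assoc]
  have hXX : Xr * X = 1 := by
    calc Xr * X = b.ce i4 * (b.ce i2 * b.ce i2) * b.ce i4 := by rw [hXr, hX]; noncomm_ring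
      _ = 1 := by
        rw [hneg i2 (le_refl 2), mul_neg, mul_one, neg_mul, hneg i4 (by simp [i4]), neg_neg]
  have hTT : b.ce i8 * b.ce i7 * b.ce i6 * T = -1 := by
    calc b.ce i8 * b.ce i7 * b.ce i6 * T
        = b.ce i8 * (b.ce i7 * (b.ce i6 * b.ce i6) * b.ce i7) * b.ce i8 := by
          rw [hT]; noncomm_ring
      _ = -1 := by
        rw [hneg i6 (by simp [i6]), mul_neg, mul_one, neg_mul, hneg i7 (by simp [i7]), neg_neg,
          mul_one, hneg i8 (by simp [i8])]
  have hX0 : b.ce i0 * X = X * b.ce i0 :=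
    b.ce_comm_mul _ _ _ (hne _ _ (by norm_num)) (hne _ _ (by norm_num))
  have hX1 : b.ce i1 * X = X * b.ce i1 :=
    b.ce_comm_mul _ _ _ (hne _ _ (by norm_num)) (hne _ _ (by norm_num))
  have hT0 : b.ce i0 * T = -(T * b.ce i0) := anticomm_mul_left
    (b.ce_anticomm _ _ (hne _ _ (by norm_num)))
    (b.ce_comm_mul _ _ _ (hne _ _ (by norm_num)) (hne _ _ (by norm_num)))
  have hT1 : b.ce i1 * T = -(T * b.ce i1) := anticomm_mul_left
    (b.ce_anticomm _ _ (hne _ _ (by norm_num)))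
    (b.ce_comm_mul _ _ _ (hne _ _ (by norm_num)) (hne _ _ (by norm_num)))
  have hXU : U * X = X * U := by
    rw [hU', add_mul, mul_add, smul_mul_assoc, mul_smul_comm, hX0, hX1]
  have hTU : U * T = -(T * U) := by
    rw [hU', add_mul, mul_add, smul_mul_assoc, mul_smul_comm, hT0, hT1, smul_neg, neg_add]
  have hU0 : U * b.ce i0 + b.ce i0 * U = (2 : ℂ) • 1 := by
    rw [hU', add_mul, mul_add, smul_mul_assoc, mul_smul_comm, b.ce_mul_self,
      b.ce_anticomm i1 i0 (hne _ _ (by norm_num)), sgn, if_pos (by simp [i0])]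
    push_cast
    module
  have hxy : Xr * U * (b.ce i0 * X * T) - (-T * Xr * b.ce i0) * U * X = (2 : ℂ) • T := by
    calc Xr * U * (b.ce i0 * X * T) - (-T * Xr * b.ce i0) * U * X
        = Xr * (U * (b.ce i0 * X)) * T + T * Xr * (b.ce i0 * (U * X)) := by noncomm_ring
      _ = Xr * (U * X) * (b.ce i0 * T) + T * Xr * (b.ce i0 * X) * U := by
        rw [show b.ce i0 * (U * X) = b.ce i0 * X * U by rw [hXU, ← mul_assoc],
          show U * (b.ce i0 * X) = U * X * b.ce i0 by rw [hX0, ← mul_assoc]]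
        noncomm_ring
      _ = (Xr * X) * U * (b.ce i0 * T) + T * (Xr * X) * b.ce i0 * U := by
        rw [hX0, hXU]; noncomm_ring
      _ = -(U * T) * b.ce i0 + T * b.ce i0 * U := by rw [hXX, hT0]; noncomm_ring
      _ = T * (U * b.ce i0 + b.ce i0 * U) := by rw [hTU]; noncomm_ring
      _ = (2 : ℂ) • T := by rw [hU0, mul_smul_comm, mul_one]
  have hT_ne : T ≠ 0 := fun h => by
    rw [h, mul_zero, zero_eq_neg] at hTT
    exact hP0 (by rw [← mul_one P, hTT, mul_zero])
  -- right multiplication by `K = b₂ b₃` separates `P` from `P x` and `P y`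
  set K := b.ce i2 * b.ce i3 with hK
  have hPK : P * K = Complex.I • P := by
    have h := b.mul_cartan_of_mul_u 1 P (hP 1)
    rw [b.evenIncl_cartan_one (by omega), mul_smul_comm] at h
    have h2 := congrArg (fun w => (-2 * Complex.I) • w) h
    simp only [smul_smul] at h2
    rw [show -2 * Complex.I * (Complex.I / 2) = 1 by
        rw [mul_div_assoc', mul_assoc, Complex.I_mul_I]; norm_num, one_smul,
      show -2 * Complex.I * (-1 / 2) = Complex.I by ring] at h2
    exact h2
  have hXK : X * K = -(K * X) := by
    have h4 : b.ce i4 * K = K * b.ce i4 :=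
      b.ce_comm_mul _ _ _ (hne _ _ (by norm_num)) (hne _ _ (by norm_num))
    have h2 : b.ce i2 * K = -(K * b.ce i2) := by
      rw [hK, mul_assoc (b.ce i2) (b.ce i3), b.ce_anticomm i3 i2 (hne _ _ (by norm_num)), mul_neg,
        neg_neg]
    rw [hX, mul_assoc, h4, ← mul_assoc, h2, neg_mul, mul_assoc]
  have hYK : b.ce i0 * X * T * K = -(K * (b.ce i0 * X * T)) := by
    have h0 : b.ce i0 * K = K * b.ce i0 :=
      b.ce_comm_mul _ _ _ (hne _ _ (by norm_num)) (hne _ _ (by norm_num))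
    have h6 : b.ce i6 * K = K * b.ce i6 :=
      b.ce_comm_mul _ _ _ (hne _ _ (by norm_num)) (hne _ _ (by norm_num))
    have h7 : b.ce i7 * K = K * b.ce i7 :=
      b.ce_comm_mul _ _ _ (hne _ _ (by norm_num)) (hne _ _ (by norm_num))
    have h8 : b.ce i8 * K = K * b.ce i8 :=
      b.ce_comm_mul _ _ _ (hne _ _ (by norm_num)) (hne _ _ (by norm_num))
    have hTK : T * K = K * T :=
      (Commute.mul_left (show Commute (b.ce i6) K from h6) (Commute.mul_left h7 h8))
    calc b.ce i0 * X * T * K = b.ce i0 * X * (T * K) := by rw [mul_assoc]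
      _ = b.ce i0 * (X * K) * T := by rw [hTK]; noncomm_ring
      _ = -(b.ce i0 * K * X * T) := by rw [hXK]; noncomm_ring
      _ = -(K * (b.ce i0 * X * T)) := by rw [h0]; noncomm_ring
  obtain ⟨φ, hφ⟩ : ∃ φ : ComplexCl q →ₗ[ℂ] ℂ, φ T ≠ 0 := by
    by_contra! h
    exact hT_ne ((Module.forall_dual_apply_eq_zero_iff ℂ T).1 h)
  obtain ⟨ψ₀, hψ₀⟩ : ∃ ψ : ComplexCl q →ₗ[ℂ] ℂ, ψ P ≠ 0 := by
    by_contra! h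
    exact hP0 ((Module.forall_dual_apply_eq_zero_iff ℂ P).1 h)
  let ψ : ComplexCl q →ₗ[ℂ] ℂ := ψ₀ ∘ₗ (LinearMap.mulRight ℂ K + Complex.I • LinearMap.id)
  have hψ : ∀ w, ψ w = ψ₀ (w * K + Complex.I • w) := fun w => rfl
  have hkill : ∀ w, w * K = -(K * w) → ψ (P * w) = 0 := fun w hw => by
    rw [hψ, mul_assoc, hw, mul_neg, ← mul_assoc, hPK, smul_mul_assoc, neg_add_cancel, map_zero]
  refine ⟨φ, ψ, fun h => ?_⟩
  have h1 := congrArg (fun ω => tri ω x y 1) h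
  simp only [tri_vectorSpinorForm, tri_zero, vectorForm_apply, spinorForm_apply, x1, x2, y1, y2,
    hkill X hXK, hkill _ hYK, mul_zero, add_zero, ← map_sub, hxy] at h1
  rw [OneMemClass.coe_one, map_one, mul_one, hψ, hPK, ← add_smul, map_smul, map_smul] at h1
  simp [hφ, hψ₀] at h1

/-! ### Weights of the forms -/

/-- The form built from `b.u i` and `P` has the weight of `b.u i` plus `ω_n`. -/
theorem cAct_cartan_vectorSpinorForm (b : Frame q m) (φ ψ : ComplexCl q →ₗ[ℂ] ℂ) (P : ComplexCl q)
    (hP : ∀ j, P * b.u j = 0) (i j : Fin (m / 2 + 1)) :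
    cAct q 3 (b.cartan j) (vectorSpinorForm φ ψ (b.u i) P)
      = ((if j = i then 1 else 0) + 1 / 2 : ℂ) • vectorSpinorForm φ ψ (b.u i) P := by
  rw [cAct_vectorSpinorForm _ _ _ (b.cartan_mem_lieAlg j), b.mul_cartan_of_mul_u j P (hP j)]
  by_cases h : j = i
  · subst h
    rw [b.cartan_mul_u, b.mul_cartan_of_mul_u j _ (b.u_mul_self j), if_pos rfl, ← sub_smul,
      map_smul, map_smul, LinearMap.smul_apply]
    module
  · rw [b.cartan_comm_of_ne j i h, sub_self, map_zero, LinearMap.zero_apply, if_neg h, map_smul]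
    module

/-- The positive root vectors commute with `u₁` and kill `P`, so the form built from `u₁` and `P`
and its equivariant images are highest weight vectors of weight `ω₁ + ω_n`. -/
theorem isHighestWeightVector_of_complexMap (b : Frame q m) (φ ψ : ComplexCl q →ₗ[ℂ] ℂ)
    (P : ComplexCl q) (hP : ∀ j, P * b.u j = 0) (p : Coh q 3 ℝ →ₗ[ℝ] Coh q 3 ℝ)
    (hp : ∀ g x, p (spinActReal q 3 g x) = spinActReal q 3 g (p x))
    (hne : complexMap p (vectorSpinorForm φ ψ (b.u 0) P) ≠ 0) :
    b.IsHighestWeightVector (omegaOne m + omegaLast m)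
      (complexMap p (vectorSpinorForm φ ψ (b.u 0) P)) := by
  refine ⟨hne, fun j => ?_, fun i j hij => ?_, fun i j hij => ?_, fun hodd i => ?_⟩
  · rw [← b.complexMap_cAct p hp _ (b.cartan_mem_lieAlg j), b.cAct_cartan_vectorSpinorForm φ ψ P hP,
      map_smul]
    congr 1
    simp only [omegaOne, omegaLast, Pi.add_apply, Pi.smul_apply, basisWeight, Pi.single_apply]
    split_ifs <;> simp
  · have hX := b.rootSum_mem_lieAlg i j hij.ne
    rw [← b.complexMap_cAct p hp _ hX, cAct_vectorSpinorForm _ _ _ hX, b.evenIncl_rootSum,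
      ← comm_mul_of_anticomm (b.u_anticomm 0 i) (b.u_anticomm 0 j), sub_self, ← mul_assoc, hP,
      zero_mul]
    simp
  · have hX := b.rootDiff_mem_lieAlg i j hij.ne
    have h0j : (0 : Fin (m / 2 + 1)) ≠ j := fun h => by simp [← h] at hij
    rw [← b.complexMap_cAct p hp _ hX, cAct_vectorSpinorForm _ _ _ hX, b.evenIncl_rootDiff,
      ← comm_mul_of_anticomm (b.u_anticomm 0 i) (b.u_mul_ubar_anticomm 0 j h0j), sub_self,
      ← mul_assoc, hP, zero_mul]
    simp
  · have hX := b.rootShort_mem_lieAlg hodd i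
    have hc : b.u 0 * b.ce (Fin.last (m + 1)) = -(b.ce (Fin.last (m + 1)) * b.u 0) := by
      rw [b.ce_mul_u _ 0 (by simp) (by simp; rintro rfl; simp at hodd), neg_neg]
    rw [← b.complexMap_cAct p hp _ hX, cAct_vectorSpinorForm _ _ _ hX, b.evenIncl_rootShort,
      ← comm_mul_of_anticomm (b.u_anticomm 0 i) hc, sub_self, ← mul_assoc, hP, zero_mul]
    simp

/-- `E = -2 H₁`. -/
theorem gradingElt_eq_cartan (b : Frame q m) : gradingElt b.J = (-2 : ℂ) • b.cartan 0 := by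
  have h : (realForm q (b.fst 0) : ℂ) = 1 := by
    rw [b.realForm_fst]
    simp [planeSgn]
  rw [cartan, h, TensorProduct.smul_tmul', gradingElt]
  congr 1
  simp only [smul_eq_mul]
  ring

/-! ### The nilpotent subalgebra -/

theorem evenIncl_gradingElt (b : Frame q m) :
    evenIncl q (gradingElt b.J) = 1 - (1 / 2 : ℂ) • (b.u 0 * b.ubar 0) := by
  have h := b.u_mul_ubar_eq_cartan 0
  rw [planeSgn, if_pos (by simp), one_smul] at h
  rw [gradingElt_eq_cartan, map_smul, h]
  module

/-- Elements of `𝔤^{-1,1}` are left multiples of `u₁`. -/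
theorem eq_u_mul_of_mem_nilp (b : Frame q m) {X : ℂ ⊗[ℝ] EvenCl q} (hX : X ∈ nilp b.J) :
    evenIncl q X = (1 / 4 : ℂ) • (b.u 0 * b.ubar 0 * evenIncl q X) := by
  have h := congrArg (evenIncl q) hX.2
  rw [map_sub, map_mul, map_mul, map_smul] at h
  have hE := b.evenIncl_gradingElt
  set e := evenIncl q (gradingElt b.J) with he
  set x := evenIncl q X
  have hee : e * e = 1 := by
    have hu : b.u 0 * b.ubar 0 * (b.u 0 * b.ubar 0) = (4 : ℂ) • (b.u 0 * b.ubar 0) := by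
      have h1 := b.u_mul_ubar_add 0
      rw [planeSgn, if_pos (by simp), mul_one] at h1
      rw [mul_assoc, ← mul_assoc (b.ubar 0), eq_sub_of_add_eq' h1, sub_mul, mul_sub, smul_mul_assoc,
        one_mul, mul_smul_comm, ← mul_assoc, ← mul_assoc, b.u_mul_self, zero_mul, zero_mul,
        sub_zero]
    rw [hE]
    simp only [sub_mul, mul_sub, smul_mul_assoc, mul_smul_comm, hu, one_mul, mul_one]
    module
  have h1 : x - e * x * e = (-2 : ℂ) • (e * x) := by
    have := congrArg (e * ·) h
    simp only [mul_sub, ← mul_assoc, hee, one_mul, mul_smul_comm] at this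
    exact this
  have h2 : e * x * e - x = (-2 : ℂ) • (x * e) := by
    have := congrArg (· * e) h
    simp only [sub_mul, mul_assoc, hee, mul_one, smul_mul_assoc] at this
    rw [mul_assoc]
    exact this
  -- hence `e x = - x e`, and therefore `e x = - x`
  have h3 : e * x = -x := by
    linear_combination (norm := module) (1 / 2 : ℂ) • h + (1 / 4 : ℂ) • h1 + (1 / 4 : ℂ) • h2
  rw [hE, sub_mul, one_mul, smul_mul_assoc] at h3
  linear_combination (norm := module) (1 / 2 : ℂ) • h3

/-- The Lie algebra preserves the space of vectors under commutators. -/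
theorem commutator_mem_span (b : Frame q m) {X : ℂ ⊗[ℝ] EvenCl q} (hX : X ∈ lieAlg q)
    (U : ComplexCl q) (hU : U ∈ Submodule.span ℂ (Set.range b.ce)) :
    evenIncl q X * U - U * evenIncl q X ∈ Submodule.span ℂ (Set.range b.ce) := by
  rw [b.lieAlg_eq_span] at hX
  induction hX using Submodule.span_induction with
  | mem X hX =>
    obtain ⟨i, j, hij, rfl⟩ := hX
    rw [b.evenIncl_vecMul, one_smul]
    induction hU using Submodule.span_induction with
    | mem U hU =>
      obtain ⟨k, rfl⟩ := hU
      by_cases hi : k = i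
      · have : b.ce i * b.ce j * b.ce i = -(b.ce i * b.ce i * b.ce j) := by
          rw [mul_assoc, b.ce_anticomm j i hij.symm, mul_neg, ← mul_assoc]
        rw [hi, this, ← mul_assoc, b.ce_mul_self, smul_mul_assoc, one_mul, ← neg_add', ← two_smul ℂ,
          smul_smul]
        exact neg_mem (Submodule.smul_mem _ _ (Submodule.subset_span ⟨j, rfl⟩))
      by_cases hj : k = j
      · have : b.ce j * (b.ce i * b.ce j) = -(b.ce i * (b.ce j * b.ce j)) := by
          rw [← mul_assoc, b.ce_anticomm j i hij.symm, neg_mul, mul_assoc]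
        rw [hj, this, mul_assoc, b.ce_mul_self, mul_smul_comm, mul_one, sub_neg_eq_add,
          ← two_smul ℂ, smul_smul]
        exact Submodule.smul_mem _ _ (Submodule.subset_span ⟨i, rfl⟩)
      rw [b.ce_comm_mul k i j hi hj, sub_self]
      exact zero_mem _
    | zero => simp
    | add U U' _ _ h h' =>
      rw [mul_add, add_mul, add_sub_add_comm]
      exact add_mem h h'
    | smul c U _ h =>
      rw [mul_smul_comm, smul_mul_assoc, ← smul_sub]
      exact Submodule.smul_mem _ _ h
  | zero => simp
  | add X Y _ _ h h' =>
    rw [map_add, mul_add, add_mul, add_sub_add_comm]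
    exact add_mem h h'
  | smul c X _ h =>
    rw [map_smul, mul_smul_comm, smul_mul_assoc, ← smul_sub]
    exact Submodule.smul_mem _ _ h

/-- A vector of weight `e₁` is a multiple of `u₁`. -/
theorem exists_eq_smul_u (b : Frame q m) (U : ComplexCl q)
    (hU : U ∈ Submodule.span ℂ (Set.range b.ce))
    (h : evenIncl q (b.cartan 0) * U - U * evenIncl q (b.cartan 0) = U) :
    ∃ c : ℂ, U = c • b.u 0 := by
  let i0 : Fin (m + 2) := ⟨0, by omega⟩
  let i1 : Fin (m + 2) := ⟨1, by omega⟩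
  have h01 : i1 ≠ i0 := by simp [i0, i1]
  have hs0 : b.ce i0 * b.ce i0 = 1 := by
    rw [b.ce_mul_self, sgn, if_pos (by simp [i0])]
    simp
  have hs1 : b.ce i1 * b.ce i1 = 1 := by
    rw [b.ce_mul_self, sgn, if_pos (by simp [i1])]
    simp
  have hu : b.u 0 = b.ce i0 + Complex.I • b.ce i1 := rfl
  have hH : evenIncl q (b.cartan 0) = (-(Complex.I / 2)) • (b.ce i0 * b.ce i1) := by
    rw [evenIncl_cartan, planeSgn, if_pos (by simp), mul_one]
    rfl
  set H := evenIncl q (b.cartan 0)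
  have hH0 : H * b.ce i0 - b.ce i0 * H = Complex.I • b.ce i1 := by
    rw [hH, smul_mul_assoc, mul_smul_comm, mul_assoc, b.ce_anticomm i1 i0 h01, mul_neg, ← mul_assoc,
      hs0, one_mul]
    module
  have hH1 : H * b.ce i1 - b.ce i1 * H = (-Complex.I) • b.ce i0 := by
    rw [hH, smul_mul_assoc, mul_smul_comm, ← mul_assoc, b.ce_anticomm i1 i0 h01, neg_mul, mul_assoc,
      hs1, mul_one]
    module
  have hex : ∃ a c : ℂ, H * U - U * H = a • b.ce i0 + c • b.ce i1 := by
    clear h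
    induction hU using Submodule.span_induction with
    | mem U hU =>
      obtain ⟨k, rfl⟩ := hU
      by_cases h0 : k = i0
      · exact ⟨0, Complex.I, by rw [h0, hH0, zero_smul, zero_add]⟩
      by_cases h1 : k = i1
      · exact ⟨-Complex.I, 0, by rw [h1, hH1, zero_smul, add_zero]⟩
      refine ⟨0, 0, ?_⟩
      rw [hH, smul_mul_assoc, mul_smul_comm, b.ce_comm_mul k i0 i1 h0 h1]
      simp
    | zero => exact ⟨0, 0, by simp⟩
    | add U U' _ _ h h' =>
      obtain ⟨a, c, hac⟩ := h
      obtain ⟨a', c', hac'⟩ := h'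
      refine ⟨a + a', c + c', ?_⟩
      rw [mul_add, add_mul, add_sub_add_comm, hac, hac']
      module
    | smul z U _ h =>
      obtain ⟨a, c, hac⟩ := h
      refine ⟨z * a, z * c, ?_⟩
      rw [mul_smul_comm, smul_mul_assoc, ← smul_sub, hac]
      module
  obtain ⟨a, c, hac⟩ := hex
  rw [h] at hac
  refine ⟨(a - c * Complex.I) / 2, ?_⟩
  have h2 : U = a • (Complex.I • b.ce i1) + c • ((-Complex.I) • b.ce i0) := by
    rw [← hH0, ← hH1]
    conv_lhs => rw [← h, hac]
    simp only [mul_add, add_mul, mul_smul_comm, smul_mul_assoc]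
    module
  have h3 : U = (1 / 2 : ℂ) • (U + U) := by module
  rw [h3]
  nth_rewrite 1 [hac]
  rw [h2, hu]
  have hI : c • b.ce i1 = -((c * (Complex.I * Complex.I)) • b.ce i1) := by
    rw [Complex.I_mul_I]
    module
  rw [hI]
  module

/-- An element of `𝔤^{-1,1}` maps `u₂` to a multiple of `u₁`. -/
theorem exists_commutator_eq_smul_u (b : Frame q m) (hm : 2 ≤ m) {X : ℂ ⊗[ℝ] EvenCl q}
    (hX : X ∈ nilp b.J) :
    ∃ c : ℂ, evenIncl q X * b.u 1 - b.u 1 * evenIncl q X = c • b.u 0 := by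
  refine b.exists_eq_smul_u _ (b.commutator_mem_span hX.1 _ ?_) ?_
  · exact add_mem (Submodule.subset_span ⟨_, rfl⟩)
      (Submodule.smul_mem _ _ (Submodule.subset_span ⟨_, rfl⟩))
  · have h := congrArg (evenIncl q) hX.2
    rw [gradingElt_eq_cartan, map_sub, map_mul, map_mul, map_smul, map_smul, smul_mul_assoc,
      mul_smul_comm, ← smul_sub] at h
    have hcomm := b.cartan_comm_of_ne 0 1 (zero_ne_one hm)
    set H := evenIncl q (b.cartan 0)
    set x := evenIncl q X
    have h' : H * x - x * H = x := smul_right_injective _ (by norm_num : (-2 : ℂ) ≠ 0) h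
    calc H * (x * b.u 1 - b.u 1 * x) - (x * b.u 1 - b.u 1 * x) * H
        = (H * x - x * H) * b.u 1 - b.u 1 * (H * x - x * H)
          + (x * (H * b.u 1 - b.u 1 * H) - (H * b.u 1 - b.u 1 * H) * x) := by noncomm_ring
      _ = x * b.u 1 - b.u 1 * x := by rw [h', hcomm]; simp

end Frame

/-! ### The Lie algebra representation -/

theorem infAct_infAct_sub {M : Type*} [AddCommGroup M] [Module ℝ M] (L L' : M →ₗ[ℝ] M)
    (ω : M [⋀^Fin 3]→ₗ[ℝ] ℂ) :
    infAct L (infAct L' ω) - infAct L' (infAct L ω) = infAct (L ∘ₗ L' - L' ∘ₗ L) ω := by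
  refine ext_tri fun x y z => ?_
  simp only [tri_sub, tri_infAct, LinearMap.sub_apply, LinearMap.comp_apply, map_sub]
  ring

theorem cAct_cAct_sub (X Y : ℂ ⊗[ℝ] EvenCl q) (ω : Coh q 3 ℂ) :
    cAct q 3 X (cAct q 3 Y ω) - cAct q 3 Y (cAct q 3 X ω) = cAct q 3 (X * Y - Y * X) ω := by
  induction X with
  | zero => simp
  | add X X' h h' =>
    simp only [map_add, LinearMap.add_apply, add_mul, mul_add]
    rw [add_sub_add_comm, h, h', ← LinearMap.add_apply, ← map_add, add_sub_add_comm]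
  | tmul z a =>
    induction Y with
    | zero => simp
    | add Y Y' h h' =>
      simp only [map_add, LinearMap.add_apply, add_mul, mul_add]
      rw [add_sub_add_comm, h, h', ← LinearMap.add_apply, ← map_add, add_sub_add_comm]
    | tmul w c =>
      have hsm : ∀ (L : EvenCl q →ₗ[ℝ] EvenCl q) (z : ℂ) (η : Coh q 3 ℂ),
          infAct L (z • η) = z • infAct L η := fun L z η => map_smul (infActLin (EvenCl q) 3 L) z η
      have hcomm : LinearMap.mulLeft ℝ (a * c - c * a) = LinearMap.mulLeft ℝ a ∘ₗ
          LinearMap.mulLeft ℝ c - LinearMap.mulLeft ℝ c ∘ₗ LinearMap.mulLeft ℝ a := by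
        ext x
        simp [sub_mul, mul_assoc]
      rw [Algebra.TensorProduct.tmul_mul_tmul, Algebra.TensorProduct.tmul_mul_tmul, mul_comm w z,
        ← TensorProduct.tmul_sub, cAct_tmul, cAct_tmul, cAct_tmul, cAct_tmul, cAct_tmul, hsm, hsm,
        smul_smul, smul_smul, mul_comm w z, ← smul_sub, infAct_infAct_sub, hcomm]

theorem evenIncl_injective (q : QuadraticForm ℚ V) : Function.Injective (evenIncl q) :=
  Module.Flat.lTensor_preserves_injective_linearMap (M := ℂ)
    (even (realForm q)).val.toLinearMap Subtype.val_injective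

/-! ### Rotated frames -/

/-- Over `ℝ` the Clifford algebra is linearly isomorphic to the exterior algebra, compatibly with
the embedded vectors. -/
theorem ι_injective_of_real {M : Type*} [AddCommGroup M] [Module ℝ M] (Q : QuadraticForm ℝ M) :
    Function.Injective (ι Q) := fun v w h => by
  have h' := congrArg (equivExterior Q) h
  have hι : ∀ v, equivExterior Q (ι Q v) = ExteriorAlgebra.ι ℝ v := fun v =>
    changeForm_ι changeForm.associated_neg_proof v
  rw [hι, hι] at h'
  exact (ExteriorAlgebra.ι_leftInverse (R := ℝ) (M := M)).injective h'

/-- Conjugation by an element of the spin group is a linear automorphism of the vectors. -/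
theorem exists_linearEquiv_conj (g : spinGroup (realForm q)) :
    ∃ ρ : (ℝ ⊗[ℚ] V) ≃ₗ[ℝ] (ℝ ⊗[ℚ] V), ∀ v, ι (realForm q) (ρ v)
      = (g : CliffordAlgebra (realForm q)) * ι _ v * star (g : CliffordAlgebra (realForm q)) := by
  have hinj : Function.Injective (ι (realForm q)) := ι_injective_of_real _
  have hex : ∀ g : spinGroup (realForm q), ∃ ρ : (ℝ ⊗[ℚ] V) →ₗ[ℝ] (ℝ ⊗[ℚ] V), ∀ v,
      ι (realForm q) (ρ v)
        = (g : CliffordAlgebra (realForm q)) * ι _ v * star (g : CliffordAlgebra (realForm q)) := by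
    intro g
    have hmem : ∀ v, (g : CliffordAlgebra (realForm q)) * ι _ v
        * star (g : CliffordAlgebra (realForm q)) ∈ LinearMap.range (ι (realForm q)) := fun v =>
      spinGroup.conjAct_smul_ι_mem_range_ι (x := spinGroup.toUnits g) g.2 v
    choose f hf using hmem
    refine ⟨{ toFun := f, map_add' := fun v w => hinj ?_, map_smul' := fun c v => hinj ?_ }, hf⟩
    · rw [map_add, hf, hf, hf, map_add, mul_add, add_mul]
    · rw [map_smul, hf, hf, map_smul, mul_smul_comm, smul_mul_assoc, RingHom.id_apply]
  have hcancel : ∀ (g h : spinGroup (realForm q)) (ρ ρ' : (ℝ ⊗[ℚ] V) →ₗ[ℝ] (ℝ ⊗[ℚ] V)),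
      (∀ v, ι (realForm q) (ρ v)
        = (g : CliffordAlgebra (realForm q)) * ι _ v * star (g : CliffordAlgebra (realForm q))) →
      (∀ v, ι (realForm q) (ρ' v)
        = (h : CliffordAlgebra (realForm q)) * ι _ v * star (h : CliffordAlgebra (realForm q))) →
      g * h = 1 → ρ ∘ₗ ρ' = LinearMap.id := by
    intro g h ρ ρ' hρ hρ' hgh
    refine LinearMap.ext fun v => hinj ?_
    have h1 : (g : CliffordAlgebra (realForm q)) * h = 1 := congrArg Subtype.val hgh
    rw [LinearMap.comp_apply, hρ, hρ', LinearMap.id_apply]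
    generalize (g : CliffordAlgebra (realForm q)) = x at h1 ⊢
    generalize (h : CliffordAlgebra (realForm q)) = y at h1 ⊢
    calc x * (y * ι _ v * star y) * star x
        = x * y * ι (realForm q) v * star (x * y) := by rw [star_mul]; noncomm_ring
      _ = _ := by rw [h1, star_one, one_mul, mul_one]
  obtain ⟨ρ, hρ⟩ := hex g
  obtain ⟨ρ', hρ'⟩ := hex g⁻¹
  exact ⟨LinearEquiv.ofLinearMap ρ ρ' (hcancel _ _ _ _ hρ hρ' (mul_inv_cancel g))
    (hcancel _ _ _ _ hρ' hρ (inv_mul_cancel g)), hρ⟩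

/-- The spin group acts on frames. -/
theorem Frame.exists_rotate (b : Frame q m) (g : spinGroup (realForm q)) :
    ∃ b' : Frame q m, ∀ k, b'.e k
      = (g : CliffordAlgebra (realForm q)) * b.e k * star (g : CliffordAlgebra (realForm q)) := by
  obtain ⟨ρ, hρ⟩ := exists_linearEquiv_conj g
  have hQ : ∀ v, realForm q (ρ v) = realForm q v := by
    intro v
    have hinj : Function.Injective (algebraMap ℝ (CliffordAlgebra (realForm q))) :=
      (algebraMap ℝ _).injective
    refine hinj ?_
    have h1 := spinGroup.star_mul_self_of_mem g.2
    have h2 := spinGroup.mul_star_self_of_mem g.2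
    rw [← ι_sq_scalar, hρ]
    generalize (g : CliffordAlgebra (realForm q)) = x at h1 h2 ⊢
    calc x * ι _ v * star x * (x * ι _ v * star x)
        = x * ι (realForm q) v * (star x * x) * ι (realForm q) v * star x := by noncomm_ring
      _ = x * (ι (realForm q) v * ι (realForm q) v) * star x := by rw [h1]; noncomm_ring
      _ = _ := by rw [ι_sq_scalar, ← Algebra.commutes, mul_assoc, h2, mul_one]
  refine ⟨⟨b.basis.map ρ, fun i => ?_, fun i j hij => ?_⟩, fun k => hρ _⟩
  · rw [Module.Basis.map_apply, hQ, b.form_apply]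
  · rw [← b.orthogonal i j hij]
    simp only [QuadraticMap.polar, Module.Basis.map_apply, ← map_add, hQ]

/-- Rotating a frame by `g` conjugates the point `J` and the isotropic vectors by `g`. -/
theorem Frame.exists_rotate_J (b : Frame q m) (g : spinGroup (realForm q)) :
    ∃ b' : Frame q m, b'.J = spinToEven g * b.J * spinToEven g⁻¹ ∧
      ∀ j, b'.u j = clIncl q g * b.u j * clIncl q (star (g : CliffordAlgebra (realForm q))) := by
  obtain ⟨b', hb'⟩ := b.exists_rotate g
  refine ⟨b', Subtype.ext ?_, fun j => ?_⟩
  · have h1 := spinGroup.star_mul_self_of_mem g.2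
    change b'.e _ * b'.e _ = (g : CliffordAlgebra (realForm q)) * (b.e _ * b.e _) * star g.1
    rw [hb', hb']
    generalize (g : CliffordAlgebra (realForm q)) = x at h1 ⊢
    calc x * b.e ⟨0, by omega⟩ * star x * (x * b.e ⟨1, by omega⟩ * star x)
        = x * b.e ⟨0, by omega⟩ * (star x * x) * b.e ⟨1, by omega⟩ * star x := by noncomm_ring
      _ = _ := by rw [h1]; noncomm_ring
  · simp only [Frame.u, Frame.ce, hb', map_mul, mul_add, add_mul, mul_smul_comm, smul_mul_assoc]

/-! ### The action of the nilpotent subalgebra on the classes of `u₁` and `u₂` -/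

namespace Frame

theorem gradingElt_smul_of_weight (b : Frame q m) (ω : Coh q 3 ℂ) (c : ℂ)
    (h : cAct q 3 (b.cartan 0) ω = c • ω) :
    cAct q 3 (gradingElt b.J) ω = (-2 * c) • ω := by
  rw [b.gradingElt_eq_cartan, map_smul, LinearMap.smul_apply, h, smul_smul]

theorem complexMap_cartan (b : Frame q m) (φ ψ : ComplexCl q →ₗ[ℂ] ℂ) (P : ComplexCl q)
    (hP : ∀ j, P * b.u j = 0) (p : Coh q 3 ℝ →ₗ[ℝ] Coh q 3 ℝ)
    (hp : ∀ g x, p (spinActReal q 3 g x) = spinActReal q 3 g (p x))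
    (i j : Fin (m / 2 + 1)) :
    cAct q 3 (b.cartan j) (complexMap p (vectorSpinorForm φ ψ (b.u i) P))
      = ((if j = i then 1 else 0) + 1 / 2 : ℂ) •
        complexMap p (vectorSpinorForm φ ψ (b.u i) P) := by
  rw [← b.complexMap_cAct p hp _ (b.cartan_mem_lieAlg j),
    b.cAct_cartan_vectorSpinorForm φ ψ P hP, map_smul]

/-- The class of `u₁` has `E`-eigenvalue `-2 (1 + 1/2) = -3`. -/
theorem complexMap_mem_hodgePiece_zero (b : Frame q m) (φ ψ : ComplexCl q →ₗ[ℂ] ℂ) (P : ComplexCl q)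
    (hP : ∀ j, P * b.u j = 0) (p : Coh q 3 ℝ →ₗ[ℝ] Coh q 3 ℝ)
    (hp : ∀ g x, p (spinActReal q 3 g x) = spinActReal q 3 g (p x)) :
    complexMap p (vectorSpinorForm φ ψ (b.u 0) P) ∈ hodgePiece b.J (0 : ℤ) := by
  refine mem_hodgePiece_of_cAct b.J_mul_self _ 0 (by norm_num) ?_
  rw [b.gradingElt_smul_of_weight _ _ (b.complexMap_cartan φ ψ P hP p hp 0 0), if_pos rfl]
  norm_num

/-- The class of `u₂` has `E`-eigenvalue `-2 (1/2) = -1`. -/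
theorem complexMap_mem_hodgePiece_one (b : Frame q m) (φ ψ : ComplexCl q →ₗ[ℂ] ℂ) (P : ComplexCl q)
    (hP : ∀ j, P * b.u j = 0) (p : Coh q 3 ℝ →ₗ[ℝ] Coh q 3 ℝ)
    (hp : ∀ g x, p (spinActReal q 3 g x) = spinActReal q 3 g (p x))
    (hm : 2 ≤ m) :
    complexMap p (vectorSpinorForm φ ψ (b.u 1) P) ∈ hodgePiece b.J (1 : ℤ) := by
  refine mem_hodgePiece_of_cAct b.J_mul_self _ 1 (by norm_num) ?_
  rw [b.gradingElt_smul_of_weight _ _ (b.complexMap_cartan φ ψ P hP p hp 1 0),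
    if_neg (zero_ne_one hm)]
  norm_num

/-- An element of `𝔤^{-1,1}` maps the class of `u₂` to a multiple of the class of `u₁`. -/
theorem cAct_complexMap_of_mem_nilp (b : Frame q m) (φ ψ : ComplexCl q →ₗ[ℂ] ℂ) (P : ComplexCl q)
    (hP : ∀ j, P * b.u j = 0) (p : Coh q 3 ℝ →ₗ[ℝ] Coh q 3 ℝ)
    (hp : ∀ g x, p (spinActReal q 3 g x) = spinActReal q 3 g (p x))
    {X : ℂ ⊗[ℝ] EvenCl q} (hX : X ∈ nilp b.J) (c : ℂ)
    (hc : evenIncl q X * b.u 1 - b.u 1 * evenIncl q X = c • b.u 0) :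
    cAct q 3 X (complexMap p (vectorSpinorForm φ ψ (b.u 1) P))
      = c • complexMap p (vectorSpinorForm φ ψ (b.u 0) P) := by
  have hPX : P * evenIncl q X = 0 := by
    rw [b.eq_u_mul_of_mem_nilp hX, mul_smul_comm, ← mul_assoc, ← mul_assoc, hP, zero_mul, zero_mul,
      smul_zero]
  rw [← b.complexMap_cAct p hp _ hX.1, cAct_vectorSpinorForm _ _ _ hX.1, hc, hPX, map_zero,
    sub_zero, map_smul, LinearMap.smul_apply, map_smul]

theorem ubar_mul_self (b : Frame q m) (j : Fin (m / 2 + 1)) : b.ubar j * b.ubar j = 0 := by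
  have h := b.ce_snd_mul_fst j
  rw [ubar, sub_mul, mul_sub, mul_sub]
  simp only [mul_smul_comm, smul_mul_assoc, h, ce_fst_mul_self, ce_snd_mul_self, smul_smul,
    ← mul_assoc, Complex.I_mul_I]
  module

theorem cartan_comm_ubar_of_ne (b : Frame q m) (i j : Fin (m / 2 + 1)) (h : i ≠ j) :
    evenIncl q (b.cartan i) * b.ubar j = b.ubar j * evenIncl q (b.cartan i) := by
  have hv : i.val ≠ j.val := fun e => h (Fin.ext e)
  rw [evenIncl_cartan, smul_mul_assoc, mul_smul_comm, mul_assoc,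
    b.ce_mul_ubar _ j (by simp; omega) (by simp; omega), mul_neg, ← mul_assoc,
    b.ce_mul_ubar _ j (by simp; omega) (by simp; omega)]
  simp only [neg_mul, neg_neg, mul_assoc]

theorem cartan_mul_ubar (b : Frame q m) (j : Fin (m / 2 + 1)) :
    evenIncl q (b.cartan j) * b.ubar j = (-1 / 2 : ℂ) • b.ubar j := by
  have h := congrArg (· * b.ubar j) (b.u_mul_ubar_eq_cartan j)
  simp only [smul_mul_assoc, mul_assoc, b.ubar_mul_self, mul_zero, smul_zero, add_mul,
    one_mul] at h
  linear_combination (norm := module) (-1 / 4 : ℂ) • h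

theorem ubar_mul_cartan (b : Frame q m) (j : Fin (m / 2 + 1)) :
    b.ubar j * evenIncl q (b.cartan j) = (1 / 2 : ℂ) • b.ubar j := by
  have h := congrArg (b.ubar j * ·) (b.u_mul_ubar_eq_cartan j)
  have h2 : b.ubar j * (b.u j * b.ubar j) = (4 * planeSgn j) • b.ubar j := by
    have := congrArg (b.ubar j * ·) (b.u_mul_ubar_add j)
    simp only [mul_add, ← mul_assoc, b.ubar_mul_self, zero_mul, add_zero, mul_smul_comm,
      mul_one] at this
    rw [← mul_assoc]
    exact this
  simp only [mul_smul_comm, h2, mul_add, mul_one, smul_smul] at h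
  rw [show planeSgn j * (4 * planeSgn j) = 4 by linear_combination 4 * planeSgn_mul_self j] at h
  linear_combination (norm := module) (-1 / 4 : ℂ) • h

/-- The root vector of weight `σ₁ = e₁ - e₂` lies in `𝔤^{-1,1}`. -/
theorem rootDiff_mem_nilp (b : Frame q m) (hm : 2 ≤ m) : b.rootDiff 0 1 ∈ nilp b.J := by
  have h01 := zero_ne_one hm
  refine ⟨b.rootDiff_mem_lieAlg 0 1 h01, evenIncl_injective q ?_⟩
  rw [gradingElt_eq_cartan, map_sub, map_mul, map_mul, map_smul, map_smul, evenIncl_rootDiff]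
  rw [smul_mul_assoc, ← mul_assoc, b.cartan_mul_u, mul_smul_comm, mul_assoc (b.u 0),
    ← b.cartan_comm_ubar_of_ne 0 1 h01, ← mul_assoc, b.mul_cartan_of_mul_u 0 _ (b.u_mul_self 0)]
  simp only [smul_mul_assoc]
  module

/-- The Cartan element `H₂` is half of `i b₂ b₃`. -/
theorem gradingElt_eq_cartan_one (b : Frame q m) (hm : 2 ≤ m) :
    gradingElt (vecMul q (b.basis ⟨2, by omega⟩) (b.basis ⟨3, by omega⟩))
      = (2 : ℂ) • b.cartan 1 := by
  refine evenIncl_injective q ?_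
  rw [map_smul, b.evenIncl_cartan_one hm, gradingElt, evenIncl_vecMul]
  module

theorem cartan_one_commutator (b : Frame q m) (hm : 2 ≤ m) :
    b.cartan 1 * b.rootDiff 0 1 - b.rootDiff 0 1 * b.cartan 1 = -b.rootDiff 0 1 := by
  have h01 := zero_ne_one hm
  refine evenIncl_injective q ?_
  rw [map_sub, map_mul, map_mul, map_neg, evenIncl_rootDiff, ← mul_assoc,
    b.cartan_comm_of_ne 1 0 h01.symm, mul_assoc, mul_assoc, ← mul_sub, b.cartan_mul_ubar,
    b.ubar_mul_cartan, ← mul_neg]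
  congr 1
  module

/-- The second Cartan element has eigenvalues `± 1/2`, `± 3/2` on the third cohomology, so a class
of weight `3/2` is not in the image of the root vector of weight `e₁ - e₂`, which lowers the
eigenvalue by `1`. -/
theorem eq_zero_of_eq_cAct_rootDiff (b : Frame q m) (hm : 2 ≤ m) (v w : Coh q 3 ℂ)
    (hv : cAct q 3 (b.cartan 1) v = (3 / 2 : ℂ) • v) (hw : v = cAct q 3 (b.rootDiff 0 1) w) :
    v = 0 := by
  set K := vecMul q (b.basis ⟨2, by omega⟩) (b.basis ⟨3, by omega⟩) with hKdef
  have hK : K * K = -1 := Subtype.ext (by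
    have h2 := b.e_mul_self ⟨2, by omega⟩
    have h3 := b.e_mul_self ⟨3, by omega⟩
    have h := b.e_anticomm ⟨3, by omega⟩ ⟨2, by omega⟩ (by simp)
    simp only [sgn, Nat.not_lt.2 (le_refl 2), Nat.not_lt.2 (show 2 ≤ 3 by norm_num), if_false,
      map_neg, map_one] at h2 h3
    change b.e _ * b.e _ * (b.e _ * b.e _) = -1
    calc b.e ⟨2, by omega⟩ * b.e ⟨3, by omega⟩ * (b.e ⟨2, by omega⟩ * b.e ⟨3, by omega⟩)
        = b.e ⟨2, by omega⟩ * (b.e ⟨3, by omega⟩ * b.e ⟨2, by omega⟩) * b.e ⟨3, by omega⟩ := by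
          noncomm_ring
      _ = -((b.e ⟨2, by omega⟩ * b.e ⟨2, by omega⟩) * (b.e ⟨3, by omega⟩ * b.e ⟨3, by omega⟩)) := by
          rw [h]; noncomm_ring
      _ = -1 := by rw [h2, h3]; simp)
  have hE := b.gradingElt_eq_cartan_one hm
  rw [← hKdef] at hE
  have hq := cAct_quartic hK w
  set E := cAct q 3 (gradingElt K) with hEdef
  set X := cAct q 3 (b.rootDiff 0 1) with hXdef
  have hcomm : ∀ η, E (X η) = X (E η) - (2 : ℂ) • X η := by
    intro η
    have h := cAct_cAct_sub (b.cartan 1) (b.rootDiff 0 1) η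
    rw [b.cartan_one_commutator hm, map_neg, LinearMap.neg_apply] at h
    simp only [hEdef, hE, map_smul, LinearMap.smul_apply, ← hXdef] at h ⊢
    rw [sub_eq_iff_eq_add.1 h]
    module
  have hEv : E v = (3 : ℂ) • v := by
    rw [hEdef, hE, map_smul, LinearMap.smul_apply, hv]
    module
  -- multiply `E⁴ w = 10 E² w - 9 w` by `X`, using `X E = (E + 2) X` and `E v = 3 v`
  have a1 : X (E w) = (5 : ℂ) • v := by
    have h := hcomm w
    rw [← hw, hEv] at h
    linear_combination (norm := module) -h
  have a2 : X (E (E w)) = (25 : ℂ) • v := by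
    have h := hcomm (E w)
    rw [a1, map_smul, hEv] at h
    linear_combination (norm := module) -h
  have a3 : X (E (E (E w))) = (125 : ℂ) • v := by
    have h := hcomm (E (E w))
    rw [a2, map_smul, hEv] at h
    linear_combination (norm := module) -h
  have a4 : X (E (E (E (E w)))) = (625 : ℂ) • v := by
    have h := hcomm (E (E (E w)))
    rw [a3, map_smul, hEv] at h
    linear_combination (norm := module) -h
  rw [hq, map_sub, map_smul, map_smul, a2, ← hw] at a4
  have h0 : (384 : ℂ) • v = 0 := by linear_combination (norm := module) -a4
  exact (smul_eq_zero_iff_right (by norm_num)).1 h0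

end Frame

/-! ### Rational elements of the spin group -/

theorem ofBaseChangeAux_star (x : CliffordAlgebra q) :
    ofBaseChangeAux ℝ q (star x) = star (ofBaseChangeAux ℝ q x) := by
  induction x using CliffordAlgebra.induction with
  | algebraMap r =>
    rw [star_algebraMap, AlgHom.commutes, IsScalarTower.algebraMap_apply ℚ ℝ, star_algebraMap]
  | ι v => rw [star_ι, map_neg, ofBaseChangeAux_ι, star_ι]
  | mul x y hx hy => rw [star_mul, map_mul, map_mul, star_mul, hx, hy]
  | add x y hx hy => rw [star_add, map_add, map_add, star_add, hx, hy]

theorem ofBaseChangeAux_mem_spinGroup (γ : spinGroup q) :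
    ofBaseChangeAux ℝ q (γ : CliffordAlgebra q) ∈ spinGroup (realForm q) := by
  obtain ⟨x, ⟨⟨y, hy, hyx⟩, hx1, hx2⟩, hx⟩ := γ
  refine ⟨⟨⟨Units.map (ofBaseChangeAux ℝ q : CliffordAlgebra q →* _) y, ?_, ?_⟩, ?_⟩,
    ofBaseChangeAux_mem_even q x hx⟩
  · have hle : lipschitzGroup q ≤ (lipschitzGroup (realForm q)).comap
        (Units.map (ofBaseChangeAux ℝ q : CliffordAlgebra q →* _)) := by
      refine (Subgroup.closure_le _).2 ?_
      rintro y ⟨v, hv⟩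
      refine Subgroup.subset_closure ⟨1 ⊗ₜ v, ?_⟩
      change _ = ofBaseChangeAux ℝ q (y : CliffordAlgebra q)
      rw [← hv, ofBaseChangeAux_ι]
    exact hle hy
  · exact congrArg (ofBaseChangeAux ℝ q) hyx
  · refine Unitary.mem_iff.2 ⟨?_, ?_⟩
    · rw [← ofBaseChangeAux_star, ← map_mul, hx1, map_one]
    · rw [← ofBaseChangeAux_star, ← map_mul, hx2, map_one]

/-- Rational elements of the spin group act through real ones. -/
theorem exists_spinToEven_eq (γ : spinGroup q) :
    ∃ g : spinGroup (realForm q), spinToEven g⁻¹ = evenToReal (spinToEvenRat γ⁻¹) := by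
  refine ⟨⟨_, ofBaseChangeAux_mem_spinGroup γ⁻¹⟩⁻¹, ?_⟩
  rw [inv_inv]
  rfl

/-! ### The weight `ω₁ + ω_n` -/

theorem rho_zero_sub_rho_one (hm : 2 ≤ m) : rho m 0 - rho m 1 = 1 := by
  have h01 := Frame.zero_ne_one hm
  have key : ∀ k : Fin (m / 2 + 1), rho m k = (∑ j, if k < j then 1 else 0)
      + if Odd m then 1 / 2 else 0 := by
    intro k
    have h1 : ∀ i j : Fin (m / 2 + 1), (if i < j then
      ((basisWeight i - basisWeight j) + (basisWeight i + basisWeight j) : Weight m) else 0) k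
        = if i = k then (if i < j then 2 else 0) else 0 := by
      intro i j
      by_cases hij : i < j <;> by_cases hik : i = k
      · subst hik
        simp [hij, basisWeight]
        norm_num
      · simp [hij, hik, basisWeight, Pi.single_apply, Ne.symm hik]
      · simp [hij]
      · simp [hij]
    have h2 : (if Odd m then ∑ i, basisWeight i else 0 : Weight m) k = if Odd m then 1 else 0 := by
      split_ifs
      · simp [basisWeight, Finset.sum_apply, Pi.single_apply]
      · rfl
    rw [rho, Pi.smul_apply, Pi.add_apply, h2, Finset.sum_apply]
    simp only [Finset.sum_apply, h1]
    rw [Finset.sum_comm]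
    simp only [Finset.sum_ite_eq', Finset.mem_univ, if_true, smul_eq_mul, mul_add, Finset.mul_sum]
    congr 1
    · refine Finset.sum_congr rfl fun j _ => ?_
      split_ifs <;> norm_num
    · split_ifs <;> norm_num
  rw [key, key, add_sub_add_right_eq_sub, ← Finset.sum_sub_distrib, Finset.sum_eq_single 1]
  · rw [if_pos (Fin.pos_of_ne_zero h01.symm), if_neg (lt_irrefl _), sub_zero]
  · intro j _ hj
    rcases eq_or_ne j 0 with rfl | h0
    · simp
    · have h1 := Frame.val_one hm
      have h2 : (0 : Fin (m / 2 + 1)) < j := Fin.pos_of_ne_zero h0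
      have h3 : (1 : Fin (m / 2 + 1)) < j := by
        have : j.val ≠ 1 := fun h => hj (Fin.ext (h.trans h1.symm))
        rw [Fin.lt_def] at h2 ⊢
        simp only [h1, Fin.val_zero] at *
        omega
      rw [if_pos h2, if_pos h3, sub_self]
  · simp

theorem reflI_zero (hm : 2 ≤ m) (lam : Weight m) : reflI lam 0 = lam 1 := by
  have h01 := Frame.zero_ne_one hm
  have h1 : lam ⬝ᵥ sigmaI m = lam 0 - lam 1 := by
    simp [sigmaI, basisWeight, dotProduct_sub]
  have h2 : sigmaI m ⬝ᵥ sigmaI m = 2 := by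
    simp [sigmaI, basisWeight, dotProduct_sub, h01, h01.symm]
    norm_num
  rw [reflI, h1, h2]
  simp [sigmaI, basisWeight, h01]

theorem mu_omegaOne_add_omegaLast (hm : 2 ≤ m) : mu (omegaOne m + omegaLast m) = 0 := by
  have h01 := Frame.zero_ne_one hm
  have hr := rho_zero_sub_rho_one hm
  have h : (omegaOne m + omegaLast m) 1 = 1 / 2 := by
    simp [omegaOne, omegaLast, basisWeight, h01.symm]
  rw [mu, evalE, Pi.sub_apply, reflI_zero hm, Pi.add_apply, h]
  linear_combination hr

/-! ### The variation and its infinitesimal invariants -/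

/-- The tensor `f ⊗ v` with `X · v = f(X) ω` is closed, where `v`, `ω` are the classes of `u₂`,
`u₁`. It is not exact, since `v` is not in the image of the root vector of weight `e₁ - e₂`. -/
theorem Frame.exists_infinitesimalInvariant (b : Frame q m) (hm : 2 ≤ m)
    (φ ψ : ComplexCl q →ₗ[ℂ] ℂ) (P : ComplexCl q) (hP : ∀ j, P * b.u j = 0)
    (p : Coh q 3 ℝ →ₗ[ℝ] Coh q 3 ℝ)
    (hp : ∀ g x, p (spinActReal q 3 g x) = spinActReal q 3 g (p x))
    (hne : complexMap p (vectorSpinorForm φ ψ (b.u 0) P) ≠ 0) :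
    ∃ θ : nilp b.J →ₗ[ℂ] Coh q 3 ℂ,
      (∀ X, θ X ∈ complexify (LinearMap.range p) ⊓ hodgePiece b.J (1 : ℤ)) ∧
      (∀ X Y : nilp b.J, cAct q 3 X.1 (θ Y) = cAct q 3 Y.1 (θ X)) ∧
      ¬ ∃ w, ∀ X : nilp b.J, θ X = cAct q 3 X.1 w := by
  set ω := complexMap p (vectorSpinorForm φ ψ (b.u 0) P) with hω
  set v := complexMap p (vectorSpinorForm φ ψ (b.u 1) P) with hv
  have h01 := zero_ne_one hm
  have hu : b.u 0 ≠ 0 := fun h => hne (by rw [hω, h, map_zero, LinearMap.zero_apply, map_zero])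
  obtain ⟨χ, hχ⟩ : ∃ χ : ComplexCl q →ₗ[ℂ] ℂ, χ (b.u 0) ≠ 0 := by
    by_contra! h
    exact hu ((Module.forall_dual_apply_eq_zero_iff ℂ (b.u 0)).1 h)
  set f : nilp b.J →ₗ[ℂ] ℂ := χ ∘ₗ (LinearMap.mulRight ℂ (b.u 1) - LinearMap.mulLeft ℂ (b.u 1)) ∘ₗ
    (evenIncl q).toLinearMap ∘ₗ (nilp b.J).subtype with hf
  have hfX : ∀ X : nilp b.J, f X = χ (evenIncl q X.1 * b.u 1 - b.u 1 * evenIncl q X.1) :=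
    fun X => rfl
  have hact : ∀ X : nilp b.J, cAct q 3 X.1 v = ((χ (b.u 0))⁻¹ * f X) • ω := by
    intro X
    obtain ⟨c, hc⟩ := b.exists_commutator_eq_smul_u hm X.2
    rw [hv, b.cAct_complexMap_of_mem_nilp φ ψ P hP p hp X.2 c hc, hfX, hc, map_smul, smul_eq_mul,
      mul_left_comm, inv_mul_cancel₀ hχ, mul_one]
  refine ⟨f.smulRight v, fun X => ?_, fun X Y => ?_, ?_⟩
  · exact Submodule.smul_mem _ _
      ⟨complexMap_mem p _, b.complexMap_mem_hodgePiece_one φ ψ P hP p hp hm⟩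
  · rw [LinearMap.smulRight_apply, LinearMap.smulRight_apply, map_smul, map_smul, hact, hact,
      smul_smul, smul_smul]
    congr 1
    ring
  · rintro ⟨w, hw⟩
    set X₀ : nilp b.J := ⟨b.rootDiff 0 1, b.rootDiff_mem_nilp hm⟩
    have hplane : planeSgn (1 : Fin (m / 2 + 1)) = -1 := by
      rw [planeSgn, val_one hm, if_neg (by norm_num)]
    have hcomm : evenIncl q X₀.1 * b.u 1 - b.u 1 * evenIncl q X₀.1 = (-4 : ℂ) • b.u 0 := by
      rw [evenIncl_rootDiff, ← mul_assoc, b.u_anticomm 1 0, mul_assoc, neg_mul, mul_assoc,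
        sub_neg_eq_add, ← mul_add, add_comm (b.ubar 1 * b.u 1), b.u_mul_ubar_add, hplane,
        mul_smul_comm, mul_one]
      norm_num
    have hf0 : f X₀ = -4 * χ (b.u 0) := by rw [hfX, hcomm, map_smul, smul_eq_mul]
    have hf0' : f X₀ ≠ 0 := by
      rw [hf0]
      exact mul_ne_zero (by norm_num) hχ
    have hv0 : v = cAct q 3 (b.rootDiff 0 1) ((f X₀)⁻¹ • w) := by
      rw [map_smul, ← hw X₀, LinearMap.smulRight_apply, smul_smul, inv_mul_cancel₀ hf0', one_smul]
    have hweight : cAct q 3 (b.cartan 1) v = (3 / 2 : ℂ) • v := by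
      rw [hv, b.complexMap_cartan φ ψ P hP p hp 1 1, if_pos rfl]
      norm_num
    have hvz := b.eq_zero_of_eq_cAct_rootDiff hm v _ hweight hv0
    have h := hact X₀
    rw [hvz, map_zero] at h
    exact smul_ne_zero (mul_ne_zero (inv_ne_zero hχ) hf0') hne h.symm

/-- The highest weight vector of a frame, transported to a rotated frame. -/
theorem Frame.exists_rotate_vectorSpinorForm (b : Frame q m) (g : spinGroup (realForm q))
    (φ ψ : ComplexCl q →ₗ[ℂ] ℂ) (P : ComplexCl q) (hP : ∀ j, P * b.u j = 0)
    (p : Coh q 3 ℝ →ₗ[ℝ] Coh q 3 ℝ)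
    (hp : ∀ g x, p (spinActReal q 3 g x) = spinActReal q 3 g (p x))
    (hne : complexMap p (vectorSpinorForm φ ψ (b.u 0) P) ≠ 0) :
    ∃ (b' : Frame q m) (P' : ComplexCl q), b'.J = spinToEven g * b.J * spinToEven g⁻¹ ∧
      (∀ j, P' * b'.u j = 0) ∧ complexMap p (vectorSpinorForm φ ψ (b'.u 0) P') ≠ 0 := by
  obtain ⟨b', hJ, hu⟩ := b.exists_rotate_J g
  refine ⟨b', P * clIncl q (star (g : CliffordAlgebra (realForm q))), hJ, fun j => ?_, ?_⟩
  · have h1 := congrArg (clIncl q) (spinGroup.star_mul_self_of_mem g.2)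
    rw [map_mul, map_one] at h1
    rw [hu, ← mul_assoc, ← mul_assoc, mul_assoc P, h1, mul_one, hP, zero_mul]
  · rw [hu, ← spinAct_vectorSpinorForm, complexMap_spinAct p hp]
    intro h
    refine hne ?_
    have h2 := congrArg (spinAct q 3 g⁻¹) h
    rw [map_zero] at h2
    rw [← h2]
    refine AlternatingMap.ext fun x => ?_
    change _ = complexMap p _ fun i => spinToEven g⁻¹ * (spinToEven g⁻¹⁻¹ * x i)
    simp only [← mul_assoc, inv_inv, spinToEven_inv_mul, one_mul]

/-- The domain is a single orbit, so its points come from rotations of any given frame. -/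
theorem Family.exists_rotate_eq (F : Family q m) (b : Frame q m) (hb : b.J ∈ F.domain)
    {J : EvenCl q} (hJ : J ∈ F.domain) :
    ∃ g : spinGroup (realForm q), J = spinToEven g * b.J * spinToEven g⁻¹ := by
  obtain ⟨b₀, h₀⟩ := F.domain_orbit
  rw [h₀] at hb hJ
  obtain ⟨g, hg⟩ := hb
  obtain ⟨h, hh⟩ := hJ
  refine ⟨h * g⁻¹, ?_⟩
  have h1 := spinToEven_inv_mul g
  rw [hh, hg, mul_inv_rev, inv_inv, spinToEven_mul, spinToEven_mul]
  symm
  calc spinToEven h * spinToEven g⁻¹ * (spinToEven g * b₀.J * spinToEven g⁻¹) *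
        (spinToEven g * spinToEven h⁻¹)
      = spinToEven h * (spinToEven g⁻¹ * spinToEven g) * b₀.J * (spinToEven g⁻¹ * spinToEven g) *
        spinToEven h⁻¹ := by simp only [mul_assoc]
    _ = _ := by rw [h1, mul_one, mul_one]

/-- The sub-variation of the third cohomology cut out by an equivariant endomorphism. -/
def rangeSubVHS (F : Family q m) (p : Coh q 3 ℝ →ₗ[ℝ] Coh q 3 ℝ)
    (hp : ∀ g x, p (spinActReal q 3 g x) = spinActReal q 3 g (p x)) : SubVHS F 2 where
  space := LinearMap.range p
  flat γ _ ω hω := by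
    obtain ⟨g, hg⟩ := exists_spinToEven_eq γ
    obtain ⟨x, rfl⟩ := hω
    rw [← hg]
    exact ⟨spinActReal q 3 g x, hp g x⟩
  hodge J hJ := by
    obtain ⟨b₀, h₀⟩ := F.domain_orbit
    rw [h₀] at hJ
    obtain ⟨g, hg⟩ := hJ
    obtain ⟨b', hb', -⟩ := b₀.exists_rotate_J g
    rw [hg, ← hb']
    refine b'.complexify_le_iSup_hodgePiece _ ?_
    rintro g _ ⟨x, rfl⟩
    exact ⟨_, hp g x⟩

/-- A nonzero class of type `(0, 3)` and its conjugate show that the level is `3`. -/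
theorem one_lt_level_rangeSubVHS (F : Family q m) (p : Coh q 3 ℝ →ₗ[ℝ] Coh q 3 ℝ)
    (hp : ∀ g x, p (spinActReal q 3 g x) = spinActReal q 3 g (p x)) (J : EvenCl q)
    (ω : Coh q 3 ℂ) (hω : ω ∈ complexify (LinearMap.range p)) (hω0 : ω ≠ 0)
    (hJ : ω ∈ hodgePiece J (0 : ℤ)) : 1 < (rangeSubVHS F p hp).level J := by
  have hmem : ∀ (η : Coh q 3 ℂ) (a a' : ℤ), η ∈ complexify (LinearMap.range p) →
      η ∈ hodgePiece J a' → a + (2 : ℕ) = a' → η ≠ 0 → (rangeSubVHS F p hp).piece J a ≠ ⊥ := by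
    rintro η a _ h1 h2 rfl h0 hbot
    exact h0 ((Submodule.eq_bot_iff _).1 hbot η ⟨h1, h2⟩)
  have h1 := hmem _ 1 _ (conjCoh_mem_complexify _ _ hω) (conjCoh_mem_hodgePiece hJ) (by norm_num)
    (conjCoh_ne_zero hω0)
  have h2 := hmem _ (-2) _ hω hJ (by norm_num) hω0
  rw [SubVHS.level]
  refine lt_of_lt_of_le (show 1 < 3 by norm_num) (le_csSup ⟨3, fun d hd => ?_⟩ ?_)
  · obtain ⟨a, a', ha, ha', -, -, hd⟩ := hd
    rw [Set.mem_Icc] at ha ha'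
    push_cast at ha ha'
    omega
  · exact ⟨1, -2, by norm_num, by norm_num, h1, h2, by norm_num⟩

end Clifford

end

end KugaSatake

open KugaSatake in
theorem mainTheorem8 {V : Type*} [AddCommGroup V] [Module ℚ V] (q : QuadraticForm ℚ V)
    (m : ℕ) (hm : 7 ≤ m) (F : KugaSatake.Family q m)
    (b : KugaSatake.Frame q m) (hb : b.J ∈ F.domain) :
    0 ≤ KugaSatake.mu (KugaSatake.omegaOne m + KugaSatake.omegaLast m) ∧
    ∃ W : KugaSatake.SubVHS F 2,
      W.IsIrreducibleHomogeneous ∧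
      W.HasHighestWeight b (KugaSatake.omegaOne m + KugaSatake.omegaLast m) ∧
      (∀ J ∈ F.domain, 1 < W.level J) ∧
      ∃ j : ℕ, (j : ℚ) = KugaSatake.mu (KugaSatake.omegaOne m + KugaSatake.omegaLast m) ∧
        ∀ J ∈ F.domain, W.InfinitesimalInvariantsNonzero J j := by
  have hm2 : 2 ≤ m := by omega
  have := b.finiteDimensional_coh 3
  obtain ⟨P, hP0, hP⟩ := b.exists_mul_u_eq_zero
  obtain ⟨φ, ψ, hne⟩ := b.exists_vectorSpinorForm_ne_zero hm P hP0 hP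
  -- an equivariant `p` with irreducible range that does not kill the highest weight vector
  obtain ⟨p, hpne, hp, hbot, hirr⟩ := exists_equivariant_irreducible_range (spinActReal q 3)
    b.exists_isCompl_spinStable (fun p => complexMap p (vectorSpinorForm φ ψ (b.u 0) P) ≠ 0)
    (fun h => h (complexMap_zero _)) (by rwa [complexMap_id]) (fun p p' h => by
      by_contra! h'
      exact h (by rw [complexMap_add, h'.1, h'.2, add_zero]))
  rw [mu_omegaOne_add_omegaLast hm2]
  refine ⟨le_rfl, rangeSubVHS F p hp, ⟨?_, hbot, fun U hU hUst => hirr U hU hUst⟩,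
    ⟨_, complexMap_mem p _, b.isHighestWeightVector_of_complexMap φ ψ P hP p hp hpne⟩,
    fun J hJ => ?_, 0, Nat.cast_zero, fun J hJ => ?_⟩
  · rintro g _ ⟨x, rfl⟩
    exact ⟨_, hp g x⟩
  · obtain ⟨g, rfl⟩ := F.exists_rotate_eq b hb hJ
    obtain ⟨b', P', hJ', hP', hne'⟩ := b.exists_rotate_vectorSpinorForm g φ ψ P hP p hp hpne
    rw [← hJ']
    exact one_lt_level_rangeSubVHS F p hp _ _ (complexMap_mem p _) hne'
      (b'.complexMap_mem_hodgePiece_zero φ ψ P' hP' p hp)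
  · obtain ⟨g, rfl⟩ := F.exists_rotate_eq b hb hJ
    obtain ⟨b', P', hJ', hP', hne'⟩ := b.exists_rotate_vectorSpinorForm g φ ψ P hP p hp hpne
    rw [← hJ']
    obtain ⟨θ, h1, h2, h3⟩ :=
      b'.exists_infinitesimalInvariant hm2 φ ψ P' hP' p hp hne'
    exact ⟨θ, h1, h2, fun ⟨w, _, hw⟩ => h3 ⟨w, hw⟩⟩
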